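/- \textbf{Theorem (Robinson inflation).} Let $\mathcal{P}$ be a finite set of marked unit squares, each with a base point in its interior. Let $\mathcal{T}$ be an aperiodic and repetitive planar tiling by translated copies of elements of $\mathcal{P}$ touching face-to-face. Let $\mathbb{X}$ be its continuous hull, i.e. the closure, in the Gromov--Hausdorff topology, of the set of its translates, and let $X\subset\mathbb{X}$ be the total transversal of those tilings having the origin as base point of a tile. Let $\mathcal{B}$ be a well-adapted box decomposition of $\mathbb{X}$. Then there is an integer $K$ such that, for every sequence of integers $N_1,N_2,\dots\geq 0$ with $N_1\geq K$ and $N_{n+1}\geq K N_n$ for all $n\geq 1$, there is a sequence of well-adapted box decompositions $\mathcal{B}''_n$ $(n\ge 0)$ of $\mathbb{X}$ such that $\mathcal{B}''_0=\mathcal{B}$ and, for every $n\geq 0$, $\mathcal{B}''_{n+1}$ is obtained from $\mathcal{B}''_n$ by Robinson inflation with squares of side $N_{n+1}$. \emph{Box decompositions.} A (well-adapted, closed) flow box is a set $\{S-v \mid S\in C,\ v\in \mathbb{P}\}\subset\mathbb{X}$, where the transversal $C\neq\emptyset$ is clopen in $X$, the plaque $\mathbb{P}\ni 0$ is the union of a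 finite patch of marked tiles that belongs to all $S\in C$, and $(v,S)\mapsto S-v$ is an embedding of $\mathbb{P}\times C$; its vertical boundary is $\{S-v\mid S\in C,\ v\in\partial\mathbb{P}\}$, and its transversals are the sets $\{S-v\mid S\in C\}$, $v\in\mathbb{P}$. A partial box decomposition is a finite family of flow boxes with disjoint interiors; it is a box decomposition if the boxes cover $\mathbb{X}$. Its plaques tile (in the partial case: pack) each leaf, i.e. the plane tiled by any $S\in\mathbb{X}$. A box decomposition $\mathcal{B}'$ is inflated from $\mathcal{B}$ if (i) whenever a tiling lies in a box of $\mathcal{B}$ and in a box of $\mathcal{B}'$, the transversal of the latter through it is contained in the transversal of the former; (ii) the union of the vertical boundaries of the boxes of $\mathcal{B}'$ is contained in that of $\mathcal{B}$; (iii) in each leaf, every plaque of $\mathcal{B}'$ contains a plaque of $\mathcal{B}$ in its interior. \emph{Arms and crosses.} Consider a partial box decomposition whose plaques are squares of side $N$ and which is maximal: in each leaf, every square of side $N$ has an interior point in common with the interior of some plaque. Fix a leaf. A square $\mathbb{Q}$ faces an edge of a square $\mathbb{P}$ if orthogonal segments starting from a subset of positive length of this edge, outside $\mathbb{P}$, join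 it to $\mathbb{Q}$; their common length is the orthogonal distance. $\mathbb{Q}$ is a neighbor of $\mathbb{P}$ if it realizes the minimal orthogonal distance from some edge of $\mathbb{P}$ to the squares facing this edge. If $\mathbb{Q}$ is a neighbor of $\mathbb{P}$ or conversely, the union of the orthogonal segments joining the two facing edges is an arm; its axis, parallel to and equidistant from these edges, divides it into two half-arms, one attached to each square. The connected components of the complement of the union of all squares and arms are the crosses. The middle point of the intersection of an arm with (the closure of) a cross $C$, when this intersection is a segment or a point, is an exit point of $C$. The connected components of $C$ minus the union of the segments joining its center of mass to its exit points are the cross-sectors. For a square $\mathbb{P}$, let $\mathbb{P}'$ be the union of $\mathbb{P}$, the half-arms attached to $\mathbb{P}$, and the closures of the cross-sectors whose closure meets $\mathbb{P}$. \emph{Robinson inflation.} Let $\mathbb{P}''$ be the union of the plaques $t$ of $\mathcal{B}$ in the leaf such that the interior of $t$ meets $\mathbb{P}'$ and $\mathbb{P}$ has the highest priority among the squares $\mathbb{Q}$ for which the interior of $t$ meets $\mathbb{Q}'$; priority goes right and upward, i.e. it increases with $x+y$ and, in case of equality, with $x$, where $(x,y)$ is the lower left corner of the square. A box decomposition $\mathcal{B}'$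 is obtained from $\mathcal{B}$ by Robinson inflation with squares of side $N$ if $\mathcal{B}'$ is inflated from $\mathcal{B}$ and there is a maximal partial box decomposition as above, with squares of side $N$, such that in each leaf the plaques of $\mathcal{B}'$ are exactly the sets $\mathbb{P}''$. -/

import Mathlib

open Set MeasureTheory

noncomputable section

namespace RobinsonTiling

/-! ### Tilings of the plane by marked unit squares -/

/-- The plane; its distance is the max-distance. -/
abbrev Plane : Type := Fin 2 → ℝ

/-- The closed axis-parallel square of side `s` with lower left corner `p`. -/
def square (s : ℝ) (p : Plane) : Set Plane := Icc p (fun i => p i + s)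

/-- A planar tiling by unit squares touching face-to-face and marked by elements of `A`, i.e. a
tiling by translated copies of the prototiles `(unit square, mark a)`. The pair `(p, a)` is the
tile with mark `a` and lower left corner `p`. Squares of side one touching face-to-face are exactly
the cells of a translate of the standard square lattice. -/
@[ext]
structure Tiling (A : Type*) where
  tiles : Set (Plane × A)
  lattice : ∃ (s : Plane) (f : (Fin 2 → ℤ) → A),
    tiles = range (fun m : Fin 2 → ℤ => ((s + fun i => (m i : ℝ), f m) : Plane × A))

namespace Tiling

variable {A : Type*}

/-- The translated tiling `T + v`. -/
def translate (T : Tiling A) (v : Plane) : Tiling A where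
  tiles := {t | (t.1 - v, t.2) ∈ T.tiles}
  lattice := by
    obtain ⟨s, f, h⟩ := T.lattice
    refine ⟨s + v, f, ?_⟩
    ext ⟨x, a⟩
    simp only [h, mem_ofPred_eq, mem_range, Prod.mk.injEq]
    constructor
    · rintro ⟨m, hm, ha⟩
      exact ⟨m, by rw [add_right_comm, hm, sub_add_cancel], ha⟩
    · rintro ⟨m, hm, ha⟩
      exact ⟨m, by rw [← hm, add_right_comm, add_sub_cancel_right], ha⟩

/-- `T` and `T'` coincide on the ball `B(0, R)`: the same tiles meet this ball. -/
def CoincideOn (T T' : Tiling A) (R : ℝ) : Prop :=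
  ∀ t : Plane × A, (square 1 t.1 ∩ Metric.ball 0 R).Nonempty → (t ∈ T.tiles ↔ t ∈ T'.tiles)

/-- The basic neighborhood of `T` with parameters `r`, `ε`, `ε'`. -/
def basicNhd (T : Tiling A) (r ε ε' : ℝ) : Set (Tiling A) :=
  {T' | ∃ v v' : Plane, ‖v‖ < ε ∧ ‖v'‖ < ε' ∧
    ∃ R > r, CoincideOn (T.translate v) (T'.translate v') R}

/-- The Gromov-Hausdorff topology on the space of tilings. -/
instance : TopologicalSpace (Tiling A) :=
  TopologicalSpace.generateFrom
    {U | ∃ (T : Tiling A) (r ε ε' : ℝ), 0 < r ∧ 0 < ε ∧ 0 < ε' ∧ U = basicNhd T r ε ε'}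

/-- No translation symmetries. -/
def Aperiodic (T : Tiling A) : Prop := ∀ v : Plane, T.translate v = T → v = 0

/-- Every patch `M` of `T` has a translated copy in each ball of a suitable radius. -/
def Repetitive (T : Tiling A) : Prop :=
  ∀ M : Set (Plane × A), M.Finite → M ⊆ T.tiles → ∃ R > 0, ∀ x : Plane, ∃ w : Plane,
    ∀ t ∈ M, (t.1 + w, t.2) ∈ T.tiles ∧ square 1 (t.1 + w) ⊆ Metric.ball x R

/-- The continuous hull of `T`: the closure of its orbit under translations. -/
def hull (T : Tiling A) : Set (Tiling A) := closure (range T.translate)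

end Tiling

/-! ### Flow boxes and box decompositions -/

section Boxes

variable {A : Type*}

/-- The total transversal of `Ω` given by the base points `β a` of the prototiles (relative to
their lower left corners): the tilings in `Ω` having the origin as base point of a tile. -/
def totalTransversal (β : A → Plane) (Ω : Set (Tiling A)) : Set (Tiling A) :=
  {T | T ∈ Ω ∧ ∃ a, (-β a, a) ∈ T.tiles}

/-- A finite family of well-adapted closed flow boxes in `Ω` with disjoint interiors (a partial
box decomposition). The `i`-th box is `{T - v | T ∈ trans i, v ∈ plaque i}`; it is identified with
`plaque i × trans i` by `(v, T) ↦ T - v`, its transversal is clopen in the total transversal and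
its plaque is a patch of marked tiles. -/
structure FlowBoxFamily (β : A → Plane) (Ω : Set (Tiling A)) where
  card : ℕ
  plaque : Fin card → Set Plane
  trans : Fin card → Set (Tiling A)
  trans_nonempty : ∀ i, (trans i).Nonempty
  trans_subset : ∀ i, trans i ⊆ totalTransversal β Ω
  trans_isClopen : ∀ i, IsClopen {T : totalTransversal β Ω | T.1 ∈ trans i}
  zero_mem : ∀ i, 0 ∈ plaque i
  isPatch : ∀ i, ∃ M : Set (Plane × A), M.Finite ∧ plaque i = ⋃ t ∈ M, square 1 t.1 ∧
    ∀ T ∈ trans i, M ⊆ T.tiles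
  isEmbedding : ∀ i, Topology.IsEmbedding
    (fun z : plaque i × trans i => z.2.1.translate (-z.1.1))
  disjoint_interior : ∀ i j, i ≠ j → Disjoint
    (interior {S : Ω | ∃ T ∈ trans i, ∃ v ∈ plaque i, S.1 = T.translate (-v)})
    (interior {S : Ω | ∃ T ∈ trans j, ∃ v ∈ plaque j, S.1 = T.translate (-v)})

namespace FlowBoxFamily

variable {β : A → Plane} {Ω : Set (Tiling A)}

/-- The `i`-th flow box. -/
def box (B : FlowBoxFamily β Ω) (i : Fin B.card) : Set (Tiling A) :=
  {S | ∃ T ∈ B.trans i, ∃ v ∈ B.plaque i, S = T.translate (-v)}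

/-- The transversal of the `i`-th box at the point `v` of its plaque. -/
def transversalAt (B : FlowBoxFamily β Ω) (i : Fin B.card) (v : Plane) : Set (Tiling A) :=
  (fun T => T.translate (-v)) '' B.trans i

/-- The vertical boundary of the `i`-th box. -/
def verticalBoundary (B : FlowBoxFamily β Ω) (i : Fin B.card) : Set (Tiling A) :=
  {S | ∃ T ∈ B.trans i, ∃ v ∈ frontier (B.plaque i), S = T.translate (-v)}

/-- A (complete, well-adapted) box decomposition: the boxes cover `Ω`. -/
def IsBoxDecomposition (B : FlowBoxFamily β Ω) : Prop := ⋃ i, B.box i = Ω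

/-- The plaques of `B` in the leaf of `T`, seen as subsets of the plane tiled by `T`. -/
def plaquesOn (B : FlowBoxFamily β Ω) (T : Tiling A) : Set (Set Plane) :=
  {Q | ∃ (i : Fin B.card) (u : Plane), T.translate (-u) ∈ B.trans i ∧
    Q = (fun x => u + x) '' B.plaque i}

/-- `B'` is inflated from `B`. -/
structure IsInflatedFrom (B' B : FlowBoxFamily β Ω) : Prop where
  transversal_subset : ∀ (T : Tiling A) (j : Fin B'.card) (i : Fin B.card),
    ∀ w ∈ B'.plaque j, ∀ v ∈ B.plaque i, T ∈ B'.transversalAt j w → T ∈ B.transversalAt i v →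
      B'.transversalAt j w ⊆ B.transversalAt i v
  verticalBoundary_subset : ⋃ j, B'.verticalBoundary j ⊆ ⋃ i, B.verticalBoundary i
  exists_plaque_subset_interior : ∀ T ∈ Ω, ∀ Q ∈ B'.plaquesOn T,
    ∃ R ∈ B.plaquesOn T, R ⊆ interior Q

end FlowBoxFamily

end Boxes

/-! ### Arms and crosses of a family of squares

Below, `V` is the set of lower left corners of a family of squares of side `N` in the plane,
`k : Fin 2` is one of the two coordinate directions and `k + 1` is the other one. -/

/-- There is room for no other square of side `N`. -/
def IsMaximalFamily (V : Set Plane) (N : ℝ) : Prop :=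
  ∀ q : Plane, ∃ p ∈ V, (interior (square N p) ∩ interior (square N q)).Nonempty

/-- The square at `q` faces the square at `p` in the positive direction `k`: segments in this
direction (of length `q k - (p k + N)`) join an edge of the latter to the former. -/
def Faces (N : ℝ) (k : Fin 2) (p q : Plane) : Prop :=
  p k + N ≤ q k ∧ |q (k + 1) - p (k + 1)| < N

/-- The squares at `p` and `q` bound an arm in direction `k`: `q` is the neighbor of `p` (one of
the nearest squares facing the corresponding edge of `p`), or `p` is the neighbor of `q`. -/
def HasArm (V : Set Plane) (N : ℝ) (k : Fin 2) (p q : Plane) : Prop :=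
  p ∈ V ∧ q ∈ V ∧ Faces N k p q ∧
    ((∀ r ∈ V, Faces N k p r → q k ≤ r k) ∨ (∀ r ∈ V, Faces N k r q → r k ≤ p k))

/-- The arm: the union of the orthogonal segments joining the two squares. -/
def arm (N : ℝ) (k : Fin 2) (p q : Plane) : Set Plane :=
  {x | p k + N ≤ x k ∧ x k ≤ q k ∧ max (p (k + 1)) (q (k + 1)) ≤ x (k + 1) ∧
    x (k + 1) ≤ min (p (k + 1)) (q (k + 1)) + N}

/-- The part of the arm between the square at `p` and the axis of the arm. -/
def lowerHalfArm (N : ℝ) (k : Fin 2) (p q : Plane) : Set Plane :=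
  {x | x ∈ arm N k p q ∧ x k ≤ (p k + N + q k) / 2}

/-- The part of the arm between the axis of the arm and the square at `q`. -/
def upperHalfArm (N : ℝ) (k : Fin 2) (p q : Plane) : Set Plane :=
  {x | x ∈ arm N k p q ∧ (p k + N + q k) / 2 ≤ x k}

/-- The complement of the union of the squares and the arms. -/
def freeSpace (V : Set Plane) (N : ℝ) : Set Plane :=
  {x | (∀ p ∈ V, x ∉ square N p) ∧ ∀ k p q, HasArm V N k p q → x ∉ arm N k p q}

/-- `C` is a connected component of `S`. -/
def IsComponent (S C : Set Plane) : Prop := ∃ x ∈ S, C = connectedComponentIn S x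

/-- A (non-degenerate) cross; the degenerate ones have empty interior, they lie in arms, and they
contribute nothing to the sets defined below. -/
def IsCross (V : Set Plane) (N : ℝ) (C : Set Plane) : Prop := IsComponent (freeSpace V N) C

/-- The exit points of a cross: the middle points of its intersections with the arms. -/
def exitPoints (V : Set Plane) (N : ℝ) (C : Set Plane) : Set Plane :=
  {e | ∃ k p q, HasArm V N k p q ∧ ∃ a b, closure C ∩ arm N k p q = segment ℝ a b ∧
    e = midpoint ℝ a b}

/-- The center of mass. -/
def centerOfMass (C : Set Plane) : Plane := ⨍ x in C, x

/-- The decoration of a cross: its center of mass joined to its exit points. -/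
def decoration (V : Set Plane) (N : ℝ) (C : Set Plane) : Set Plane :=
  ⋃ e ∈ exitPoints V N C, segment ℝ (centerOfMass C) e

/-- The (open) cross-sectors: the regions into which the decoration separates a cross. -/
def IsCrossSector (V : Set Plane) (N : ℝ) (U : Set Plane) : Prop :=
  ∃ C, IsCross V N C ∧ IsComponent (C \ decoration V N C) U

/-- The union of the square at `p` with its half-arms and the (closed) cross-sectors meeting it. -/
def enlarged (V : Set Plane) (N : ℝ) (p : Plane) : Set Plane :=
  {x | x ∈ square N p ∨
    (∃ k q, HasArm V N k p q ∧ x ∈ lowerHalfArm N k p q) ∨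
    (∃ k q, HasArm V N k q p ∧ x ∈ upperHalfArm N k q p) ∨
    ∃ U, IsCrossSector V N U ∧ (closure U ∩ square N p).Nonempty ∧ x ∈ closure U}

/-- The priority of squares: the square at `q` comes further right and upward than that at `p`. -/
def RightUp (p q : Plane) : Prop :=
  p 0 + p 1 < q 0 + q 1 ∨ (p 0 + p 1 = q 0 + q 1 ∧ p 0 ≤ q 0)

/-- The inflated tile of the square at `p`, made of elements of a tiling `τ` of the plane: every
element of `τ` is included in the enlarged square that it meets, and the ones that meet several
enlarged squares go right and upward. -/
def inflatedTile (τ : Set (Set Plane)) (V : Set Plane) (N : ℝ) (p : Plane) : Set Plane :=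
  ⋃ t ∈ {t ∈ τ | (interior t ∩ enlarged V N p).Nonempty ∧
    ∀ q ∈ V, (interior t ∩ enlarged V N q).Nonempty → RightUp q p}, t

/-! ### Robinson inflation -/

section Inflation

variable {A : Type*} {β : A → Plane} {Ω : Set (Tiling A)}

/-- The lower left corners of the plaques in the leaf of `T`, for boxes whose plaques are squares
of side `N`. -/
def FlowBoxFamily.corners (F : FlowBoxFamily β Ω) (N : ℝ) (T : Tiling A) : Set Plane :=
  {p | square N p ∈ F.plaquesOn T}

/-- A partial box decomposition whose plaques are squares of side `N` and which is maximal, i.e.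
in each leaf there is room for no other square of side `N`. -/
def FlowBoxFamily.IsMaximalSquareFamily (F : FlowBoxFamily β Ω) (N : ℝ) : Prop :=
  (∀ i, ∃ p, F.plaque i = square N p) ∧ ∀ T ∈ Ω, IsMaximalFamily (F.corners N T) N

/-- `B'` is obtained from `B` by Robinson inflation with squares of side `N`. -/
def IsRobinsonInflation (B B' : FlowBoxFamily β Ω) (N : ℝ) : Prop :=
  B'.IsInflatedFrom B ∧
    ∃ F : FlowBoxFamily β Ω, F.IsMaximalSquareFamily N ∧
      ∀ T ∈ Ω, B'.plaquesOn T =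
        inflatedTile (B.plaquesOn T) (F.corners N T) N '' F.corners N T

end Inflation

end RobinsonTiling

end

/-! A tiling is a configuration of marks on ℤ² together with an offset of the lattice, and the hull
corresponds to the orbit closure of one configuration. By compactness a clopen transversal is
recognized by finite windows, so a box decomposition is a local rule: a bounded window around a cell
decides whether the cell is the center of a plaque and which cells the plaque contains. Conversely,
a local rule with disjoint plaques yields flow boxes (`LocalPlaques.exists_family`). The required
injectivity comes from a uniform form of aperiodicity: in the whole hull, bounded nonzero
translations are detected in a fixed window (`exists_forall_eq_zero`). The same fact lets a greedy
choice along a finite coloring select a maximal family of squares of side `N` by a local rule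
(`exists_square_family`).

The geometric core is that the sets P'' use up every plaque of the old decomposition. For this the
enlarged squares must be dense, hence every cross-sector must touch a square. Each cross lies in a
rectangle bounded by at most four squares and by arms joining them, and within this rectangle only
squares are removed from the free space (`Packing.hasCell`, `SquarePacking.exists_crossFrame`).
Suppose that the closure of a sector met no square. A ray from the center of mass would lead from
the sector to an opening of the rectangle. From there the sector would spread along the opening in
both directions until the decoration stops it, so exit points would be met on both sides; but one
arm has only one exit point (`CrossFrame.sector_meets`).

The rectangles have sides at most `2 * N`, so an enlarged square depends only on the squares within
`11 * N` (`Agree.enlarged_eq`), and the inflated tiles obey a local rule. The priority order makes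
them disjoint. The middle of each square is kept by its own tile, so a tile swallows a whole old
plaque once `N` is large compared with the radius `d` of the old plaques; `8 * d + 20 ≤ N` suffices.
The new plaques have radius at most `4 * N + 1`, again proportional to the side, which allows the
iteration with a constant `K`. -/

namespace RobinsonTiling

/-! ### Maximal packings by squares and their arms -/

section PlanarPackings

variable {ι : Type*}

/-- A locally finite maximal packing of the plane by squares of side `N`; the square `p ∈ V` has
lower left corner `(x p, y p)`. -/
structure Packing (V : Set ι) (N : ℝ) (x y : ι → ℝ) : Prop where
  pos : 0 < N
  disj : ∀ p ∈ V, ∀ q ∈ V, p ≠ q →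
    x p + N ≤ x q ∨ x q + N ≤ x p ∨ y p + N ≤ y q ∨ y q + N ≤ y p
  maxl : ∀ u v : ℝ, ∃ p ∈ V, x p < u + N ∧ u < x p + N ∧ y p < v + N ∧ v < y p + N
  fin : ∀ u v R : ℝ, {p ∈ V | |x p - u| ≤ R ∧ |y p - v| ≤ R}.Finite

/-- The square `q` faces the square `p` on its right. -/
def Fc (N : ℝ) (x y : ι → ℝ) (p q : ι) : Prop :=
  x p + N ≤ x q ∧ y q < y p + N ∧ y p < y q + N

/-- The square `q` faces the square `p` on its right, at a distance smaller than the side. -/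
def HL (N : ℝ) (x y : ι → ℝ) (p q : ι) : Prop :=
  x p + N ≤ x q ∧ x q < x p + 2 * N ∧ y q < y p + N ∧ y p < y q + N

/-- There is an arm between the square `p` and the square `q` on its right. -/
def Arm (V : Set ι) (N : ℝ) (x y : ι → ℝ) (p q : ι) : Prop :=
  p ∈ V ∧ q ∈ V ∧ Fc N x y p q ∧
    ((∀ r ∈ V, Fc N x y p r → x q ≤ x r) ∨ (∀ r ∈ V, Fc N x y r q → x r ≤ x p))

variable {V : Set ι} {N : ℝ} {x y : ι → ℝ}

theorem Packing.cases (h : Packing V N x y) {p q : ι} (hp : p ∈ V) (hq : q ∈ V) :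
    (x p = x q ∧ y p = y q) ∨
    x p + N ≤ x q ∨ x q + N ≤ x p ∨ y p + N ≤ y q ∨ y q + N ≤ y p := by
  by_cases e : p = q
  · subst e; simp
  · exact Or.inr (h.disj p hp q hq e)

theorem Packing.eq_of (h : Packing V N x y) {p q : ι} (hp : p ∈ V) (hq : q ∈ V)
    (h1 : x p < x q + N) (h2 : x q < x p + N) (h3 : y p < y q + N) (h4 : y q < y p + N) :
    p = q := by
  by_contra e
  rcases h.disj p hp q hq e with e | e | e | e <;> linarith

theorem Packing.swap (h : Packing V N x y) : Packing V N y x where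
  pos := h.pos
  disj p hp q hq e := by
    rcases h.disj p hp q hq e with e | e | e | e <;> simp [e]
  maxl u v := by
    obtain ⟨p, hp, h1, h2, h3, h4⟩ := h.maxl v u
    exact ⟨p, hp, h3, h4, h1, h2⟩
  fin u v R := (h.fin v u R).subset fun _ hp => ⟨hp.1, hp.2.2, hp.2.1⟩

/-- The mirror image of the square `[x, x + N]` has left end `-x - N`. This symmetry, with `swap`,
reduces the four directions to one. -/
theorem Packing.reflect (h : Packing V N x y) : Packing V N (fun p => -x p - N) y where
  pos := h.pos
  disj p hp q hq e := by
    rcases h.disj p hp q hq e with e | e | e | e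
    · exact Or.inr (Or.inl (by linarith))
    · exact Or.inl (by linarith)
    · exact Or.inr (Or.inr (Or.inl e))
    · exact Or.inr (Or.inr (Or.inr e))
  maxl u v := by
    obtain ⟨p, hp, h1, h2, h3, h4⟩ := h.maxl (-u - N) v
    exact ⟨p, hp, by linarith, by linarith, h3, h4⟩
  fin u v R := (h.fin (-u - N) v R).subset fun p hp => ⟨hp.1, by
    have := hp.2.1
    rw [← abs_neg] at this
    convert this using 2
    ring, hp.2.2⟩

theorem arm_reflect {p q : ι} :
    Arm V N (fun p => -x p - N) y p q ↔ Arm V N x y q p := by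
  unfold Arm Fc
  constructor
  · rintro ⟨h1, h2, ⟨h3, h4, h5⟩, h6⟩
    refine ⟨h2, h1, ⟨by linarith, h5, h4⟩, ?_⟩
    rcases h6 with h6 | h6
    · exact Or.inr fun r hr h7 => by
        have := h6 r hr ⟨by linarith, h7.2.2, h7.2.1⟩
        linarith
    · exact Or.inl fun r hr h7 => by
        have := h6 r hr ⟨by linarith, h7.2.2, h7.2.1⟩
        linarith
  · rintro ⟨h1, h2, ⟨h3, h4, h5⟩, h6⟩
    refine ⟨h2, h1, ⟨by linarith, h5, h4⟩, ?_⟩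
    rcases h6 with h6 | h6
    · exact Or.inr fun r hr h7 => by
        have := h6 r hr ⟨by linarith, h7.2.2, h7.2.1⟩
        linarith
    · exact Or.inl fun r hr h7 => by
        have := h6 r hr ⟨by linarith, h7.2.2, h7.2.1⟩
        linarith

theorem hl_reflect {p q : ι} : HL N (fun p => -x p - N) y p q ↔ HL N x y q p := by
  unfold HL
  constructor <;> rintro ⟨h1, h2, h3, h4⟩ <;> exact ⟨by linarith, by linarith, h4, h3⟩

theorem hl_reflect_swap {p q : ι} : HL N y (fun p => -x p - N) p q ↔ HL N y x p q := by
  unfold HL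
  constructor <;> rintro ⟨h1, h2, h3, h4⟩ <;> exact ⟨h1, h2, by linarith, by linarith⟩

theorem arm_reflect_swap {p q : ι} :
    Arm V N y (fun p => -x p - N) p q ↔ Arm V N y x p q := by
  have : ∀ p q, Fc N y (fun p => -x p - N) p q ↔ Fc N y x p q := by
    intro p q
    unfold Fc
    constructor <;> rintro ⟨h1, h2, h3⟩ <;> exact ⟨h1, by linarith, by linarith⟩
  unfold Arm
  simp only [this]

/-- The finite set of squares within distance `4 * N` of a given one contains an extremal element
for any predicate. -/
theorem Packing.exists_min (h : Packing V N x y) (p : ι) (P : ι → Prop) (g : ι → ℝ)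
    (hP : ∀ q ∈ V, P q → |x q - x p| ≤ 4 * N ∧ |y q - y p| ≤ 4 * N) (hne : ∃ q ∈ V, P q) :
    ∃ q ∈ V, P q ∧ ∀ r ∈ V, P r → g q ≤ g r := by
  have hf : {q | q ∈ V ∧ P q}.Finite :=
    (h.fin (x p) (y p) (4 * N)).subset fun q hq => ⟨hq.1, hP q hq.1 hq.2⟩
  obtain ⟨q, hq, hq'⟩ := hf.exists_minimalFor g _ hne
  refine ⟨q, hq.1, hq.2, fun r hr hr' => ?_⟩
  by_contra! hlt
  exact absurd (hq' ⟨hr, hr'⟩ hlt.le) (not_le.2 hlt)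

/-- A test square glued to the right edge of `p` overlaps a member of the packing by maximality.
This member is disjoint from `p`, hence faces it at distance less than `N`. All arms are therefore
shorter than `N`. -/
theorem Packing.exists_nearest (h : Packing V N x y) {p : ι} (hp : p ∈ V) :
    ∃ q ∈ V, HL N x y p q ∧ ∀ r ∈ V, Fc N x y p r → x q ≤ x r := by
  have hN := h.pos
  obtain ⟨q, hq, hpq, hmin⟩ := h.exists_min p (HL N x y p) x
    (fun q _ ⟨h1, h2, h3, h4⟩ => ⟨abs_le.2 ⟨by linarith, by linarith⟩,
      abs_le.2 ⟨by linarith, by linarith⟩⟩) <| by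
    obtain ⟨q, hq, h1⟩ := h.maxl (x p + N) (y p)
    refine ⟨q, hq, ?_⟩
    have := h.cases hp hq
    unfold HL
    grind
  refine ⟨q, hq, hpq, fun r hr hr' => ?_⟩
  by_contra! hlt
  have := hmin r hr ⟨hr'.1, by linarith [hpq.2.1], hr'.2⟩
  linarith

theorem Packing.arm_hl (h : Packing V N x y) {p q : ι} (ha : Arm V N x y p q) : HL N x y p q := by
  obtain ⟨hp, hq, ⟨h1, h2, h3⟩, h4 | h4⟩ := ha
  · obtain ⟨r, hr, h5, h6⟩ := h.exists_nearest hp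
    exact ⟨h1, (h4 r hr ⟨h5.1, h5.2.2⟩).trans_lt h5.2.1, h2, h3⟩
  · obtain ⟨r, hr, h5, h6⟩ := h.reflect.exists_nearest hq
    rw [hl_reflect] at h5
    have := h4 r hr ⟨h5.1, h5.2.2⟩
    exact ⟨h1, by linarith [h5.2.1], h2, h3⟩

/-- A pair of close facing squares which is not joined by an arm is crossed by two other squares
in a pinwheel. -/
theorem Packing.exists_of_not_arm (h : Packing V N x y) {p q : ι} (hp : p ∈ V) (hq : q ∈ V)
    (hl : HL N x y p q) (hn : ¬ Arm V N x y p q) :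
    ∃ r ∈ V, ∃ s ∈ V, Arm V N x y p r ∧ Arm V N x y s q ∧ x r < x q ∧ x p < x s ∧
      ((y q + N ≤ y r ∧ y s + N ≤ y p) ∨ (y r + N ≤ y q ∧ y p + N ≤ y s)) := by
  have hN := h.pos
  obtain ⟨r, hr, h1, h2⟩ := h.exists_nearest hp
  obtain ⟨s, hs, h3, h4⟩ := h.reflect.exists_nearest hq
  rw [hl_reflect] at h3
  have h4' : ∀ r ∈ V, Fc N x y r q → x r ≤ x s := fun r hr hr' => by
    have := h4 r hr ⟨by linarith [hr'.1], hr'.2.2, hr'.2.1⟩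
    linarith
  have A1 : Arm V N x y p r := ⟨hp, hr, ⟨h1.1, h1.2.2⟩, Or.inl h2⟩
  have A2 : Arm V N x y s q := ⟨hs, hq, ⟨h3.1, h3.2.2⟩, Or.inr h4'⟩
  have h5 : x r < x q := by
    by_contra! h5
    exact hn ⟨hp, hq, ⟨hl.1, hl.2.2⟩, Or.inl fun t ht ht' => h5.trans (h2 t ht ht')⟩
  have h6 : x p < x s := by
    by_contra! h6
    exact hn ⟨hp, hq, ⟨hl.1, hl.2.2⟩, Or.inr fun t ht ht' => (h4' t ht ht').trans h6⟩
  -- Disjointness puts `r` above or below `q`, and `s` above or below `p`. The same side for both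
  -- would give contradictory comparisons of `y p` and `y q`.
  refine ⟨r, hr, s, hs, A1, A2, h5, h6, ?_⟩
  have e1 := h.cases hr hq
  have e2 := h.cases hs hp
  have e3 := h.cases hr hs
  clear hn A1 A2 h2 h4 h4'
  unfold HL at *
  grind (splits := 40)

/-- A vertical arm does not cross the gap between two squares facing each other horizontally. -/
theorem Packing.no_cross (h : Packing V N x y) {a b p q : ι} (ha : a ∈ V) (hb : b ∈ V)
    (hab : HL N x y a b) (hpq : Arm V N y x p q) {X : ℝ} (h1 : x a + N < X) (h2 : X < x b)
    (h3 : x p < X) (h4 : X < x p + N) (h5 : x q < X) (h6 : X < x q + N)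
    (h7 : y p + N < max (y a) (y b)) (h8 : max (y a) (y b) ≤ y q) : False := by
  have hN := h.pos
  have hl := h.swap.arm_hl hpq
  obtain ⟨hp, hq, hf, h9⟩ := hpq
  have e1 := h.cases hp ha
  have e2 := h.cases hp hb
  have e3 := h.cases hq ha
  have e4 := h.cases hq hb
  -- The gap is narrower than `N`, so each of `p` and `q` overlaps `a` or `b` horizontally. This
  -- conflicts either with disjointness or with the choice of a nearest square.
  rcases h9 with h9 | h9
  · have e5 := h9 a ha
    have e6 := h9 b hb
    clear h9
    unfold Fc HL at *
    rcases le_total (y a) (y b) with hab' | hab'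
    · rw [max_eq_right hab'] at *
      grind (splits := 40)
    · rw [max_eq_left hab'] at *
      grind (splits := 40)
  · have e5 := h9 a ha
    have e6 := h9 b hb
    clear h9
    unfold Fc HL at *
    rcases le_total (y a) (y b) with hab' | hab'
    · rw [max_eq_right hab'] at *
      grind (splits := 40)
    · rw [max_eq_left hab'] at *
      grind (splits := 40)

end PlanarPackings

/-! ### Rings of four squares and their rectangles -/

section Cells

variable {ι : Type*}

/-- Four squares `a`, `b`, `c`, `d` (upper left, upper right, lower right, lower left), consecutive
ones being equal or joined by arms. -/
structure Ring (V : Set ι) (N : ℝ) (x y : ι → ℝ) (a b c d : ι) : Prop where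
  ha : a ∈ V
  hb : b ∈ V
  hc : c ∈ V
  hd : d ∈ V
  top : a = b ∨ Arm V N x y a b
  right : c = b ∨ Arm V N y x c b
  bot : d = c ∨ Arm V N x y d c
  left : d = a ∨ Arm V N y x d a

/-- The point `(X, Y)` lies in the open rectangle bounded by four squares. -/
def InRect (N : ℝ) (x y : ι → ℝ) (a b c d : ι) (X Y : ℝ) : Prop :=
  min (x d) (x a) + N < X ∧ X < max (x b) (x c) ∧ min (y d) (y c) + N < Y ∧ Y < max (y a) (y b)

/-- The square `p` contains the point `(X, Y)`. -/
def InSq (N : ℝ) (x y : ι → ℝ) (p : ι) (X Y : ℝ) : Prop :=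
  x p ≤ X ∧ X ≤ x p + N ∧ y p ≤ Y ∧ Y ≤ y p + N

/-- The arm between `p` and the square `q` on its right contains the point `(X, Y)`. -/
def InArm (V : Set ι) (N : ℝ) (x y : ι → ℝ) (p q : ι) (X Y : ℝ) : Prop :=
  Arm V N x y p q ∧ x p + N ≤ X ∧ X ≤ x q ∧ max (y p) (y q) ≤ Y ∧ Y ≤ min (y p) (y q) + N

/-- The open rectangle bounded by four squares contains the point `(X, Y)`, and it meets the arms
only inside squares. -/
structure Cell (V : Set ι) (N : ℝ) (x y : ι → ℝ) (a b c d : ι) (X Y : ℝ) : Prop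
    extends Ring V N x y a b c d where
  inRect : InRect N x y a b c d X Y
  clear_x : ∀ X' Y' p q, InRect N x y a b c d X' Y' → InArm V N x y p q X' Y' →
    ∃ f ∈ V, InSq N x y f X' Y'
  clear_y : ∀ X' Y' p q, InRect N x y a b c d X' Y' → InArm V N y x p q Y' X' →
    ∃ f ∈ V, InSq N x y f X' Y'

def HasCell (V : Set ι) (N : ℝ) (x y : ι → ℝ) (X Y : ℝ) : Prop :=
  ∃ a b c d, Cell V N x y a b c d X Y

variable {V : Set ι} {N : ℝ} {x y : ι → ℝ}

theorem Ring.swap {a b c d : ι} (h : Ring V N x y a b c d) : Ring V N y x c b a d :=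
  ⟨h.hc, h.hb, h.ha, h.hd, h.right, h.top, h.left, h.bot⟩

theorem inRect_swap {a b c d : ι} {X Y : ℝ} :
    InRect N y x c b a d Y X ↔ InRect N x y a b c d X Y := by
  unfold InRect
  rw [max_comm (y b), max_comm (x b)]
  tauto

theorem inSq_swap {p : ι} {X Y : ℝ} : InSq N y x p Y X ↔ InSq N x y p X Y := by
  unfold InSq
  tauto

theorem Cell.swap {a b c d : ι} {X Y : ℝ} (h : Cell V N x y a b c d X Y) :
    Cell V N y x c b a d Y X where
  toRing := h.toRing.swap
  inRect := inRect_swap.2 h.inRect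
  clear_x X' Y' p q h1 h2 := by
    obtain ⟨f, hf, h3⟩ := h.clear_y Y' X' p q (inRect_swap.1 h1) h2
    exact ⟨f, hf, inSq_swap.2 h3⟩
  clear_y X' Y' p q h1 h2 := by
    obtain ⟨f, hf, h3⟩ := h.clear_x Y' X' p q (inRect_swap.1 h1) h2
    exact ⟨f, hf, inSq_swap.2 h3⟩

theorem HasCell.swap {X Y : ℝ} : HasCell V N x y X Y → HasCell V N y x Y X :=
  fun ⟨_, _, _, _, h⟩ => ⟨_, _, _, _, h.swap⟩

theorem inRect_reflect {a b c d : ι} {X Y : ℝ} :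
    InRect N (fun p => -x p - N) y a b c d X Y ↔ InRect N x y b a d c (-X) Y := by
  simp only [InRect, max_comm (y b), min_comm (y c), lt_max_iff,
    min_lt_iff, ← min_add_add_right]
  have e1 : ∀ p, (-x p - N + N < X ↔ -X < x p) := fun p => by
    constructor <;> intro <;> linarith
  have e2 : ∀ p, (X < -x p - N ↔ x p + N < -X) := fun p => by
    constructor <;> intro <;> linarith
  simp only [e1, e2]
  tauto

theorem inSq_reflect {p : ι} {X Y : ℝ} :
    InSq N (fun p => -x p - N) y p X Y ↔ InSq N x y p (-X) Y := by
  unfold InSq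
  constructor <;> rintro ⟨h1, h2, h3⟩ <;> exact ⟨by linarith, by linarith, h3⟩

theorem inArm_reflect {p q : ι} {X Y : ℝ} :
    InArm V N (fun p => -x p - N) y p q X Y ↔ InArm V N x y q p (-X) Y := by
  unfold InArm
  rw [arm_reflect, max_comm, min_comm]
  constructor <;> rintro ⟨h1, h2, h3, h4⟩ <;> exact ⟨h1, by linarith, by linarith, h4⟩

theorem inArm_reflect_swap {p q : ι} {X Y : ℝ} :
    InArm V N y (fun p => -x p - N) p q Y X ↔ InArm V N y x p q Y (-X) := by
  simp only [InArm, arm_reflect_swap, max_le_iff, ← min_add_add_right, le_min_iff]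
  constructor <;> rintro ⟨h1, h2, h3, ⟨h4, h5⟩, h6, h7⟩ <;>
    exact ⟨h1, h2, h3, ⟨by linarith, by linarith⟩, by linarith, by linarith⟩

theorem Cell.of_reflect {a b c d : ι} {X Y : ℝ}
    (h : Cell V N (fun p => -x p - N) y a b c d (-X) Y) : Cell V N x y b a d c X Y where
  ha := h.hb
  hb := h.ha
  hc := h.hd
  hd := h.hc
  top := h.top.imp Eq.symm arm_reflect.1
  right := h.left.imp id arm_reflect_swap.1
  bot := h.bot.imp Eq.symm arm_reflect.1
  left := h.right.imp id arm_reflect_swap.1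
  inRect := by
    have := inRect_reflect.1 h.inRect
    rwa [neg_neg] at this
  clear_x X' Y' p q h1 h2 := by
    obtain ⟨f, hf, h3⟩ := h.clear_x (-X') Y' q p (inRect_reflect.2 (by rwa [neg_neg]))
      (inArm_reflect.2 (by rwa [neg_neg]))
    rw [inSq_reflect, neg_neg] at h3
    exact ⟨f, hf, h3⟩
  clear_y X' Y' p q h1 h2 := by
    obtain ⟨f, hf, h3⟩ := h.clear_y (-X') Y' p q (inRect_reflect.2 (by rwa [neg_neg]))
      (inArm_reflect_swap.2 (by rwa [neg_neg]))
    rw [inSq_reflect, neg_neg] at h3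
    exact ⟨f, hf, h3⟩

theorem HasCell.of_reflect {X Y : ℝ} :
    HasCell V N (fun p => -x p - N) y (-X) Y → HasCell V N x y X Y :=
  fun ⟨_, _, _, _, h⟩ => ⟨_, _, _, _, h.of_reflect⟩

/-- The square `f` meets the open rectangle bounded by four squares. -/
def Meets (N : ℝ) (x y : ι → ℝ) (a b c d f : ι) : Prop :=
  min (x d) (x a) < x f ∧ x f < max (x b) (x c) ∧ min (y d) (y c) < y f ∧ y f < max (y a) (y b)

theorem Ring.links {a b c d : ι} (hp : Packing V N x y) (h : Ring V N x y a b c d) :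
    (a = b ∨ HL N x y a b) ∧ (c = b ∨ HL N y x c b) ∧ (d = c ∨ HL N x y d c) ∧
      (d = a ∨ HL N y x d a) :=
  ⟨h.top.imp id hp.arm_hl, h.right.imp id hp.swap.arm_hl, h.bot.imp id hp.arm_hl,
    h.left.imp id hp.swap.arm_hl⟩

/-- If the lower edge of `q` is below the top of the rectangle, then `q` meets the rectangle and
`hm` applies. Otherwise consider the abscissa `X`: below `a` or `b`, the arm is too short to end
anywhere but at that square; strictly between them, `no_cross` forbids the arm. -/
theorem Ring.upper_eq {a b c d : ι} (hp : Packing V N x y) (h : Ring V N x y a b c d)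
    (hm : ∀ f ∈ V, Meets N x y a b c d f → f = a ∨ f = b ∨ f = c ∨ f = d)
    {p q : ι} {X Y : ℝ} (hpq : Arm V N y x p q) (hr : InRect N x y a b c d X Y)
    (h1 : x p < X) (h2 : X < x p + N) (h3 : x q < X) (h4 : X < x q + N)
    (h5 : y p + N < Y) (h6 : Y < y q) (na : ¬ InSq N x y a X Y) (nb : ¬ InSq N x y b X Y) :
    q = a ∨ q = b ∨ q = c ∨ q = d := by
  have hN := hp.pos
  obtain ⟨r1, r2, r3, r4⟩ := hr
  have hl := hp.swap.arm_hl hpq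
  obtain ⟨l1, l2, l3, l4⟩ := h.links hp
  rcases lt_or_ge (y q) (max (y a) (y b)) with h7 | h7
  · exact hm q hpq.2.1 ⟨by linarith, by linarith, by linarith, h7⟩
  have ea : y a ≤ y q := (le_max_left _ _).trans h7
  have eb : y b ≤ y q := (le_max_right _ _).trans h7
  have xa : x a ≤ min (x d) (x a) + N := by
    rcases l4 with rfl | l4
    · simp [hN.le]
    · have := l4.2.2.1
      rw [← min_add_add_right]
      exact le_min this.le (by linarith)
  have xb : max (x b) (x c) ≤ x b + N := by
    rcases l2 with rfl | l2
    · simp [hN.le]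
    · exact max_le (by linarith) l2.2.2.2.le
  rcases le_or_gt X (x a + N) with h8 | h8
  · left
    have : Y < y a := by
      by_contra! h9
      exact na ⟨by linarith, h8, h9, by
        rcases l1 with rfl | l1
        · rw [max_self] at r4; linarith
        · have : max (y a) (y b) ≤ y a + N := max_le (by linarith) l1.2.2.1.le
          linarith⟩
    refine hp.eq_of hpq.2.1 h.ha (by linarith) (by linarith) ?_ (by linarith)
    linarith [hl.2.1]
  rcases le_or_gt (x b) X with h9 | h9
  · right; left
    have : Y < y b := by
      by_contra! h9
      exact nb ⟨by linarith, by linarith, h9, by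
        rcases l1 with rfl | l1
        · rw [max_self] at r4; linarith
        · have : max (y a) (y b) ≤ y b + N := max_le l1.2.2.2.le (by linarith)
          linarith⟩
    refine hp.eq_of hpq.2.1 h.hb (by linarith) (by linarith) ?_ (by linarith)
    linarith [hl.2.1]
  rcases l1 with rfl | l1
  · linarith
  · exact (hp.no_cross h.ha h.hb l1 hpq h8 h9 h1 h2 h3 h4 (by linarith) h7).elim

theorem Packing.flip (h : Packing V N x y) : Packing V N x (fun p => -y p - N) :=
  h.swap.reflect.swap

theorem Ring.flip {a b c d : ι} (h : Ring V N x y a b c d) :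
    Ring V N x (fun p => -y p - N) d c b a :=
  ⟨h.hd, h.hc, h.hb, h.ha, h.bot.imp id arm_reflect_swap.2, h.right.imp Eq.symm arm_reflect.2,
    h.top.imp id arm_reflect_swap.2, h.left.imp Eq.symm arm_reflect.2⟩

theorem Ring.lower_eq {a b c d : ι} (hp : Packing V N x y) (h : Ring V N x y a b c d)
    (hm : ∀ f ∈ V, Meets N x y a b c d f → f = a ∨ f = b ∨ f = c ∨ f = d)
    {p q : ι} {X Y : ℝ} (hpq : Arm V N y x p q) (hr : InRect N x y a b c d X Y)
    (h1 : x p < X) (h2 : X < x p + N) (h3 : x q < X) (h4 : X < x q + N)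
    (h5 : y p + N < Y) (h6 : Y < y q) (nc : ¬ InSq N x y c X Y) (nd : ¬ InSq N x y d X Y) :
    p = a ∨ p = b ∨ p = c ∨ p = d := by
  have key := h.flip.upper_eq hp.flip (p := q) (q := p) (X := X) (Y := -Y) ?_
    (arm_reflect.2 hpq) ?_ h3 h4 h1 h2 (by linarith) (by linarith) ?_ ?_
  · tauto
  · rintro f hf ⟨m1, m2, m3, m4⟩
    have := hm f hf ⟨?_, ?_, ?_, ?_⟩
    · tauto
    · rwa [min_comm]
    · rwa [max_comm]
    · rw [lt_max_iff] at m4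
      rw [min_lt_iff]
      exact m4.imp (fun _ => by linarith) (fun _ => by linarith)
    · rw [min_lt_iff] at m3
      rw [lt_max_iff]
      exact m3.imp (fun _ => by linarith) (fun _ => by linarith)
  · obtain ⟨r1, r2, r3, r4⟩ := hr
    refine ⟨by rwa [min_comm], by rwa [max_comm], ?_, ?_⟩
    · rw [← min_add_add_right, min_lt_iff]
      rw [lt_max_iff] at r4
      exact r4.imp (fun _ => by linarith) (fun _ => by linarith)
    · rw [← min_add_add_right, min_lt_iff] at r3
      rw [lt_max_iff]
      exact r3.imp (fun _ => by linarith) (fun _ => by linarith)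
  · rintro ⟨m1, m2, m3, m4⟩
    exact nd ⟨m1, m2, by linarith, by linarith⟩
  · rintro ⟨m1, m2, m3, m4⟩
    exact nc ⟨m1, m2, by linarith, by linarith⟩

end Cells

/-! ### When a ring of squares bounds a cell -/

section CellCriterion

variable {ι : Type*} {V : Set ι} {N : ℝ} {x y : ι → ℝ}

/-- A ring of squares bounds a cell when no other square meets its rectangle and there are no
arms between opposite squares. -/
structure Ring.Simple (V : Set ι) (N : ℝ) (x y : ι → ℝ) (a b c d : ι) : Prop
    extends Ring V N x y a b c d where
  meets : ∀ f ∈ V, Meets N x y a b c d f → f = a ∨ f = b ∨ f = c ∨ f = d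
  diag_y : Arm V N y x c a ∨ Arm V N y x d b → a = b ∨ c = d
  diag_x : Arm V N x y a c ∨ Arm V N x y d b → a = d ∨ b = c

theorem meets_swap {a b c d f : ι} : Meets N y x c b a d f ↔ Meets N x y a b c d f := by
  unfold Meets
  rw [max_comm (y b), max_comm (x b)]
  tauto

theorem Ring.Simple.swap {a b c d : ι} (h : Ring.Simple V N x y a b c d) :
    Ring.Simple V N y x c b a d where
  toRing := h.toRing.swap
  meets f hf hm := by
    have := h.meets f hf (meets_swap.1 hm)
    tauto
  diag_y hd := by
    have := h.diag_x hd
    tauto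
  diag_x hd := by
    have := h.diag_y hd
    tauto

/-- Both ends of the arm are among the four squares. An arm along the left or right side misses the
open rectangle, and a diagonal arm is excluded by `diag_y` unless two squares coincide and it
becomes such a side. -/
theorem Ring.Simple.not_arm {a b c d : ι} (hp : Packing V N x y)
    (h : Ring.Simple V N x y a b c d) {p q : ι} {X Y : ℝ} (hpq : Arm V N y x p q)
    (hr : InRect N x y a b c d X Y) (h1 : x p < X) (h2 : X < x p + N) (h3 : x q < X)
    (h4 : X < x q + N) (h5 : y p + N < Y) (h6 : Y < y q)
    (na : ¬ InSq N x y a X Y) (nb : ¬ InSq N x y b X Y) (nc : ¬ InSq N x y c X Y)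
    (nd : ¬ InSq N x y d X Y) : False := by
  have hN := hp.pos
  have hq' := h.toRing.upper_eq hp h.meets hpq hr h1 h2 h3 h4 h5 h6 na nb
  have hp' := h.toRing.lower_eq hp h.meets hpq hr h1 h2 h3 h4 h5 h6 nc nd
  obtain ⟨r1, r2, r3, r4⟩ := hr
  obtain ⟨l1, l2, l3, l4⟩ := h.toRing.links hp
  have hl := hp.swap.arm_hl hpq
  have d1 := h.diag_y
  rw [← min_add_add_right, min_lt_iff] at r1
  rw [lt_max_iff] at r2
  clear r3 r4 na nb nc nd
  unfold HL at *
  rcases hq' with rfl | rfl | rfl | rfl <;> rcases hp' with rfl | rfl | rfl | rfl <;>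
    grind (splits := 40)

theorem Ring.Simple.clear {a b c d : ι} (hp : Packing V N x y)
    (h : Ring.Simple V N x y a b c d) (X Y : ℝ) (p q : ι) (hr : InRect N x y a b c d X Y)
    (hi : InArm V N y x p q Y X) : ∃ f ∈ V, InSq N x y f X Y := by
  by_contra! hn
  obtain ⟨hpq, h1, h2, h3, h4⟩ := hi
  have hl := hp.swap.arm_hl hpq
  have hN := hp.pos
  have hlt : max (x p) (x q) < min (x p) (x q) + N := by
    have h5 := hl.2.2.1
    have h6 := hl.2.2.2
    rw [← min_add_add_right]
    simp only [max_lt_iff, lt_min_iff]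
    exact ⟨⟨by linarith, h5⟩, h6, by linarith⟩
  have hx1 : x p ≤ X := (le_max_left _ _).trans h3
  have hx2 : X ≤ x p + N := h4.trans (by gcongr; exact min_le_left _ _)
  have hx3 : x q ≤ X := (le_max_right _ _).trans h3
  have hx4 : X ≤ x q + N := h4.trans (by gcongr; exact min_le_right _ _)
  have h5 : y p + N < Y := lt_of_le_of_ne h1 fun e =>
    hn p hpq.1 ⟨hx1, hx2, by linarith, by linarith⟩
  have h6 : Y < y q := lt_of_le_of_ne h2 fun e =>
    hn q hpq.2.1 ⟨hx3, hx4, by linarith, by linarith⟩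
  have ho : ∀ f, IsOpen {X | ¬ InSq N x y f X Y} := fun f => by
    have : IsClosed {X | InSq N x y f X Y} := by
      simp only [InSq, ofPred_and]
      exact (isClosed_le continuous_const continuous_id).inter
        ((isClosed_le continuous_id continuous_const).inter
          (isClosed_const.inter isClosed_const))
    exact this.isOpen_compl
  have hR : IsOpen {X | InRect N x y a b c d X Y} := by
    simp only [InRect, ofPred_and]
    exact (isOpen_lt continuous_const continuous_id).inter
      ((isOpen_lt continuous_id continuous_const).inter (isOpen_const.inter isOpen_const))
  -- The point may lie on the long side of the arm, whereas `not_arm` needs it strictly inside. The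
  -- other hypotheses are open in `X`, so `X` can be moved.
  have hcl : X ∈ closure (Ioo (max (x p) (x q)) (min (x p) (x q) + N)) := by
    rw [closure_Ioo hlt.ne]
    exact ⟨h3, h4⟩
  obtain ⟨X', ⟨⟨⟨⟨ka, kb⟩, kc⟩, kd⟩, kr⟩, k1, k2⟩ := mem_closure_iff.1 hcl _
    (((((ho a).inter (ho b)).inter (ho c)).inter (ho d)).inter hR)
    ⟨⟨⟨⟨hn a h.ha, hn b h.hb⟩, hn c h.hc⟩, hn d h.hd⟩, hr⟩
  rw [max_lt_iff] at k1
  rw [← min_add_add_right, lt_min_iff] at k2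
  exact h.not_arm hp hpq kr k1.1 k2.1 k1.2 k2.2 h5 h6 ka kb kc kd

theorem Ring.Simple.cell {a b c d : ι} (hp : Packing V N x y)
    (h : Ring.Simple V N x y a b c d) {X Y : ℝ} (hr : InRect N x y a b c d X Y) :
    Cell V N x y a b c d X Y where
  toRing := h.toRing
  inRect := hr
  clear_x X' Y' p q h1 h2 := by
    obtain ⟨f, hf, h3⟩ := h.swap.clear hp.swap Y' X' p q (inRect_swap.2 h1) h2
    exact ⟨f, hf, inSq_swap.1 h3⟩
  clear_y X' Y' p q h1 h2 := h.clear hp X' Y' p q h1 h2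

/-- Squares arranged in a pinwheel around a pair of squares facing each other vertically. -/
theorem Packing.pinwheel (h : Packing V N x y) {p q r s : ι} (hl : HL N y x p q)
    (hn : ¬ Arm V N y x p q) (hpr : Arm V N y x p r) (hsq : Arm V N y x s q)
    (h1 : y r < y q) (h2 : y p < y s) (h3 : x q + N ≤ x r) (h4 : x s + N ≤ x p)
    {X Y : ℝ} (hr : InRect N x y q r p s X Y) : HasCell V N x y X Y := by
  have hN := h.pos
  have l1 := h.swap.arm_hl hpr
  have l2 := h.swap.arm_hl hsq
  have hp := hpr.1
  have hq := hsq.2.1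
  have hr' := hpr.2.1
  have hs := hsq.1
  -- The pinwheel leaves no room for another one around its own consecutive pairs, so these are
  -- joined by arms.
  have a1 : Arm V N x y s p := by
    by_contra ha
    obtain ⟨t, ht, u, hu, A1, A2, k⟩ := h.exists_of_not_arm hs hp
      (by unfold HL at *; grind) ha
    have l3 := h.arm_hl A1
    have l4 := h.arm_hl A2
    have e1 := h.cases ht hq
    have e2 := h.cases ht hp
    have e3 := h.cases hu hs
    unfold HL at *
    grind (splits := 40)
  have a2 : Arm V N x y q r := by
    by_contra ha
    obtain ⟨t, ht, u, hu, A1, A2, k⟩ := h.exists_of_not_arm hq hr'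
      (by unfold HL at *; grind) ha
    have l3 := h.arm_hl A1
    have l4 := h.arm_hl A2
    have e1 := h.cases ht hq
    have e2 := h.cases hu hp
    have e3 := h.cases hu hq
    unfold HL at *
    grind (splits := 40)
  refine ⟨q, r, p, s, Ring.Simple.cell h ⟨⟨hq, hr', hp, hs, Or.inr a2, Or.inr hpr, Or.inr a1,
    Or.inr hsq⟩, ?_, ?_, ?_⟩ hr⟩
  · rintro f hf ⟨m1, m2, m3, m4⟩
    by_contra! hne
    have e1 := h.disj f hf q hq hne.1
    have e2 := h.disj f hf r hr' hne.2.1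
    have e3 := h.disj f hf p hp hne.2.2.1
    have e4 := h.disj f hf s hs hne.2.2.2
    rw [min_lt_iff] at m1 m3
    rw [lt_max_iff] at m2 m4
    clear hr hn
    unfold HL at *
    grind (splits := 40)
  · rintro (k | k)
    · exact absurd k hn
    · have := h.swap.arm_hl k
      exfalso
      unfold HL at *
      grind
  · rintro (k | k)
    · have := h.arm_hl k
      exfalso
      unfold HL at *
      grind
    · exfalso
      have l5 := h.arm_hl k
      obtain ⟨-, -, -, k | k⟩ := k
      · have := k p hp
        unfold HL Fc at *
        grind
      · have := k q hq
        unfold HL Fc at *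
        grind

end CellCriterion

/-! ### Cells bounded by three or four squares -/

section CellExistence

variable {ι : Type*} {V : Set ι} {N : ℝ} {x y : ι → ℝ}

theorem HasCell.of_flip {X Y : ℝ} (h : HasCell V N x (fun p => -y p - N) X (-Y)) :
    HasCell V N x y X Y :=
  (HasCell.of_reflect h.swap).swap

/-- If the arm were missing, then one of the two squares given by `exists_of_not_arm` would lie
above `c` or `d`, between them, and overlap `t`. -/
theorem Packing.flat_arm (h : Packing V N x y) {t c d : ι} (ht : t ∈ V) (hc : c ∈ V) (hd : d ∈ V)
    (hct : HL N y x c t) (hdt : HL N y x d t) (hdc : x d + N ≤ x c) : Arm V N x y d c := by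
  have hN := h.pos
  by_contra ha
  obtain ⟨r, hr, s, hs, A1, A2, k⟩ := h.exists_of_not_arm hd hc (by unfold HL at *; grind) ha
  have l3 := h.arm_hl A1
  have l4 := h.arm_hl A2
  have e1 := h.cases hr ht
  have e2 := h.cases hs ht
  have e3 := h.cases hr hc
  have e4 := h.cases hs hd
  unfold HL at *
  grind (splits := 40)

/-- The missing arm produces a pinwheel around `d` and `t`. Its square below `t` occupies the place
of `c`, hence is `c`, and the rectangle of the pinwheel contains the given one. -/
theorem Packing.flat_aux (h : Packing V N x y) {t c d : ι} (ht : t ∈ V) (hc : c ∈ V) (hd : d ∈ V)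
    (hct : HL N y x c t) (hdt : HL N y x d t) (hdc : x d + N ≤ x c) {X Y : ℝ}
    (hr : InRect N x y t t c d X Y) (hn : ¬ Arm V N y x d t) : HasCell V N x y X Y := by
  have hN := h.pos
  obtain ⟨r, hr', s, hs, A1, A2, k1, k2, k⟩ := h.swap.exists_of_not_arm hd ht hdt hn
  have l3 := h.swap.arm_hl A1
  have l4 := h.swap.arm_hl A2
  rcases k with ⟨k, k'⟩ | ⟨k, k'⟩
  · exfalso
    unfold HL at *
    grind
  · have : s = c := by
      apply h.eq_of hs hc <;> unfold HL at * <;> grind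
    subst this
    refine HasCell.of_reflect (h.reflect.pinwheel (p := d) (q := t) (r := r) (s := s)
      (hl_reflect_swap.2 hdt) (by rwa [arm_reflect_swap]) (arm_reflect_swap.2 A1)
      (arm_reflect_swap.2 A2) k1 k2 (by linarith) (by linarith) ?_)
    rw [inRect_reflect, neg_neg]
    obtain ⟨r1, r2, r3, r4⟩ := hr
    refine ⟨?_, r2, r3, ?_⟩
    · refine lt_of_le_of_lt ?_ r1
      have : x d ≤ x t := by linarith [hct.2.2.2]
      rw [min_eq_left this]
      gcongr
      exact min_le_left _ _
    · rw [max_self] at r4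
      exact r4.trans_le (le_max_right _ _)

/-- The case of two squares facing a third one from below. -/
theorem Packing.flat (h : Packing V N x y) {t c d : ι} (ht : t ∈ V) (hc : c ∈ V) (hd : d ∈ V)
    (hct : HL N y x c t) (hdt : HL N y x d t) (hdc : x d + N ≤ x c) {X Y : ℝ}
    (hr : InRect N x y t t c d X Y) : HasCell V N x y X Y := by
  have hN := h.pos
  by_cases a1 : Arm V N y x d t
  swap
  · exact h.flat_aux ht hc hd hct hdt hdc hr a1
  by_cases a2 : Arm V N y x c t
  swap
  · refine HasCell.of_reflect (h.reflect.flat_aux (t := t) (c := d) (d := c) ht hd hc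
      (hl_reflect_swap.2 hdt) (hl_reflect_swap.2 hct) (by linarith) ?_ (by rwa [arm_reflect_swap]))
    rwa [inRect_reflect, neg_neg]
  have a3 := h.flat_arm ht hc hd hct hdt hdc
  refine ⟨t, t, c, d, Ring.Simple.cell h ⟨⟨ht, ht, hc, hd, Or.inl rfl, Or.inr a2, Or.inr a3,
    Or.inr a1⟩, ?_, fun _ => Or.inl rfl, ?_⟩ hr⟩
  · rintro f hf ⟨m1, m2, m3, m4⟩
    by_contra! hne
    have e1 := h.disj f hf t ht hne.1
    have e2 := h.disj f hf c hc hne.2.2.1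
    have e3 := h.disj f hf d hd hne.2.2.2
    rw [min_lt_iff] at m1 m3
    rw [lt_max_iff] at m2 m4
    clear hr a1 a2 a3
    unfold HL at *
    grind (splits := 40)
  · rintro (k | k)
    · have := h.arm_hl k
      exfalso
      unfold HL at *
      grind
    · have := h.arm_hl k
      exfalso
      unfold HL at *
      grind

/-- The case of four squares, opposite ones not facing each other. -/
theorem Packing.four (h : Packing V N x y) {a b c d : ι} (ha : a ∈ V) (hb : b ∈ V) (hc : c ∈ V)
    (hd : d ∈ V) (hda : HL N y x d a) (hab : HL N x y a b) (hdc : HL N x y d c)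
    (hcb : HL N y x c b) (a1 : ∀ f ∈ V, HL N y x f a → x f < x d + N)
    (a2 : ∀ f ∈ V, HL N x y a f → y b < y f + N) (n1 : ¬ HL N x y d b) (n2 : ¬ HL N y x d b)
    {X Y : ℝ} (hr : InRect N x y a b c d X Y) : HasCell V N x y X Y := by
  have hN := h.pos
  have a1c := a1 c hc
  have a2c := a2 c hc
  -- The hypotheses `a1` and `a2` and these six facts say that no square facing one of the relevant
  -- edges lies entirely further inside the ring than the chosen neighbor. Since `exists_of_not_arm`
  -- puts its two squares on opposite sides, one of them would lie inside; hence the four arms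
  -- exist.
  have E : ∀ f ∈ V, (HL N x y f b → y a < y f + N) ∧ (HL N y x f b → x c < x f + N) ∧
      (HL N y x c f → x b < x f + N) ∧ (HL N x y f c → y f < y d + N) ∧
      (HL N y x d f → x f < x a + N) ∧ (HL N x y d f → y f < y c + N) := by
    intro f hf
    have e1 := h.cases hf ha
    have e2 := h.cases hf hb
    have e3 := h.cases hf hc
    have e4 := h.cases hf hd
    have e5 := h.cases ha hc
    have e6 := h.cases hd hb
    have e7 := a1 f hf
    have e8 := a2 f hf
    clear a1 a2 hr
    unfold HL at *
    refine ⟨?_, ?_, ?_, ?_, ?_, ?_⟩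
    · grind (splits := 60)
    · grind (splits := 60)
    · grind (splits := 60)
    · grind (splits := 60)
    · grind (splits := 60)
    · grind (splits := 60)
  have A1 : Arm V N x y a b := by
    by_contra hn
    obtain ⟨t, ht, u, hu, B1, B2, -, -, k⟩ := h.exists_of_not_arm ha hb hab hn
    have := a2 t ht (h.arm_hl B1)
    have := (E u hu).1 (h.arm_hl B2)
    rcases k with k | k <;> linarith
  have A2 : Arm V N y x c b := by
    by_contra hn
    obtain ⟨t, ht, u, hu, B1, B2, -, -, k⟩ := h.swap.exists_of_not_arm hc hb hcb hn
    have := (E t ht).2.2.1 (h.swap.arm_hl B1)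
    have := (E u hu).2.1 (h.swap.arm_hl B2)
    rcases k with k | k <;> linarith
  have A3 : Arm V N x y d c := by
    by_contra hn
    obtain ⟨t, ht, u, hu, B1, B2, -, -, k⟩ := h.exists_of_not_arm hd hc hdc hn
    have := (E t ht).2.2.2.2.2 (h.arm_hl B1)
    have := (E u hu).2.2.2.1 (h.arm_hl B2)
    rcases k with k | k <;> linarith
  have A4 : Arm V N y x d a := by
    by_contra hn
    obtain ⟨t, ht, u, hu, B1, B2, -, -, k⟩ := h.swap.exists_of_not_arm hd ha hda hn
    have := (E t ht).2.2.2.2.1 (h.swap.arm_hl B1)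
    have := a1 u hu (h.swap.arm_hl B2)
    rcases k with k | k <;> linarith
  refine ⟨a, b, c, d, Ring.Simple.cell h ⟨⟨ha, hb, hc, hd, Or.inr A1, Or.inr A2, Or.inr A3,
    Or.inr A4⟩, ?_, ?_, ?_⟩ hr⟩
  · rintro f hf ⟨m1, m2, m3, m4⟩
    by_contra! hne
    have e1 := h.disj f hf a ha hne.1
    have e2 := h.disj f hf b hb hne.2.1
    have e3 := h.disj f hf c hc hne.2.2.1
    have e4 := h.disj f hf d hd hne.2.2.2
    have e5 := a1 f hf
    have e6 := a2 f hf
    obtain ⟨f1, f2, f3, f4, f5, f6⟩ := E f hf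
    rw [min_lt_iff] at m1 m3
    rw [lt_max_iff] at m2 m4
    clear hr A1 A2 A3 A4 a1 a2 E hne n1 n2 a1c a2c f3 f4 f5 f6
    unfold HL at *
    have g1 : x d + N ≤ x f ∨ x a + N ≤ x f := by grind (splits := 40)
    have g2 : x f + N ≤ x b ∨ x f + N ≤ x c := by grind (splits := 40)
    have g3 : y d + N ≤ y f ∨ y c + N ≤ y f := by grind (splits := 40)
    have g4 : y f + N ≤ y a ∨ y f + N ≤ y b := by grind (splits := 40)
    clear m1 m2 m3 m4
    -- With `k2`, the square `f` would fit horizontally between `a` and `b`, whose distance is less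
    -- than `N`.
    have k1 : x a + N ≤ x f := by
      by_contra! k
      clear e2 e3 f1 f2
      grind (splits := 40)
    have k2 : x f + N ≤ x b := by
      by_contra! k
      clear e1 e4 e5 e6 f1
      grind (splits := 40)
    linarith
  · rintro (k | k)
    · have := a1c (h.swap.arm_hl k)
      unfold HL at *
      grind
    · exact absurd (h.swap.arm_hl k) n2
  · rintro (k | k)
    · have := a2c (h.arm_hl k)
      unfold HL at *
      grind
    · exact absurd (h.arm_hl k) n1

/-- A test square placed in the corner to the right of `d` and below `b` overlaps some square, and
`a1`, `a2` and the absence of facing between `d` and `b` force that square to face both. The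
position of the test square depends on whether `d` or `b` juts out beyond `a`; when neither does,
two test squares are compared. -/
theorem Packing.corner (h : Packing V N x y) {a b d : ι} (ha : a ∈ V) (hb : b ∈ V) (hd : d ∈ V)
    (hda : HL N y x d a) (hab : HL N x y a b) (a1 : ∀ f ∈ V, HL N y x f a → x f < x d + N)
    (a2 : ∀ f ∈ V, HL N x y a f → y b < y f + N) (n1 : ¬ HL N x y d b) (n2 : ¬ HL N y x d b) :
    ∃ c ∈ V, HL N x y d c ∧ HL N y x c b := by
  have := h.pos
  have e6 := h.cases hb hd
  have key : ∀ f ∈ V, ((x f = x a ∧ y f = y a) ∨ x f + N ≤ x a ∨ x a + N ≤ x f ∨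
      y f + N ≤ y a ∨ y a + N ≤ y f) ∧ ((x f = x b ∧ y f = y b) ∨ x f + N ≤ x b ∨ x b + N ≤ x f ∨
      y f + N ≤ y b ∨ y b + N ≤ y f) ∧ ((x f = x d ∧ y f = y d) ∨ x f + N ≤ x d ∨ x d + N ≤ x f ∨
      y f + N ≤ y d ∨ y d + N ≤ y f) := fun f hf => ⟨h.cases hf ha, h.cases hf hb, h.cases hf hd⟩
  by_cases h1 : x a < x d
  · by_cases h5 : y d + 2 * N ≤ y b
    · obtain ⟨f, hf, f1⟩ := h.maxl (x a + N) (y b - N)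
      obtain ⟨e1, e2, e3⟩ := key f hf
      have e4 := a1 f hf
      have e5 := a2 f hf
      clear a1 a2 key
      refine ⟨f, hf, ?_⟩
      unfold HL at *
      grind (splits := 40)
    · obtain ⟨f, hf, f1⟩ := h.maxl (x d + N) (y b - N)
      obtain ⟨e1, e2, e3⟩ := key f hf
      have e4 := a1 f hf
      have e5 := a2 f hf
      clear a1 a2 key
      refine ⟨f, hf, ?_⟩
      unfold HL at *
      grind (splits := 40)
  by_cases h2 : y b < y a
  · by_cases h5 : x d + 2 * N ≤ x b
    · obtain ⟨f, hf, f1⟩ := h.maxl (x d + N) (y a - N)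
      obtain ⟨e1, e2, e3⟩ := key f hf
      have e4 := a1 f hf
      have e5 := a2 f hf
      clear a1 a2 key
      refine ⟨f, hf, ?_⟩
      unfold HL at *
      grind (splits := 40)
    · obtain ⟨f, hf, f1⟩ := h.maxl (x d + N) (y b - N)
      obtain ⟨e1, e2, e3⟩ := key f hf
      have e4 := a1 f hf
      have e5 := a2 f hf
      clear a1 a2 key
      refine ⟨f, hf, ?_⟩
      unfold HL at *
      grind (splits := 40)
  obtain ⟨f, hf, f1⟩ := h.maxl (x d + N) (y a - N)
  obtain ⟨g, hg, g1⟩ := h.maxl (x a + N) (y b - N)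
  have F : x a + N ≤ x f ∧ y f + N ≤ y a ∧ x f < x d + 2 * N := by
    obtain ⟨e1, e2, e3⟩ := key f hf
    have e4 := a1 f hf
    have e5 := a2 f hf
    clear a1 a2 key
    unfold HL at *
    grind
  have G : x a + N ≤ x g ∧ y g + N ≤ y a ∧ y b < y g + 2 * N := by
    obtain ⟨e1, e2, e3⟩ := key g hg
    have e4 := a1 g hg
    have e5 := a2 g hg
    clear a1 a2 key
    unfold HL at *
    grind
  have e := h.cases hf hg
  refine ⟨f, hf, ?_⟩
  clear a1 a2 key
  unfold HL at *
  grind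

end CellExistence

/-! ### Cells found by walking upward from a point -/

section CellExistence

variable {ι : Type*} {V : Set ι} {N : ℝ} {x y : ι → ℝ}

/-- The vertical segment from `(X, Y)` to `(X, h)` does not meet the squares, nor the gaps between
squares facing each other horizontally. -/
def FreePath (V : Set ι) (N : ℝ) (x y : ι → ℝ) (X Y h : ℝ) : Prop :=
  (∀ f ∈ V, ∀ Z, Y ≤ Z → Z < h → ¬ InSq N x y f X Z) ∧
    ∀ p ∈ V, ∀ q ∈ V, HL N x y p q → ∀ Z, Y ≤ Z → Z < h →
      ¬ (x p + N ≤ X ∧ X ≤ x q ∧ y p ≤ Z ∧ y q ≤ Z ∧ Z ≤ y p + N ∧ Z ≤ y q + N)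

theorem FreePath.reflect {X Y h : ℝ} (H : FreePath V N x y X Y h) :
    FreePath V N (fun p => -x p - N) y (-X) Y h := by
  refine ⟨fun f hf Z h1 h2 h3 => ?_, fun p hp q hq hl Z h1 h2 h3 => ?_⟩
  · rw [inSq_reflect, neg_neg] at h3
    exact H.1 f hf Z h1 h2 h3
  · obtain ⟨k1, k2, k3, k4, k5, k6⟩ := h3
    exact H.2 q hq p hp (hl_reflect.1 hl) Z h1 h2
      ⟨by linarith, by linarith, k4, k3, k6, k5⟩

theorem FreePath.sq {X Y h : ℝ} (H : FreePath V N x y X Y h) {f : ι} (hf : f ∈ V)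
    (h1 : x f ≤ X) (h2 : X ≤ x f + N) (h3 : Y ≤ y f + N) (hN : 0 < N) (hh : Y < h) :
    h ≤ y f := by
  by_contra! h4
  refine H.1 f hf (max Y (y f)) (le_max_left _ _) (max_lt hh h4)
    ⟨h1, h2, le_max_right _ _, max_le h3 (by linarith)⟩

theorem FreePath.gap {X Y h : ℝ} (H : FreePath V N x y X Y h) {p q : ι} (hp : p ∈ V) (hq : q ∈ V)
    (hl : HL N x y p q) (h1 : x p + N ≤ X) (h2 : X ≤ x q) (h3 : Y ≤ y p + N) (h4 : Y ≤ y q + N)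
    (hN : 0 < N) (hh : Y < h) : h ≤ y p ∨ h ≤ y q := by
  by_contra! h5
  refine H.2 p hp q hq hl (max Y (max (y p) (y q))) (le_max_left _ _)
    (max_lt hh (max_lt h5.1 h5.2)) ⟨h1, h2, ?_, ?_, ?_, ?_⟩
  · simp
  · simp
  · exact max_le h3 (max_le (by linarith) hl.2.2.1.le)
  · exact max_le h4 (max_le hl.2.2.2.le (by linarith))

/-- If the path started at or below the lower side of the rectangle, it would run through `d`,
through `c` or through the gap between them. -/
theorem FreePath.bottom (hN : 0 < N) {X Y h : ℝ} (H : FreePath V N x y X Y h) (hh : Y < h)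
    {c d : ι} (hc : c ∈ V) (hd : d ∈ V) (hdc : d = c ∨ HL N x y d c) (h1 : x d ≤ X)
    (h2 : X ≤ x c + N) (h3 : y d + N ≤ h) : min (y d) (y c) + N < Y := by
  by_contra! h6
  rw [← min_add_add_right, le_min_iff] at h6
  have h4 : y c < h := by
    rcases hdc with rfl | hdc
    · linarith
    · linarith [hdc.2.2.1]
  rcases le_total X (x d + N) with h7 | h7
  · linarith [H.sq hd h1 h7 h6.1 hN hh]
  rcases le_total (x c) X with h8 | h8
  · linarith [H.sq hc h8 h2 h6.2 hN hh]
  rcases hdc with rfl | hdc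
  · linarith
  · rcases H.gap hd hc hdc h7 h8 h6.1 h6.2 hN hh with h9 | h9 <;> linarith

theorem inRect_flip {a b c d : ι} {X Y : ℝ} :
    InRect N x (fun p => -y p - N) d c b a X (-Y) ↔ InRect N x y a b c d X Y := by
  rw [← inRect_swap, inRect_reflect, inRect_swap, neg_neg]

/-- If `d` and `b` face each other, horizontally or vertically, three squares suffice and `flat`
applies in a rotated frame. Otherwise `corner` supplies a fourth square and `four` applies. -/
theorem Packing.corner_cell (h : Packing V N x y) {a b d : ι} (ha : a ∈ V) (hb : b ∈ V)
    (hd : d ∈ V) (hda : HL N y x d a) (hab : HL N x y a b)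
    (a1 : ∀ f ∈ V, HL N y x f a → x f < x d + N) (a2 : ∀ f ∈ V, HL N x y a f → y b < y f + N)
    {X Y : ℝ} (H : FreePath V N x y X Y (y a)) (hY : Y < y a) (h1 : min (x d) (x a) + N < X)
    (h2 : X < x b) : HasCell V N x y X Y := by
  have hN := h.pos
  have h3 : x d ≤ X := by
    refine le_trans ?_ h1.le
    rw [← min_add_add_right]
    exact le_min (by linarith) hda.2.2.2.le
  by_cases n1 : HL N x y d b
  · refine (h.swap.flat hb ha hd hab n1 hda.1 (inRect_swap.2 ⟨h1, ?_, ?_, ?_⟩)).swap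
    · simpa using h2
    · exact H.bottom hN hY hb hd (Or.inr n1) h3 (by linarith) hda.1
    · exact lt_max_of_lt_left hY
  by_cases n2 : HL N y x d b
  · refine (h.flip.flat (X := X) (Y := -Y) hd hb ha (hl_reflect.2 n2) (hl_reflect.2 hda) hab.1
      (inRect_flip.2 ⟨h1, ?_, ?_, ?_⟩)).of_flip
    · exact lt_max_of_lt_left h2
    · exact H.bottom hN hY hd hd (Or.inl rfl) h3 (by linarith [n2.2.2.1]) hda.1
    · exact lt_max_of_lt_left hY
  obtain ⟨c, hc, h4, h5⟩ := h.corner ha hb hd hda hab a1 a2 n1 n2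
  refine h.four ha hb hc hd hda hab h4 h5 a1 a2 n1 n2 ⟨h1, lt_max_of_lt_left h2, ?_,
    lt_max_of_lt_left hY⟩
  exact H.bottom hN hY hc hd (Or.inr h4) h3 (by linarith [h5.2.2.1]) hda.1

/-- No two facing close squares have the point `(X, Y)` between them. -/
def NoGap (V : Set ι) (N : ℝ) (x y : ι → ℝ) (X Y : ℝ) : Prop :=
  ∀ p ∈ V, ∀ q ∈ V, HL N x y p q → ¬ (x p + N ≤ X ∧ X ≤ x q ∧ y p ≤ Y ∧ y q ≤ Y ∧ Y ≤ y p + N ∧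
    Y ≤ y q + N)

theorem Packing.exists_rightmost (h : Packing V N x y) (a : ι) (hne : ∃ d ∈ V, HL N y x d a) :
    ∃ d ∈ V, HL N y x d a ∧ ∀ f ∈ V, HL N y x f a → x f ≤ x d := by
  obtain ⟨d, hd, h1, h2⟩ := h.exists_min a (fun d => HL N y x d a) (fun d => - x d)
    (fun q _ ⟨h1, h2, h3, h4⟩ => ⟨abs_le.2 ⟨by linarith [h.pos], by linarith [h.pos]⟩,
      abs_le.2 ⟨by linarith [h.pos], by linarith [h.pos]⟩⟩) hne
  exact ⟨d, hd, h1, fun f hf hf' => by linarith [h2 f hf hf']⟩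

theorem Packing.exists_lowest (h : Packing V N x y) {a : ι} (ha : a ∈ V) :
    ∃ b ∈ V, HL N x y a b ∧ ∀ f ∈ V, HL N x y a f → y b ≤ y f := by
  obtain ⟨q, hq, hq', -⟩ := h.exists_nearest ha
  exact h.exists_min a (fun b => HL N x y a b) y
    (fun q _ ⟨h1, h2, h3, h4⟩ => ⟨abs_le.2 ⟨by linarith [h.pos], by linarith [h.pos]⟩,
      abs_le.2 ⟨by linarith [h.pos], by linarith [h.pos]⟩⟩) ⟨q, hq, hq'⟩

theorem Packing.exists_below (h : Packing V N x y) {a : ι} (ha : a ∈ V) :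
    ∃ d ∈ V, HL N y x d a := by
  obtain ⟨q, hq, hq', -⟩ := h.flip.swap.exists_nearest ha
  exact ⟨q, hq, hl_reflect.1 hq'⟩

/-- The upward path from `(X, Y)` first hits the gap between `a` and `b`, at the height of the
lower edge of `a`. -/
theorem Packing.cell_of_gap (h : Packing V N x y) {a b : ι} (ha : a ∈ V) (hb : b ∈ V)
    (hab : HL N x y a b) (hba : y b ≤ y a) {X Y : ℝ} (H : FreePath V N x y X Y (y a))
    (hY : Y < y a) (h1 : x a + N < X) (h2 : X < x b) : HasCell V N x y X Y := by
  have hN := h.pos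
  obtain ⟨d, hd, hda, h3⟩ := h.exists_rightmost a (h.exists_below ha)
  refine h.corner_cell ha hb hd hda hab (fun f hf hf' => by linarith [h3 f hf hf']) ?_ H hY
    (lt_of_le_of_lt (by gcongr; exact min_le_right _ _) h1) h2
  intro f hf hf'
  have := h.cases hf hb
  unfold HL at *
  grind

/-- The upward path from `(X, Y)` first hits the square `a`; the squares below `a` lie on the left
of the path. -/
theorem Packing.cell_of_left (h : Packing V N x y) {a : ι} (ha : a ∈ V) {X Y : ℝ}
    (H : FreePath V N x y X Y (y a)) (hY : Y < y a) (h1 : X < x a + N)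
    (hl : ∀ f ∈ V, HL N y x f a → x f + N < X) : HasCell V N x y X Y := by
  have hN := h.pos
  obtain ⟨d, hd, hda, h3⟩ := h.exists_rightmost a (h.exists_below ha)
  obtain ⟨b, hb, hab, h4⟩ := h.exists_lowest ha
  refine h.corner_cell ha hb hd hda hab (fun f hf hf' => by linarith [h3 f hf hf'])
    (fun f hf hf' => by linarith [h4 f hf hf']) H hY
    (lt_of_le_of_lt (by gcongr; exact min_le_left _ _) (hl d hd hda)) (by linarith [hab.1])

/-- The upward path from `(X, Y)` first hits the square `a`. -/
theorem Packing.cell_of_square (h : Packing V N x y) {a : ι} (ha : a ∈ V) {X Y : ℝ}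
    (H : FreePath V N x y X Y (y a)) (hY : Y < y a) (h1 : x a < X) (h2 : X < x a + N)
    (hv : NoGap V N y x Y X) : HasCell V N x y X Y := by
  have hN := h.pos
  have key : ∀ f ∈ V, HL N y x f a → x f + N < X ∨ X < x f := by
    intro f hf hf'
    by_contra! h3
    refine hv f hf a ha hf' ⟨?_, hY.le, h3.2, h1.le, h3.1, h2.le⟩
    by_contra! h4
    linarith [H.sq hf h3.2 h3.1 h4.le hN hY, hf'.1]
  by_cases hl : ∀ f ∈ V, HL N y x f a → x f + N < X
  · exact h.cell_of_left ha H hY h2 hl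
  by_cases hr : ∀ f ∈ V, HL N y x f a → X < x f
  · refine HasCell.of_reflect (h.reflect.cell_of_left ha H.reflect hY (by linarith) ?_)
    intro f hf hf'
    linarith [hr f hf (hl_reflect_swap.1 hf')]
  -- Squares below `a` lie on both sides of the path: this is the flat configuration.
  push Not at hl hr
  obtain ⟨c, hc, h3, h4⟩ := hl
  obtain ⟨d, hd, h5, h6⟩ := hr
  have h4' : X < x c := (key c hc h3).resolve_left (not_lt.2 h4)
  have h6' : x d + N < X := (key d hd h5).resolve_right (not_lt.2 h6)
  have h7 : x d + N ≤ x c := by linarith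
  refine h.flat ha hc hd h3 h5 h7 ⟨?_, ?_, ?_, ?_⟩
  · exact lt_of_le_of_lt (by gcongr; exact min_le_left _ _) h6'
  · exact lt_max_of_lt_right h4'
  · refine H.bottom hN hY hc hd (Or.inr ?_) (by linarith) (by linarith) h5.1
    unfold HL at *
    grind
  · exact lt_max_of_lt_left hY

end CellExistence

/-! ### A cell around every generic free point -/

section CellOfPoint

variable {ι : Type*} {V : Set ι} {N : ℝ} {x y : ι → ℝ}

/-- The vertical segment from `(X, Y)` to `(X, Y + 3 * N)` meets neither the squares nor the gaps
between close squares. -/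
def LongPath (V : Set ι) (N : ℝ) (x y : ι → ℝ) (X Y : ℝ) : Prop :=
  (∀ f ∈ V, x f ≤ X → X ≤ x f + N → y f + N < Y ∨ Y + 3 * N < y f) ∧
    ∀ p ∈ V, ∀ q ∈ V, HL N x y p q → x p + N ≤ X → X ≤ x q →
      y p + N < Y ∨ y q + N < Y ∨ Y + 3 * N < y p ∨ Y + 3 * N < y q

theorem LongPath.reflect {X Y : ℝ} (H : LongPath V N x y X Y) :
    LongPath V N (fun p => -x p - N) y (-X) Y := by
  refine ⟨fun f hf h1 h2 => H.1 f hf (by linarith) (by linarith), fun p hp q hq hl h1 h2 => ?_⟩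
  have := H.2 q hq p hp (hl_reflect.1 hl) (by linarith) (by linarith)
  tauto

/-- Among the squares on the left of the line that meet the band between heights `y0` and `y0 + N`,
let `L` be the rightmost; a test square glued to its right gives `R`. Their gap surrounds the line,
so the two cannot face each other and one lies entirely above the other. -/
theorem Packing.exists_window (h : Packing V N x y) {X Y : ℝ} (H : LongPath V N x y X Y) {y0 : ℝ}
    (h1 : Y ≤ y0) (h2 : y0 ≤ Y + 2 * N) :
    ∃ L ∈ V, ∃ R ∈ V, x L + N < X ∧ X < x R ∧ x R < x L + 2 * N ∧ y L < y0 + N ∧ y0 < y L + N ∧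
      y R < y0 + N ∧ y0 < y R + N ∧ (y L + N ≤ y R ∨ y R + N ≤ y L) ∧
      ∀ f ∈ V, x f ≤ X → y f < y0 + N → y0 < y f + N → x f ≤ x L := by
  have hN := h.pos
  have col : ∀ f ∈ V, y f < y0 + N → y0 < y f + N → x f + N < X ∨ X < x f := by
    intro f hf h3 h4
    by_contra! h5
    rcases H.1 f hf h5.2 h5.1 with h6 | h6 <;> linarith
  obtain ⟨L0, hL0, k1, k2, k3, k4⟩ := h.maxl (X - N) y0
  obtain ⟨L, hL, ⟨m1, m2, m3, m4⟩, m5⟩ := h.exists_min L0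
    (fun f => x L0 ≤ x f ∧ x f ≤ X ∧ y f < y0 + N ∧ y0 < y f + N) (fun f => - x f)
    (fun q _ ⟨h1, h2, h3, h4⟩ => ⟨abs_le.2 ⟨by linarith, by linarith⟩,
      abs_le.2 ⟨by linarith, by linarith⟩⟩) ⟨L0, hL0, le_rfl, by linarith, k3, k4⟩
  obtain ⟨R, hR, n1, n2, n3, n4⟩ := h.maxl (x L + N) y0
  have hLX := (col L hL m3 m4).resolve_right (by linarith)
  have hRX : X < x R := by
    rcases col R hR n3 n4 with h5 | h5
    · have := m5 R hR ⟨by linarith, by linarith, n3, n4⟩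
      linarith
    · exact h5
  refine ⟨L, hL, R, hR, hLX, hRX, by linarith, m3, m4, n3, n4, ?_, ?_⟩
  · by_contra! h6
    rcases H.2 L hL R hR ⟨by linarith, by linarith, h6.1, h6.2⟩ hLX.le hRX.le with h7 | h7 | h7 | h7
      <;> linarith
  · intro f hf h3 h4 h5
    by_contra! h6
    have := m5 f hf ⟨by linarith, h3, h4, h5⟩
    linarith

/-- Raise the window to the upper edge of `R`. Its left square `L'` is at least as far right as `L`.
Then either `L'` and `R` face each other across the path, or the new right square overlaps `R`. -/
theorem Packing.longPath_aux (h : Packing V N x y) {X Y : ℝ} (H : LongPath V N x y X Y) {L R : ι}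
    (hL : L ∈ V) (hR : R ∈ V) (h1 : x L + N < X) (h2 : X < x R) (h3 : x R < x L + 2 * N)
    (h4 : y L < Y + N) (h5 : Y < y R + N) (h6 : y R + N ≤ y L) : False := by
  have hN := h.pos
  obtain ⟨L', hL', R', hR', k1, k2, k3, k4, k5, k6, k7, k8, k9⟩ :=
    h.exists_window H (y0 := y R + N) h5.le (by linarith)
  have k10 := k9 L hL (by linarith) (by linarith) (by linarith)
  have e1 := H.2 L' hL' R hR
  have e2 := h.cases hR hR'
  clear k9
  unfold HL at *
  grind

theorem Packing.not_longPath (h : Packing V N x y) {X Y : ℝ} : ¬ LongPath V N x y X Y := by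
  intro H
  have hN := h.pos
  obtain ⟨L, hL, R, hR, k1, k2, k3, k4, k5, k6, k7, k8, -⟩ :=
    h.exists_window H le_rfl (by linarith)
  rcases k8 with k8 | k8
  · exact h.reflect.longPath_aux H.reflect (L := R) (R := L) hR hL (by linarith) (by linarith)
      (by linarith) k6 k5 k8
  · exact h.longPath_aux H hL hR k1 k2 k3 k4 k7 k8

/-- The vertical line at `X` meets the square `a` (if `a = b`) or the gap between `a` and `b`. -/
def OnLine (V : Set ι) (N : ℝ) (x y : ι → ℝ) (X : ℝ) (a b : ι) : Prop :=
  a ∈ V ∧ b ∈ V ∧ ((a = b ∧ x a ≤ X ∧ X ≤ x a + N) ∨ (HL N x y a b ∧ x a + N ≤ X ∧ X ≤ x b))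

/-- By `not_longPath` the upward path meets a square or a gap within height `3 * N`, and local
finiteness provides the lowest obstacle. -/
theorem Packing.exists_first (h : Packing V N x y) {X Y : ℝ}
    (hs : ∀ f ∈ V, ¬ InSq N x y f X Y) (hg : NoGap V N x y X Y) :
    ∃ a b, OnLine V N x y X a b ∧ Y < max (y a) (y b) ∧
      FreePath V N x y X Y (max (y a) (y b)) := by
  have hN := h.pos
  have hne : ∃ a b, OnLine V N x y X a b ∧ Y < max (y a) (y b) ∧ max (y a) (y b) ≤ Y + 3 * N := by
    by_contra! hc
    refine h.not_longPath (X := X) (Y := Y) ⟨fun f hf h1 h2 => ?_, fun p hp q hq hl h1 h2 => ?_⟩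
    · by_contra! h3
      have := hc f f ⟨hf, hf, Or.inl ⟨rfl, h1, h2⟩⟩
      rw [max_self] at this
      by_cases h4 : Y < y f
      · linarith [this h4]
      · exact hs f hf ⟨h1, h2, not_lt.1 h4, h3.1⟩
    · by_contra! h3
      have h5 := hc p q ⟨hp, hq, Or.inr ⟨hl, h1, h2⟩⟩
      rw [lt_max_iff, lt_max_iff] at h5
      by_cases h4 : Y < y p ∨ Y < y q
      · rcases h5 h4 with h5 | h5 <;> linarith
      · push Not at h4
        exact hg p hp q hq hl ⟨h1, h2, h4.1, h4.2, h3.1, h3.2.1⟩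
  have hf := h.fin X Y (4 * N)
  have hfin : {z : ι × ι | OnLine V N x y X z.1 z.2 ∧ Y < max (y z.1) (y z.2) ∧
      max (y z.1) (y z.2) ≤ Y + 3 * N}.Finite := by
    refine (hf.prod hf).subset ?_
    rintro ⟨a, b⟩ ⟨⟨ha, hb, h1⟩, h2, h3⟩
    rw [max_le_iff] at h3
    rw [lt_max_iff] at h2
    dsimp only at ha hb h1 h2 h3
    refine ⟨⟨ha, abs_le.2 ?_, abs_le.2 ?_⟩, ⟨hb, abs_le.2 ?_, abs_le.2 ?_⟩⟩ <;>
    rcases h1 with ⟨rfl, h4, h5⟩ | ⟨⟨h4, h5, h6, h7⟩, h8, h9⟩ <;>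
    rcases h2 with h2 | h2 <;> constructor <;> linarith
  obtain ⟨a, b, hab⟩ := hne
  obtain ⟨⟨a, b⟩, ⟨h1, h2, h3⟩, h4⟩ := hfin.exists_minimalFor
    (fun z => max (y z.1) (y z.2)) _ ⟨(a, b), hab⟩
  dsimp only at h1 h2 h3
  have h4' : ∀ p q, OnLine V N x y X p q → Y < max (y p) (y q) →
      max (y a) (y b) ≤ max (y p) (y q) := by
    intro p q k1 k2
    by_contra! k3
    exact absurd (h4 (j := (p, q)) ⟨k1, k2, by dsimp only; linarith⟩ k3.le) (not_le.2 k3)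
  refine ⟨a, b, h1, h2, fun f hf Z k1 k2 k3 => ?_, fun p hp q hq hl Z k1 k2 k3 => ?_⟩
  · have := h4' f f ⟨hf, hf, Or.inl ⟨rfl, k3.1, k3.2.1⟩⟩
    rw [max_self] at this
    by_cases k4 : Y < y f
    · linarith [this k4, k3.2.2.1]
    · exact hs f hf ⟨k3.1, k3.2.1, not_lt.1 k4, by linarith [k3.2.2.2]⟩
  · obtain ⟨k4, k5, k6, k7, k8, k9⟩ := k3
    have := h4' p q ⟨hp, hq, Or.inr ⟨hl, k4, k5⟩⟩
    by_cases k10 : Y < max (y p) (y q)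
    · linarith [this k10, max_le k6 k7]
    · rw [not_lt, max_le_iff] at k10
      exact hg p hp q hq hl ⟨k4, k5, k10.1, k10.2, by linarith, by linarith⟩

/-- The coordinates of the point `(X, Y)` are not those of the edges of the squares. -/
def Generic (V : Set ι) (N : ℝ) (x y : ι → ℝ) (X Y : ℝ) : Prop :=
  ∀ p ∈ V, X ≠ x p ∧ X ≠ x p + N ∧ Y ≠ y p ∧ Y ≠ y p + N

theorem Generic.swap {X Y : ℝ} (g : Generic V N x y X Y) : Generic V N y x Y X :=
  fun p hp => ⟨(g p hp).2.2.1, (g p hp).2.2.2, (g p hp).1, (g p hp).2.1⟩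

theorem Packing.hasCell_of_noGap (h : Packing V N x y) {X Y : ℝ} (g : Generic V N x y X Y)
    (hs : ∀ f ∈ V, ¬ InSq N x y f X Y) (hg : NoGap V N x y X Y) (hg' : NoGap V N y x Y X) :
    HasCell V N x y X Y := by
  obtain ⟨a, b, ⟨ha, hb, h1⟩, h2, h3⟩ := h.exists_first hs hg
  obtain ⟨g1, g2, -, -⟩ := g a ha
  obtain ⟨g3, g4, -, -⟩ := g b hb
  rcases h1 with ⟨rfl, h4, h5⟩ | ⟨hl, h4, h5⟩
  · rw [max_self] at h2 h3
    exact h.cell_of_square ha h3 h2 (lt_of_le_of_ne h4 g1.symm) (lt_of_le_of_ne h5 g2) hg'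
  · have h4' := lt_of_le_of_ne h4 g2.symm
    have h5' := lt_of_le_of_ne h5 g3
    rcases le_total (y b) (y a) with h6 | h6
    · rw [max_eq_left h6] at h2 h3
      exact h.cell_of_gap ha hb hl h6 h3 h2 h4' h5'
    · rw [max_eq_right h6] at h2 h3
      exact HasCell.of_reflect (h.reflect.cell_of_gap hb ha (hl_reflect.2 hl) h6 h3.reflect h2
        (by linarith) (by linarith))

/-- The point lies in a vertical gap that is not an arm, so the gap is the middle of a pinwheel, up
to reflection. Genericity makes the inequalities strict. -/
theorem Packing.hasCell_of_gap (h : Packing V N x y) {X Y : ℝ} (g : Generic V N x y X Y)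
    (harm : ∀ p q, ¬ InArm V N y x p q Y X) (hg' : ¬ NoGap V N y x Y X) :
    HasCell V N x y X Y := by
  unfold NoGap at hg'
  push Not at hg'
  obtain ⟨p, hp, q, hq, hl, h1, h2, h3, h4, h5, h6⟩ := hg'
  have hn : ¬ Arm V N y x p q := fun ha => harm p q
    ⟨ha, h1, h2, max_le h3 h4, by rw [← min_add_add_right]; exact le_min h5 h6⟩
  obtain ⟨g1, g2, g3, g4⟩ := g p hp
  obtain ⟨g5, g6, g7, g8⟩ := g q hq
  replace h1 := lt_of_le_of_ne h1 g4.symm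
  replace h2 := lt_of_le_of_ne h2 g7
  replace h3 := lt_of_le_of_ne h3 g1.symm
  replace h4 := lt_of_le_of_ne h4 g5.symm
  replace h5 := lt_of_le_of_ne h5 g2
  replace h6 := lt_of_le_of_ne h6 g6
  have key : ∀ (x : ι → ℝ) (X : ℝ), Packing V N x y → HL N y x p q → ¬ Arm V N y x p q →
      x p < X → x q < X → X < x p + N → X < x q + N → ∀ r s, Arm V N y x p r → Arm V N y x s q →
      y r < y q → y p < y s → x q + N ≤ x r → x s + N ≤ x p → HasCell V N x y X Y := by
    intro x X h hl hn k1 k2 k3 k4 r s m1 m2 m3 m4 m5 m6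
    refine h.pinwheel hl hn m1 m2 m3 m4 m5 m6 ⟨?_, ?_, ?_, lt_max_of_lt_left h2⟩
    · exact lt_of_le_of_lt (by gcongr; exact min_le_left _ _) (m6.trans_lt k1)
    · exact lt_max_of_lt_left (k4.trans_le m5)
    · exact lt_of_le_of_lt (by gcongr; exact min_le_right _ _) h1
  obtain ⟨r, hr, s, hs, A1, A2, k1, k2, ⟨k3, k4⟩ | ⟨k3, k4⟩⟩ :=
    h.swap.exists_of_not_arm hp hq hl hn
  · exact key x X h hl hn h3 h4 h5 h6 r s A1 A2 k1 k2 k3 k4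
  · refine HasCell.of_reflect (key _ (-X) h.reflect (hl_reflect_swap.2 hl)
      (fun ha => hn (arm_reflect_swap.1 ha)) ?_ ?_ ?_ ?_ r s (arm_reflect_swap.2 A1)
      (arm_reflect_swap.2 A2) k1 k2 ?_ ?_) <;> linarith

/-- Every generic point outside the squares and the arms lies in a cell. -/
theorem Packing.hasCell (h : Packing V N x y) {X Y : ℝ} (g : Generic V N x y X Y)
    (hs : ∀ f ∈ V, ¬ InSq N x y f X Y) (ha : ∀ p q, ¬ InArm V N x y p q X Y)
    (ha' : ∀ p q, ¬ InArm V N y x p q Y X) : HasCell V N x y X Y := by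
  by_cases hg : NoGap V N x y X Y
  · by_cases hg' : NoGap V N y x Y X
    · exact h.hasCell_of_noGap g hs hg hg'
    · exact h.hasCell_of_gap g ha' hg'
  · exact (h.swap.hasCell_of_gap g.swap ha hg).swap

end CellOfPoint

/-! ### The openings of a cell are arms -/

section Openings

variable {ι : Type*} {V : Set ι} {N : ℝ} {x y : ι → ℝ}

/-- Some square contains the point `(X, Y)`. -/
def Covered (V : Set ι) (N : ℝ) (x y : ι → ℝ) (X Y : ℝ) : Prop := ∃ f ∈ V, InSq N x y f X Y

theorem Packing.exists_below_not_covered (h : Packing V N x y) {X T : ℝ}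
    (hc : ¬ Covered V N x y X T) : ∃ ε > 0, ∀ Y, T - ε < Y → Y ≤ T → ¬ Covered V N x y X Y := by
  have hN := h.pos
  have hf := h.fin X T (N + 1)
  have hcl : IsClosed (⋃ f ∈ {p | p ∈ V ∧ |x p - X| ≤ N + 1 ∧ |y p - T| ≤ N + 1},
      {Y | InSq N x y f X Y}) := by
    refine hf.isClosed_biUnion fun f _ => ?_
    unfold InSq
    simp only [ofPred_and]
    exact (isClosed_const.inter (isClosed_const.inter
      ((isClosed_le continuous_const continuous_id).inter
        (isClosed_le continuous_id continuous_const))))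
  have hT : T ∉ ⋃ f ∈ {p | p ∈ V ∧ |x p - X| ≤ N + 1 ∧ |y p - T| ≤ N + 1},
      {Y | InSq N x y f X Y} := by
    simp only [mem_iUnion, not_exists]
    exact fun f hf' hf'' => hc ⟨f, hf'.1, hf''⟩
  obtain ⟨ε, hε, hb⟩ := Metric.isOpen_iff.1 hcl.isOpen_compl T hT
  refine ⟨min ε 1, lt_min hε one_pos, fun Y h1 h2 ⟨f, hf', hs⟩ => ?_⟩
  have h3 : T - ε < Y ∧ T - 1 < Y :=
    ⟨by linarith [min_le_left ε 1], by linarith [min_le_right ε 1]⟩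
  refine hb (show Y ∈ Metric.ball T ε from ?_) ?_
  · rw [Metric.mem_ball, Real.dist_eq, abs_lt]
    constructor <;> linarith
  · simp only [mem_iUnion]
    obtain ⟨k1, k2, k3, k4⟩ := hs
    refine ⟨f, ⟨hf', abs_le.2 ⟨by linarith, by linarith⟩, abs_le.2 ⟨by linarith, by linarith⟩⟩,
      k1, k2, k3, k4⟩

/-- The points of the horizontal segment between `(X₁, T)` and `(X₂, T)` outside the squares belong
to the arm between `p` and `q` and to no other arm; the end points belong to squares. -/
structure Opening (V : Set ι) (N : ℝ) (x y : ι → ℝ) (X₁ X₂ T : ℝ) (p q : ι) : Prop where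
  left : Covered V N x y X₁ T
  right : Covered V N x y X₂ T
  mem : ∀ X, X₁ ≤ X → X ≤ X₂ → ¬ Covered V N x y X T → InArm V N x y p q X T
  unique : ∀ X, X₁ ≤ X → X ≤ X₂ → ¬ Covered V N x y X T →
    (∀ p' q', InArm V N x y p' q' X T → p' = p ∧ q' = q) ∧ ∀ p' q', ¬ InArm V N y x p' q' T X

theorem covered_flip {X Y : ℝ} :
    Covered V N x (fun p => -y p - N) X Y ↔ Covered V N x y X (-Y) := by
  unfold Covered
  refine exists_congr fun f => and_congr_right fun _ => ?_
  rw [← inSq_swap, inSq_reflect, inSq_swap]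

theorem Opening.of_flip {X₁ X₂ T : ℝ} {p q : ι}
    (h : Opening V N x (fun p => -y p - N) X₁ X₂ T p q) : Opening V N x y X₁ X₂ (-T) p q where
  left := covered_flip.1 h.left
  right := covered_flip.1 h.right
  mem X h1 h2 h3 := inArm_reflect_swap.1 (h.mem X h1 h2 fun h => h3 (covered_flip.1 h))
  unique X h1 h2 h3 := by
    obtain ⟨h4, h5⟩ := h.unique X h1 h2 (fun h => h3 (covered_flip.1 h))
    exact ⟨fun p' q' h6 => h4 p' q' (inArm_reflect_swap.2 h6),
      fun p' q' h6 => h5 q' p' (inArm_reflect.2 h6)⟩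

theorem Cell.reflect {a b c d : ι} {X Y : ℝ} (h : Cell V N x y a b c d X Y) :
    Cell V N (fun p => -x p - N) y b a d c (-X) Y := by
  refine Cell.of_reflect ?_
  simpa using h

theorem Cell.flip {a b c d : ι} {X Y : ℝ} (h : Cell V N x y a b c d X Y) :
    Cell V N x (fun p => -y p - N) d c b a X (-Y) := h.swap.reflect.swap

/-- Uncovered points of the upper side lie strictly between `a` and `b`, hence in their arm. Any
other arm through such a point either continues below the side, into the rectangle and off the
squares, against `clear_x` or `clear_y`, or is horizontal with lower edge on the side, and then its
end squares overlap `a` and `b`. -/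
theorem Cell.exists_opening (hp : Packing V N x y) {a b c d : ι} {X₀ Y₀ : ℝ}
    (h : Cell V N x y a b c d X₀ Y₀) {X : ℝ} (h1 : min (x d) (x a) + N ≤ X)
    (h2 : X ≤ max (x b) (x c)) (hX : ¬ Covered V N x y X (max (y a) (y b))) :
    ∃ X₁ X₂ p q, Opening V N x y X₁ X₂ (max (y a) (y b)) p q ∧ X₁ ≤ X ∧ X ≤ X₂ ∧
      min (x d) (x a) + N ≤ X₁ ∧ X₂ ≤ max (x b) (x c) := by
  have hN := hp.pos
  obtain ⟨l1, l2, l3, l4⟩ := h.toRing.links hp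
  have ha := h.ha
  have hb := h.hb
  have hc := h.hc
  have hd := h.hd
  have A1 : x a ≤ X := by
    refine le_trans ?_ h1
    rw [← min_add_add_right]
    refine le_min ?_ (by linarith)
    rcases l4 with rfl | l4
    · linarith
    · exact l4.2.2.1.le
  have A2 : X ≤ x b + N := by
    refine h2.trans (max_le (by linarith) ?_)
    rcases l2 with rfl | l2
    · linarith
    · exact l2.2.2.2.le
  have A3 : max (y a) (y b) < y a + N := by
    refine max_lt (by linarith) ?_
    rcases l1 with rfl | l1
    · linarith
    · exact l1.2.2.1
  have A4 : max (y a) (y b) < y b + N := by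
    refine max_lt ?_ (by linarith)
    rcases l1 with rfl | l1
    · linarith
    · exact l1.2.2.2
  have A5 : x a + N < X := by
    by_contra! h3
    exact hX ⟨a, ha, A1, h3, le_max_left _ _, A3.le⟩
  have A6 : X < x b := by
    by_contra! h3
    exact hX ⟨b, hb, h3, A2, le_max_right _ _, A4.le⟩
  have hA : Arm V N x y a b := by
    rcases h.top with rfl | l1
    · linarith
    · exact l1
  have hl := hp.arm_hl hA
  refine ⟨x a + N, x b, a, b, ⟨⟨a, ha, by linarith, le_rfl, le_max_left _ _, A3.le⟩,
    ⟨b, hb, le_rfl, by linarith, le_max_right _ _, A4.le⟩, ?_, ?_⟩, A5.le, A6.le,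
    by gcongr; exact min_le_right _ _, le_max_left _ _⟩
  · intro X' h3 h4 _
    refine ⟨hA, h3, h4, le_rfl, ?_⟩
    rw [← min_add_add_right]
    exact le_min A3.le A4.le
  intro X' h3 h4 h5
  set T := max (y a) (y b) with hT
  replace h3 : x a + N < X' := by
    by_contra! h6
    exact h5 ⟨a, ha, by linarith, h6, le_max_left _ _, A3.le⟩
  replace h4 : X' < x b := by
    by_contra! h6
    exact h5 ⟨b, hb, h6, by linarith, le_max_right _ _, A4.le⟩
  obtain ⟨ε, hε, hb⟩ := hp.exists_below_not_covered h5
  have hbot : min (y d) (y c) + N < T := h.inRect.2.2.1.trans h.inRect.2.2.2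
  have key : ∀ m, m < T → ∃ Y, m < Y ∧ Y < T ∧ ¬ Covered V N x y X' Y ∧
      InRect N x y a b c d X' Y := by
    intro m hm
    obtain ⟨Y, k1, k2⟩ := exists_between (max_lt (max_lt hm hbot) (sub_lt_self T hε))
    rw [max_lt_iff, max_lt_iff] at k1
    exact ⟨Y, k1.1.1, k2, hb Y k1.2 k2.le,
      lt_of_le_of_lt (by gcongr; exact min_le_right _ _) h3, h4.trans_le (le_max_left _ _),
      k1.1.2, k2⟩
  constructor
  · rintro p' q' ⟨hA, k1, k2, k3, k4⟩
    have hl' := hp.arm_hl hA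
    have hp' := hA.1
    have hq' := hA.2.1
    have k5 : max (y p') (y q') = T := by
      by_contra! h6
      obtain ⟨Y, m1, m2, m3, m4⟩ := key _ (lt_of_le_of_ne k3 h6)
      exact m3 (h.clear_x X' Y p' q' m4 ⟨hA, k1, k2, m1.le, m2.le.trans k4⟩)
    have m1 : y p' ≤ T := k5 ▸ le_max_left _ _
    have m2 : y q' ≤ T := k5 ▸ le_max_right _ _
    have m3 : T < y p' + N := k5 ▸ max_lt (by linarith) hl'.2.2.1
    have m4 : T < y q' + N := k5 ▸ max_lt hl'.2.2.2 (by linarith)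
    have k6 : x p' + N < X' := by
      by_contra! h6
      exact h5 ⟨p', hp', by linarith, h6, m1, m3.le⟩
    have k7 : X' < x q' := by
      by_contra! h6
      exact h5 ⟨q', hq', h6, by linarith, m2, m4.le⟩
    have n1 : y a ≤ T := le_max_left _ _
    have n2 : y b ≤ T := le_max_right _ _
    obtain ⟨o1, o2, o3, o4⟩ := hl'
    obtain ⟨o5, o6, o7, o8⟩ := hl
    exact ⟨hp.eq_of hp' ha (by linarith) (by linarith) (by linarith) (by linarith),
      hp.eq_of hq' ‹b ∈ V› (by linarith) (by linarith) (by linarith) (by linarith)⟩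
  · rintro p' q' ⟨hA, k1, k2, k3, k4⟩
    rw [← min_add_add_right, le_min_iff] at k4
    rw [max_le_iff] at k3
    have k5 : y p' + N < T := by
      by_contra! h6
      exact h5 ⟨p', hA.1, k3.1, k4.1, by linarith, h6⟩
    obtain ⟨Y, m1, m2, m3, m4⟩ := key _ k5
    exact m3 (h.clear_y X' Y p' q' m4 ⟨hA, m1.le, m2.le.trans k2, max_le k3.1 k3.2,
      by rw [← min_add_add_right]; exact le_min k4.1 k4.2⟩)

end Openings

/-! ### Rectangular frames in the plane -/

section PlaneFrames

/-- The corners in `V` form a maximal locally finite packing by squares of side `N`. -/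
abbrev SquarePacking (V : Set Plane) (N : ℝ) : Prop :=
  Packing V N (fun p => p 0) (fun p => p 1)

variable {V : Set Plane} {N : ℝ}

theorem SquarePacking.dir (h : SquarePacking V N) (k : Fin 2) :
    Packing V N (fun p => p k) (fun p => p (k + 1)) := by
  fin_cases k
  exacts [h, h.swap]

theorem mem_square_iff {p z : Plane} (k : Fin 2) :
    z ∈ square N p ↔ InSq N (fun p => p k) (fun p => p (k + 1)) p (z k) (z (k + 1)) := by
  fin_cases k <;> simp [square, InSq, Pi.le_def, Fin.forall_fin_two] <;> tauto

theorem hasArm_iff {k : Fin 2} {p q : Plane} :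
    HasArm V N k p q ↔ Arm V N (fun p => p k) (fun p => p (k + 1)) p q := by
  have : ∀ p q : Plane, Faces N k p q ↔ Fc N (fun p => p k) (fun p => p (k + 1)) p q := by
    intro p q
    simp only [Faces, Fc, abs_lt]
    constructor <;> rintro ⟨h1, h2, h3⟩ <;> exact ⟨h1, by linarith, by linarith⟩
  simp only [HasArm, Arm, this]

theorem mem_arm_iff {k : Fin 2} {p q z : Plane} :
    HasArm V N k p q ∧ z ∈ arm N k p q ↔
      InArm V N (fun p => p k) (fun p => p (k + 1)) p q (z k) (z (k + 1)) := by
  rw [hasArm_iff]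
  rfl

theorem fin_two_eq (k k' : Fin 2) : k' = k ∨ k' = k + 1 := by
  revert k k'
  decide

theorem fin_two_add (k : Fin 2) : k + 1 + 1 = k := by
  revert k
  decide

/-- The union of the squares. -/
def squares (V : Set Plane) (N : ℝ) : Set Plane := ⋃ p ∈ V, square N p

theorem mem_squares {z : Plane} : z ∈ squares V N ↔ ∃ p ∈ V, z ∈ square N p := by
  simp [squares]

theorem mem_squares_iff {z : Plane} (k : Fin 2) :
    z ∈ squares V N ↔ Covered V N (fun p => p k) (fun p => p (k + 1)) (z k) (z (k + 1)) := by
  simp only [mem_squares, Covered, mem_square_iff k]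

theorem mem_freeSpace {z : Plane} : z ∈ freeSpace V N ↔
    z ∉ squares V N ∧ ∀ k p q, HasArm V N k p q → z ∉ arm N k p q := by
  simp [freeSpace, mem_squares]

/-- The open rectangle with lower left corner `u` and upper right corner `v`. -/
def rect (u v : Plane) : Set Plane := univ.pi fun i => Ioo (u i) (v i)

theorem mem_rect {u v z : Plane} : z ∈ rect u v ↔ ∀ i, u i < z i ∧ z i < v i := by
  simp [rect]

theorem isOpen_rect (u v : Plane) : IsOpen (rect u v) :=
  isOpen_set_pi finite_univ fun _ _ => isOpen_Ioo

theorem convex_rect (u v : Plane) : Convex ℝ (rect u v) :=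
  convex_pi fun _ _ => convex_Ioo _ _

theorem closure_rect {u v : Plane} (h : ∀ i, u i < v i) : closure (rect u v) = Icc u v := by
  rw [rect, closure_pi_set, ← pi_univ_Icc]
  congr! with i
  exact closure_Ioo (h i).ne

/-- The cross `C` is obtained from a rectangle by removing squares; its intersections with the
sides of the rectangle are arms. -/
structure CrossFrame (V : Set Plane) (N : ℝ) (C : Set Plane) (u v : Plane) : Prop where
  lt : ∀ i, u i < v i
  le : ∀ i, v i ≤ u i + 2 * N
  subset : C ⊆ rect u v
  free : rect u v \ squares V N ⊆ freeSpace V N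
  side : ∀ w ∈ Icc u v, w ∉ rect u v → w ∉ squares V N →
    ∃ e₁ e₂, e₁ ∈ squares V N ∧ e₂ ∈ squares V N ∧ e₁ ∈ Icc u v ∧ e₂ ∈ Icc u v ∧
      w ∈ segment ℝ e₁ e₂ ∧ (∀ z ∈ segment ℝ e₁ e₂, z ∉ rect u v) ∧
      ∃ A : Fin 2 × Plane × Plane, (HasArm V N A.1 A.2.1 A.2.2 ∧ w ∈ arm N A.1 A.2.1 A.2.2) ∧
        ∀ z ∈ segment ℝ e₁ e₂, z ∉ squares V N → ∀ k p q, HasArm V N k p q → z ∈ arm N k p q →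
          (k, p, q) = A

theorem Opening.side {k : Fin 2} {X₁ X₂ T : ℝ} {p q : Plane}
    (h : Opening V N (fun p => p k) (fun p => p (k + 1)) X₁ X₂ T p q) {u v w : Plane}
    (h1 : X₁ ≤ w k) (h2 : w k ≤ X₂) (h3 : w (k + 1) = T) (h4 : u k ≤ X₁) (h5 : X₂ ≤ v k)
    (h6 : T = u (k + 1) ∨ T = v (k + 1)) (huv : ∀ i, u i < v i) (hw : w ∉ squares V N) :
    ∃ e₁ e₂, e₁ ∈ squares V N ∧ e₂ ∈ squares V N ∧ e₁ ∈ Icc u v ∧ e₂ ∈ Icc u v ∧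
      w ∈ segment ℝ e₁ e₂ ∧ (∀ z ∈ segment ℝ e₁ e₂, z ∉ rect u v) ∧
      ∃ A : Fin 2 × Plane × Plane, (HasArm V N A.1 A.2.1 A.2.2 ∧ w ∈ arm N A.1 A.2.1 A.2.2) ∧
        ∀ z ∈ segment ℝ e₁ e₂, z ∉ squares V N → ∀ k p q, HasArm V N k p q → z ∈ arm N k p q →
          (k, p, q) = A := by
  have hk : k + 1 ≠ k := by
    fin_cases k <;> decide
  have ext' : ∀ i, i = k ∨ i = k + 1 := fin_two_eq k
  set e₁ : Plane := fun i => if i = k then X₁ else T with he₁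
  set e₂ : Plane := fun i => if i = k then X₂ else T with he₂
  have a1 : e₁ k = X₁ := by simp [he₁]
  have a2 : e₁ (k + 1) = T := by simp [he₁, hk]
  have a3 : e₂ k = X₂ := by simp [he₂]
  have a4 : e₂ (k + 1) = T := by simp [he₂, hk]
  have hT : u (k + 1) ≤ T ∧ T ≤ v (k + 1) := by
    rcases h6 with h6 | h6
    · exact ⟨h6.ge, h6.trans_le (huv _).le⟩
    · exact ⟨(huv _).le.trans h6.ge, h6.le⟩
  have hle : e₁ ≤ e₂ := by
    intro i
    rcases ext' i with rfl | rfl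
    · rw [a1, a3]; exact h1.trans h2
    · rw [a2, a4]
  have hseg : ∀ z ∈ segment ℝ e₁ e₂, X₁ ≤ z k ∧ z k ≤ X₂ ∧ z (k + 1) = T := by
    intro z hz
    have := segment_subset_Icc hle hz
    refine ⟨a1 ▸ this.1 k, a3 ▸ this.2 k, le_antisymm (a4 ▸ this.2 (k + 1)) (a2 ▸ this.1 (k + 1))⟩
  refine ⟨e₁, e₂, (mem_squares_iff k).2 ?_, (mem_squares_iff k).2 ?_, ⟨?_, ?_⟩, ⟨?_, ?_⟩, ?_, ?_,
    (k, p, q), ?_, ?_⟩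
  · rw [a1, a2]; exact h.left
  · rw [a3, a4]; exact h.right
  · intro i
    rcases ext' i with rfl | rfl
    · rw [a1]; exact h4
    · rw [a2]; exact hT.1
  · intro i
    rcases ext' i with rfl | rfl
    · rw [a1]; linarith
    · rw [a2]; exact hT.2
  · intro i
    rcases ext' i with rfl | rfl
    · rw [a3]; linarith
    · rw [a4]; exact hT.1
  · intro i
    rcases ext' i with rfl | rfl
    · rw [a3]; exact h5
    · rw [a4]; exact hT.2
  · have hwk : w k ∈ segment ℝ X₁ X₂ := by
      rw [segment_eq_Icc (h1.trans h2)]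
      exact ⟨h1, h2⟩
    obtain ⟨a, b, ha, hb, hab, hw'⟩ := hwk
    refine ⟨a, b, ha, hb, hab, ?_⟩
    ext i
    rcases ext' i with rfl | rfl
    · simpa [a1, a3] using hw'
    · simp only [Pi.add_apply, Pi.smul_apply, a2, a4, h3, smul_eq_mul]
      rw [← add_mul, hab, one_mul]
  · intro z hz hz'
    have h7 := (hseg z hz).2.2
    have h8 := mem_rect.1 hz' (k + 1)
    rcases h6 with h6 | h6 <;> rw [h7, h6] at h8 <;> simp at h8
  · refine mem_arm_iff.2 ?_
    dsimp only
    rw [h3]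
    exact h.mem _ h1 h2 (by rwa [← h3, ← mem_squares_iff k])
  · intro z hz hz' k' p' q' hA hm
    obtain ⟨h7, h8, h9⟩ := hseg z hz
    obtain ⟨h10, h11⟩ := h.unique _ h7 h8 (by rwa [← h9, ← mem_squares_iff k])
    have hA' := mem_arm_iff.1 ⟨hA, hm⟩
    rcases ext' k' with rfl | rfl
    · rw [h9] at hA'
      obtain ⟨rfl, rfl⟩ := h10 p' q' hA'
      rfl
    · rw [fin_two_add, h9] at hA'
      exact absurd hA' (h11 p' q')

theorem Cell.crossFrame (hp : SquarePacking V N) {a b c d : Plane} {X₀ Y₀ : ℝ}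
    (h : Cell V N (fun p => p 0) (fun p => p 1) a b c d X₀ Y₀) :
    ∃ u v : Plane, (u 0 < X₀ ∧ X₀ < v 0 ∧ u 1 < Y₀ ∧ Y₀ < v 1) ∧ ∀ C : Set Plane,
      C ⊆ rect u v → CrossFrame V N C u v := by
  have hN := hp.pos
  have hr := h.inRect
  obtain ⟨l1, l2, l3, l4⟩ := h.toRing.links hp
  set u : Plane := ![min (d 0) (a 0) + N, min (d 1) (c 1) + N] with hu
  set v : Plane := ![max (b 0) (c 0), max (a 1) (b 1)] with hv
  have u0 : u 0 = min (d 0) (a 0) + N := rfl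
  have u1 : u 1 = min (d 1) (c 1) + N := rfl
  have v0 : v 0 = max (b 0) (c 0) := rfl
  have v1 : v 1 = max (a 1) (b 1) := rfl
  have hQ : ∀ z : Plane, z ∈ rect u v ↔
      InRect N (fun p => p 0) (fun p => p 1) a b c d (z 0) (z 1) := by
    intro z
    rw [mem_rect, Fin.forall_fin_two, u0, u1, v0, v1, InRect]
    tauto
  have hlt : ∀ i, u i < v i := by
    rw [Fin.forall_fin_two]
    exact ⟨hr.1.trans hr.2.1, hr.2.2.1.trans hr.2.2.2⟩
  refine ⟨u, v, ⟨hr.1, hr.2.1, hr.2.2.1, hr.2.2.2⟩, fun C hC => ⟨hlt, ?_, hC, ?_, ?_⟩⟩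
  · rw [Fin.forall_fin_two, u0, u1, v0, v1]
    clear hQ hlt
    unfold HL at *
    constructor <;> rw [max_le_iff, ← min_add_add_right, ← min_add_add_right] <;>
      constructor <;> refine le_min ?_ ?_ <;> grind
  · rintro z ⟨hz, hz'⟩
    refine mem_freeSpace.2 ⟨hz', fun k p q hA hm => ?_⟩
    have hA' := mem_arm_iff.1 ⟨hA, hm⟩
    rw [mem_squares_iff 0] at hz'
    fin_cases k
    · exact hz' (h.clear_x _ _ p q ((hQ z).1 hz) hA')
    · exact hz' (h.clear_y _ _ p q ((hQ z).1 hz) hA')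
  · rintro w ⟨hw1, hw2⟩ hw hwS
    have c0 := hw1 0
    have c1 := hw1 1
    have c2 := hw2 0
    have c3 := hw2 1
    have hne : w 1 = v 1 ∨ w 1 = u 1 ∨ w 0 = v 0 ∨ w 0 = u 0 := by
      by_contra! h7
      refine hw (mem_rect.2 ?_)
      rw [Fin.forall_fin_two]
      exact ⟨⟨lt_of_le_of_ne c0 h7.2.2.2.symm, lt_of_le_of_ne c2 h7.2.2.1⟩,
        lt_of_le_of_ne c1 h7.2.1.symm, lt_of_le_of_ne c3 h7.1⟩
    have s0 : ¬ Covered V N (fun p => p 0) (fun p => p 1) (w 0) (w 1) :=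
      mt (mem_squares_iff 0).2 hwS
    have s1 : ¬ Covered V N (fun p => p 1) (fun p => p 0) (w 1) (w 0) :=
      mt (mem_squares_iff 1).2 hwS
    have fl : ∀ s t : ℝ, -(max (-s - N) (-t - N)) = min s t + N := by
      intro s t
      rw [← min_neg_neg, ← min_add_add_right]
      congr 1 <;> ring
    -- `exists_opening` treats the upper side; the lower, right and left sides follow by `flip`,
    -- `swap` and both.
    rcases hne with e | e | e | e
    · obtain ⟨X₁, X₂, p, q, ho, k1, k2, k3, k4⟩ := h.exists_opening hp (X := w 0) c0 c2
        (by rwa [← v1, ← e])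
      exact ho.side (k := 0) k1 k2 e k3 k4 (Or.inr rfl) hlt hwS
    · obtain ⟨X₁, X₂, p, q, ho, k1, k2, k3, k4⟩ := h.flip.exists_opening hp.flip (X := w 0)
        (by rwa [min_comm]) (by rwa [max_comm])
        (by
          rwa [covered_flip, fl, ← u1, ← e])
      rw [min_comm] at k3
      rw [max_comm] at k4
      have ho := ho.of_flip
      rw [fl] at ho
      exact ho.side (k := 0) k1 k2 e k3 k4 (Or.inl rfl) hlt hwS
    · obtain ⟨X₁, X₂, p, q, ho, k1, k2, k3, k4⟩ := h.swap.exists_opening hp.swap (X := w 1)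
        c1 (by rwa [max_comm])
        (by
          rwa [max_comm, ← v0, ← e])
      rw [max_comm] at k4
      rw [max_comm] at ho
      exact ho.side (k := 1) k1 k2 e k3 k4 (Or.inr rfl) hlt hwS
    · obtain ⟨X₁, X₂, p, q, ho, k1, k2, k3, k4⟩ := h.swap.flip.exists_opening hp.swap.flip
        (X := w 1) (by rwa [min_comm]) c3
        (by
          rwa [covered_flip, fl, ← u0, ← e])
      rw [min_comm] at k3
      have ho := ho.of_flip
      rw [fl] at ho
      exact ho.side (k := 1) k1 k2 e k3 k4 (Or.inl rfl) hlt hwS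

end PlaneFrames

/-! ### Connected components -/

section Components

variable {S C K : Set Plane}

theorem IsComponent.subset (h : IsComponent S C) : C ⊆ S := by
  obtain ⟨x, hx, rfl⟩ := h
  exact connectedComponentIn_subset _ _

theorem IsComponent.nonempty (h : IsComponent S C) : C.Nonempty := by
  obtain ⟨x, hx, rfl⟩ := h
  exact ⟨x, mem_connectedComponentIn hx⟩

theorem IsComponent.isPreconnected (h : IsComponent S C) : IsPreconnected C := by
  obtain ⟨x, hx, rfl⟩ := h
  exact isPreconnected_connectedComponentIn

theorem IsComponent.isOpen (h : IsComponent S C) (hS : IsOpen S) : IsOpen C := by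
  obtain ⟨x, hx, rfl⟩ := h
  exact hS.connectedComponentIn

theorem IsComponent.subset_of_inter (h : IsComponent S C) (hK : IsPreconnected K) (hKS : K ⊆ S)
    (hKC : (K ∩ C).Nonempty) : K ⊆ C := by
  obtain ⟨z, hz, hz'⟩ := hKC
  obtain ⟨x, hx, rfl⟩ := h
  rw [connectedComponentIn_eq hz']
  exact hK.subset_connectedComponentIn hz hKS

theorem isComponent_connectedComponentIn {x : Plane} (hx : x ∈ S) :
    IsComponent S (connectedComponentIn S x) := ⟨x, hx, rfl⟩

end Components

/-! ### Crosses: frames, exit points and centers of mass -/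

section FreeSpace

variable {V : Set Plane} {N : ℝ} {C U : Set Plane}

theorem SquarePacking.finite_near (h : SquarePacking V N) (z : Plane) (R : ℝ) :
    {p ∈ V | dist p z ≤ R}.Finite := by
  refine (h.fin (z 0) (z 1) R).subset fun p hp => ⟨hp.1, ?_, ?_⟩
  · exact (dist_le_pi_dist p z 0).trans hp.2
  · exact (dist_le_pi_dist p z 1).trans hp.2

theorem dist_le_of_mem_square {p z : Plane} (hN : 0 < N) (hz : z ∈ square N p) :
    dist p z ≤ N := by
  rw [dist_comm, dist_pi_le_iff hN.le]
  intro i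
  rw [Real.dist_eq, abs_le]
  constructor
  · linarith [hz.1 i]
  · linarith [hz.2 i]

theorem SquarePacking.hasArm_hl (h : SquarePacking V N) {k : Fin 2} {p q : Plane}
    (hA : HasArm V N k p q) : HL N (fun p => p k) (fun p => p (k + 1)) p q :=
  (h.dir k).arm_hl (hasArm_iff.1 hA)

theorem SquarePacking.dist_le_of_mem_arm (h : SquarePacking V N) {k : Fin 2} {p q z : Plane}
    (hA : HasArm V N k p q) (hz : z ∈ arm N k p q) :
    dist p z ≤ 2 * N ∧ dist q z ≤ 2 * N := by
  have hN := h.pos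
  obtain ⟨h1, h2, h3, h4⟩ := h.hasArm_hl hA
  obtain ⟨k1, k2, k3, k4⟩ := hz
  rw [max_le_iff] at k3
  rw [← min_add_add_right, le_min_iff] at k4
  constructor <;>
  · rw [dist_comm, dist_pi_le_iff (by linarith)]
    intro i
    rw [Real.dist_eq, abs_le]
    rcases fin_two_eq k i with rfl | rfl <;> constructor <;> linarith

theorem isClosed_square (s : ℝ) (p : Plane) : IsClosed (square s p) := isClosed_Icc

theorem isClosed_arm (k : Fin 2) (p q : Plane) : IsClosed (arm N k p q) := by
  unfold arm
  simp only [ofPred_and]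
  have := continuous_apply (A := fun _ : Fin 2 => ℝ) k
  have := continuous_apply (A := fun _ : Fin 2 => ℝ) (k + 1)
  exact (isClosed_le continuous_const (by fun_prop)).inter
    ((isClosed_le (by fun_prop) continuous_const).inter
    ((isClosed_le continuous_const (by fun_prop)).inter
    (isClosed_le (by fun_prop) continuous_const)))

theorem SquarePacking.isClosed_squares (h : SquarePacking V N) : IsClosed (squares V N) := by
  have hN := h.pos
  rw [squares, biUnion_eq_iUnion]
  refine LocallyFinite.isClosed_iUnion (fun z => ⟨Metric.ball z 1, Metric.ball_mem_nhds z one_pos,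
    ?_⟩) fun p => isClosed_square _ _
  refine ((h.finite_near z (N + 1)).preimage Subtype.val_injective.injOn).subset ?_
  rintro ⟨p, hp⟩ ⟨w, hw, hw'⟩
  refine ⟨hp, (dist_triangle p w z).trans (add_le_add (dist_le_of_mem_square hN hw) ?_)⟩
  exact (Metric.mem_ball.1 hw').le

/-- The arms near a point are finitely many. -/
theorem SquarePacking.finite_arms (h : SquarePacking V N) (z : Plane) (R : ℝ) :
    {A : Fin 2 × Plane × Plane | HasArm V N A.1 A.2.1 A.2.2 ∧
      (arm N A.1 A.2.1 A.2.2 ∩ Metric.closedBall z R).Nonempty}.Finite := by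
  refine (finite_univ.prod ((h.finite_near z (2 * N + R)).prod
    (h.finite_near z (2 * N + R)))).subset ?_
  rintro ⟨k, p, q⟩ ⟨hA, w, hw, hw'⟩
  obtain ⟨h1, h2⟩ := h.dist_le_of_mem_arm hA hw
  exact ⟨mem_univ _, ⟨hA.1, (dist_triangle p w z).trans (add_le_add h1 hw')⟩,
    ⟨hA.2.1, (dist_triangle q w z).trans (add_le_add h2 hw')⟩⟩

theorem SquarePacking.isOpen_freeSpace (h : SquarePacking V N) : IsOpen (freeSpace V N) := by
  have h1 : IsClosed (⋃ A : {A : Fin 2 × Plane × Plane // HasArm V N A.1 A.2.1 A.2.2},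
      arm N A.1.1 A.1.2.1 A.1.2.2) := by
    refine LocallyFinite.isClosed_iUnion (fun z => ⟨Metric.ball z 1,
      Metric.ball_mem_nhds z one_pos, ?_⟩) fun A => isClosed_arm _ _ _
    refine ((h.finite_arms z 1).preimage Subtype.val_injective.injOn).subset ?_
    rintro ⟨A, hA⟩ ⟨w, hw, hw'⟩
    exact ⟨hA, w, hw, Metric.ball_subset_closedBall hw'⟩
  convert h.isClosed_squares.isOpen_compl.inter h1.isOpen_compl using 1
  ext z
  simp [mem_freeSpace]

theorem SquarePacking.countable (h : SquarePacking V N) : V.Countable := by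
  have : V = ⋃ n : ℕ, {p ∈ V | dist p 0 ≤ n} := by
    ext p
    simp only [mem_iUnion, mem_ofPred_eq]
    exact ⟨fun hp => (exists_nat_ge (dist p 0)).imp fun n hn => ⟨hp, hn⟩, fun ⟨n, hn⟩ => hn.1⟩
  rw [this]
  exact countable_iUnion fun n => (h.finite_near 0 n).countable

theorem SquarePacking.exists_generic (h : SquarePacking V N) {O : Set Plane} (hO : IsOpen O)
    (hne : O.Nonempty) : ∃ z ∈ O, Generic V N (fun p => p 0) (fun p => p 1) (z 0) (z 1) := by
  obtain ⟨z, hz⟩ := hne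
  obtain ⟨ε, hε, hb⟩ := Metric.isOpen_iff.1 hO z hz
  have key : ∀ i : Fin 2, ∃ X, z i - ε < X ∧ X < z i + ε ∧ ∀ p ∈ V, X ≠ p i ∧ X ≠ p i + N := by
    intro i
    have hc : ((fun p : Plane => p i) '' V ∪ (fun p : Plane => p i + N) '' V).Countable :=
      (h.countable.image _).union (h.countable.image _)
    obtain ⟨X, hX, h1, h2⟩ := (hc.dense_compl ℝ).exists_between
      (show z i - ε < z i + ε by linarith)
    refine ⟨X, h1, h2, fun p hp => ⟨?_, ?_⟩⟩
    · rintro rfl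
      exact hX (Or.inl ⟨p, hp, rfl⟩)
    · rintro rfl
      exact hX (Or.inr ⟨p, hp, rfl⟩)
  choose g hg1 hg2 hg3 using key
  refine ⟨g, hb ?_, fun p hp => ⟨(hg3 0 p hp).1, (hg3 0 p hp).2, hg3 1 p hp⟩⟩
  rw [Metric.mem_ball, dist_pi_lt_iff hε]
  intro i
  rw [Real.dist_eq, abs_lt]
  constructor <;> linarith [hg1 i, hg2 i]

/-- A cross is open, so it contains a generic point, which has a cell. Points on the boundary of the
rectangle of this cell lie in squares or arms, so the connected cross cannot leave the rectangle. -/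
theorem SquarePacking.exists_crossFrame (h : SquarePacking V N) (hC : IsCross V N C) :
    ∃ u v, CrossFrame V N C u v := by
  obtain ⟨z, hz, hg⟩ := h.exists_generic (hC.isOpen h.isOpen_freeSpace) hC.nonempty
  have hzf := hC.subset hz
  obtain ⟨hz1, hz2⟩ := mem_freeSpace.1 hzf
  obtain ⟨a, b, c, d, hcell⟩ := h.hasCell hg (fun f hf hs => hz1 ((mem_squares_iff 0).2 ⟨f, hf, hs⟩))
    (fun p q hA => by
      obtain ⟨h1, h2⟩ := (mem_arm_iff (k := 0)).2 hA
      exact hz2 _ _ _ h1 h2)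
    (fun p q hA => by
      obtain ⟨h1, h2⟩ := (mem_arm_iff (k := 1)).2 hA
      exact hz2 _ _ _ h1 h2)
  obtain ⟨u, v, ⟨h1, h2, h3, h4⟩, h5⟩ := hcell.crossFrame h
  refine ⟨u, v, h5 C ?_⟩
  refine IsPreconnected.subset_left_of_subset_union (isOpen_rect u v)
    (isClosed_Icc (a := u) (b := v)).isOpen_compl ?_ ?_ ⟨z, hz, mem_rect.2 ?_⟩ hC.isPreconnected
  · refine disjoint_compl_right_iff_subset.2 fun w hw => ⟨fun i => ?_, fun i => ?_⟩
    · exact (mem_rect.1 hw i).1.le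
    · exact (mem_rect.1 hw i).2.le
  · intro w hw
    by_contra hw'
    rw [mem_union, not_or, mem_compl_iff, not_not] at hw'
    obtain ⟨k1, k2⟩ := mem_freeSpace.1 (hC.subset hw)
    obtain ⟨_, _, _, _, _, _, _, _, A, hA, -⟩ :=
      (h5 ∅ (empty_subset _)).side w hw'.2 hw'.1 k1
    exact k2 _ _ _ hA.1 hA.2
  · rw [Fin.forall_fin_two]
    exact ⟨⟨h1, h2⟩, h3, h4⟩

/-- The extreme values of the coordinates on a segment determine the sum of its end points. Thus a
cross has at most one exit point on each arm. -/
theorem midpoint_eq_of_segment_eq {a b a' b' : Plane} (h : segment ℝ a b = segment ℝ a' b') :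
    midpoint ℝ a b = midpoint ℝ a' b' := by
  have key : ∀ {a b z : Plane}, z ∈ segment ℝ a b → ∀ i,
      min (a i) (b i) ≤ z i ∧ z i ≤ max (a i) (b i) := by
    rintro a b z hz i
    have hz' : z i ∈ segment ℝ (a i) (b i) := by
      obtain ⟨s, t, hs, ht, hst, rfl⟩ := hz
      exact ⟨s, t, hs, ht, hst, rfl⟩
    rw [segment_eq_uIcc] at hz'
    exact hz'
  ext i
  have h1 := key (h ▸ left_mem_segment ℝ a b) i
  have h2 := key (h ▸ right_mem_segment ℝ a b) i
  have h3 := key (h.symm ▸ left_mem_segment ℝ a' b') i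
  have h4 := key (h.symm ▸ right_mem_segment ℝ a' b') i
  have h5 : a i + b i = a' i + b' i := by
    rw [← min_add_max (a i), ← min_add_max (a' i)]
    exact congr_arg₂ _ (le_antisymm (le_min h3.1 h4.1) (le_min h1.1 h2.1))
      (le_antisymm (max_le h1.2 h2.2) (max_le h3.2 h4.2))
  simp only [midpoint_eq_smul_add, Pi.smul_apply, Pi.add_apply, h5]

theorem CrossFrame.closure_subset {u v : Plane} (h : CrossFrame V N C u v) :
    closure C ⊆ Icc u v := by
  rw [← closure_rect h.lt]
  exact closure_mono h.subset

theorem CrossFrame.dist_le {u v : Plane} (h : CrossFrame V N C u v) (hN : 0 < N) {z w : Plane}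
    (hz : z ∈ Icc u v) (hw : w ∈ Icc u v) : dist z w ≤ 2 * N := by
  rw [dist_pi_le_iff (by linarith)]
  intro i
  rw [Real.dist_eq, abs_le]
  constructor <;> linarith [hz.1 i, hz.2 i, hw.1 i, hw.2 i, h.le i]

theorem SquarePacking.finite_exitPoints (h : SquarePacking V N) (hC : IsCross V N C) :
    (exitPoints V N C).Finite := by
  obtain ⟨u, v, hf⟩ := h.exists_crossFrame hC
  have hfin := h.finite_arms u (2 * N)
  refine (hfin.biUnion (t := fun A => {e | ∃ a b, closure C ∩ arm N A.1 A.2.1 A.2.2 =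
    segment ℝ a b ∧ e = midpoint ℝ a b}) fun A _ => Subsingleton.finite ?_).subset ?_
  · rintro e ⟨a, b, h1, rfl⟩ e' ⟨a', b', h2, rfl⟩
    exact midpoint_eq_of_segment_eq (h1 ▸ h2)
  · rintro e ⟨k, p, q, hA, a, b, h1, h2⟩
    refine mem_biUnion (x := (k, p, q)) ⟨hA, ?_⟩ ⟨a, b, h1, h2⟩
    have h3 : a ∈ closure C ∩ arm N k p q := h1 ▸ left_mem_segment ℝ a b
    exact ⟨a, h3.2, hf.dist_le h.pos (hf.closure_subset h3.1) ⟨le_rfl, fun i => (hf.lt i).le⟩⟩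

theorem SquarePacking.isClosed_decoration (h : SquarePacking V N) (hC : IsCross V N C) :
    IsClosed (decoration V N C) :=
  (h.finite_exitPoints hC).isClosed_biUnion fun e _ => by
    rw [← convexHull_pair]
    exact (toFinite {centerOfMass C, e}).isClosed_convexHull _

theorem CrossFrame.integrableOn {u v : Plane} (h : CrossFrame V N C u v) :
    IntegrableOn (fun x : Plane => x) C :=
  (continuous_id.integrableOn_Icc (a := u) (b := v)).mono_set
    (subset_closure.trans h.closure_subset)

theorem CrossFrame.measure_lt_top {u v : Plane} (h : CrossFrame V N C u v) :
    volume C < ⊤ :=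
  (measure_mono (subset_closure.trans h.closure_subset)).trans_lt
    (isCompact_Icc (a := u) (b := v)).measure_lt_top

/-- Each coordinate of the average lies between values attained in the cross, and these satisfy the
strict inequalities of the open rectangle. -/
theorem CrossFrame.centerOfMass_mem (hp : SquarePacking V N) (hC : IsCross V N C) {u v : Plane}
    (h : CrossFrame V N C u v) : centerOfMass C ∈ rect u v := by
  rw [mem_rect]
  intro i
  have h0 : volume C ≠ 0 := ((hC.isOpen hp.isOpen_freeSpace).measure_pos volume hC.nonempty).ne'
  have h1 : IntegrableOn (fun x : Plane => x i) C := h.integrableOn.eval i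
  have h2 : centerOfMass C i = ⨍ x in C, x i := by
    rw [centerOfMass, setAverage_eq, setAverage_eq, Pi.smul_apply,
      eval_integral fun i => h.integrableOn.eval i]
  obtain ⟨z, hz, hz'⟩ := exists_setAverage_le h0 h.measure_lt_top.ne h1
  obtain ⟨w, hw, hw'⟩ := exists_le_setAverage h0 h.measure_lt_top.ne h1
  rw [h2]
  exact ⟨(mem_rect.1 (h.subset hw) i).1.trans_le hw', hz'.trans_lt (mem_rect.1 (h.subset hz) i).2⟩

end FreeSpace

/-! ### Every cross-sector touches a square -/

section Sectors

variable {V : Set Plane} {N : ℝ} {C U : Set Plane} {u v : Plane}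

theorem exists_mem_side {K : Set Plane} (hK : IsPreconnected K) (h1 : (K ∩ rect u v).Nonempty)
    (h2 : ¬ K ⊆ rect u v) : ∃ w ∈ K, w ∈ Icc u v ∧ w ∉ rect u v := by
  by_contra! h
  refine h2 (IsPreconnected.subset_left_of_subset_union (isOpen_rect u v)
    (isClosed_Icc (a := u) (b := v)).isOpen_compl ?_ ?_ h1 hK)
  · exact disjoint_compl_right_iff_subset.2 fun w hw =>
      ⟨fun i => (mem_rect.1 hw i).1.le, fun i => (mem_rect.1 hw i).2.le⟩
  · intro w hw
    by_cases hw' : w ∈ Icc u v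
    · exact Or.inl (h w hw hw')
    · exact Or.inr hw'

/-- A sector whose closure does not meet the squares extends along segments which avoid the
decoration. -/
theorem CrossFrame.mem_closure_sector (h : CrossFrame V N C u v) (hp : SquarePacking V N)
    (hC : IsCross V N C) (hU : IsComponent (C \ decoration V N C) U)
    (hS : Disjoint (closure U) (squares V N)) {a b : Plane} (ha : a ∈ closure U)
    (hb : b ∈ Icc u v) (hD : ∀ z ∈ segment ℝ a b, z ∉ squares V N → z ∉ decoration V N C) :
    b ∈ closure U := by
  have hUC : U ⊆ C := fun z hz => (hU.subset hz).1
  -- A small ball around `x` avoids the squares and the decoration. Its trace on the open rectangle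
  -- is convex and meets the sector, hence is contained in it. This makes membership in `closure U`
  -- propagate along the segment.
  have step : ∀ x ∈ closure U, x ∉ decoration V N C →
      ∃ B, IsOpen B ∧ x ∈ B ∧ B ∩ Icc u v ⊆ closure U := by
    intro x hx hxD
    obtain ⟨ε, hε, hb⟩ := Metric.isOpen_iff.1 (hp.isClosed_squares.isOpen_compl.inter
      (hp.isClosed_decoration hC).isOpen_compl) x ⟨disjoint_left.1 hS hx, hxD⟩
    refine ⟨Metric.ball x ε, Metric.isOpen_ball, Metric.mem_ball_self hε, ?_⟩
    obtain ⟨w, hw, hwU⟩ := mem_closure_iff.1 hx _ Metric.isOpen_ball (Metric.mem_ball_self hε)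
    have hK : IsPreconnected (Metric.ball x ε ∩ rect u v) :=
      ((convex_ball x ε).inter (convex_rect u v)).isPreconnected
    have h1 : Metric.ball x ε ∩ rect u v ⊆ C :=
      hC.subset_of_inter hK (fun z hz => h.free ⟨hz.2, (hb hz.1).1⟩)
        ⟨w, ⟨hw, h.subset (hUC hwU)⟩, hUC hwU⟩
    have h2 : Metric.ball x ε ∩ rect u v ⊆ U :=
      hU.subset_of_inter hK (fun z hz => ⟨h1 hz, (hb hz.1).2⟩)
        ⟨w, ⟨hw, h.subset (hUC hwU)⟩, hwU⟩
    rw [← closure_rect h.lt]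
    exact Metric.isOpen_ball.inter_closure.trans (closure_mono h2)
  have ha' : a ∈ Icc u v := h.closure_subset (closure_mono hUC ha)
  have hγ : Continuous (AffineMap.lineMap a b : ℝ → Plane) := AffineMap.lineMap_continuous
  have hmem : ∀ t ∈ Icc (0 : ℝ) 1, AffineMap.lineMap a b t ∈ segment ℝ a b := by
    intro t ht
    rw [segment_eq_image_lineMap]
    exact mem_image_of_mem _ ht
  have hsub : Icc (0 : ℝ) 1 ⊆ {t | AffineMap.lineMap a b t ∈ closure U} := by
    refine IsClosed.Icc_subset_of_forall_mem_nhdsWithin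
      ((isClosed_closure.preimage hγ).inter isClosed_Icc) (by simpa using ha) ?_
    rintro t ⟨ht, ht'⟩
    obtain ⟨B, hB, hxB, hBU⟩ := step _ ht (hD _ (hmem t ⟨ht'.1, ht'.2.le⟩)
      (disjoint_left.1 hS ht))
    filter_upwards [Ioo_mem_nhdsGT ht'.2,
      mem_nhdsWithin_of_mem_nhds (hγ.continuousAt.preimage_mem_nhds (hB.mem_nhds hxB))] with s h1 h2
    refine hBU ⟨h2, (convex_Icc u v).segment_subset ha' hb
      (hmem s ⟨ht'.1.trans h1.1.le, h1.2.le⟩)⟩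
  simpa using hsub (right_mem_Icc.2 zero_le_one)

theorem eq_of_mem_segments {w z a b : Plane} (h1 : z ∈ segment ℝ w a) (h2 : z ∈ segment ℝ w b)
    (h3 : w ∈ segment ℝ a b) : z = w := by
  have key : ∀ {a b z : Plane}, z ∈ segment ℝ a b → ∀ i,
      (a i ≤ z i ∧ z i ≤ b i) ∨ (b i ≤ z i ∧ z i ≤ a i) := by
    rintro a b z hz i
    have hz' : z i ∈ segment ℝ (a i) (b i) := by
      obtain ⟨s, t, hs, ht, hst, rfl⟩ := hz
      exact ⟨s, t, hs, ht, hst, rfl⟩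
    rw [segment_eq_uIcc, mem_uIcc] at hz'
    exact hz'
  ext i
  have k1 := key h1 i
  have k2 := key h2 i
  have k3 := key h3 i
  grind

/-- The center of mass is interior to the convex rectangle, so a segment from it to a point of the
closed rectangle can touch the boundary only at its end. -/
theorem CrossFrame.mem_exitPoints (h : CrossFrame V N C u v) (hp : SquarePacking V N)
    (hC : IsCross V N C) {z : Plane} (hz : z ∈ decoration V N C) (hz' : z ∉ rect u v) :
    z ∈ exitPoints V N C := by
  simp only [decoration, mem_iUnion] at hz
  obtain ⟨e, he, hze⟩ := hz
  have hc := h.centerOfMass_mem hp hC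
  have he' : e ∈ closure (rect u v) := by
    obtain ⟨k, p, q, -, a, b, h1, rfl⟩ := he
    have : midpoint ℝ a b ∈ segment ℝ a b := midpoint_mem_segment a b
    rw [← h1] at this
    exact closure_mono h.subset this.1
  rw [← insert_endpoints_openSegment] at hze
  rcases hze with rfl | rfl | hze
  · exact absurd hc hz'
  · exact he
  · refine absurd ?_ hz'
    rw [← (isOpen_rect u v).interior_eq] at hc ⊢
    exact (convex_rect u v).openSegment_interior_closure_subset_interior hc he' hze

/-- The rays from the center of mass through a point outside the decoration leave the rectangle
without meeting the decoration. -/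
theorem CrossFrame.exists_far (h : CrossFrame V N C u v) (hp : SquarePacking V N)
    (hC : IsCross V N C) {z : Plane} (hz : z ∉ decoration V N C) :
    ∃ f, f ∉ rect u v ∧ ∀ w ∈ segment ℝ z f, w ∉ decoration V N C := by
  have hc := h.centerOfMass_mem hp hC
  set c := centerOfMass C with hc'
  by_cases hzc : z = c
  · refine ⟨v, fun hv => lt_irrefl _ (mem_rect.1 hv 0).2, fun w _ hw => hz ?_⟩
    simp only [decoration, mem_iUnion] at hw ⊢
    obtain ⟨e, he, -⟩ := hw
    refine ⟨e, he, ?_⟩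
    rw [hzc, hc']
    exact left_mem_segment ℝ _ _
  obtain ⟨i, hi⟩ : ∃ i, z i ≠ c i := by
    by_contra! hcon
    exact hzc (funext hcon)
  have hpos : 0 < |z i - c i| := abs_pos.2 (sub_ne_zero.2 hi)
  have hlt := h.lt i
  -- With this factor the `i`-th coordinate moves away from that of `c` by more than the side of the
  -- rectangle.
  set M := 1 + (v i - u i) / |z i - c i| with hM
  have hM1 : 1 ≤ M := by
    have : 0 ≤ (v i - u i) / |z i - c i| := div_nonneg (by linarith) hpos.le
    linarith
  refine ⟨c + M • (z - c), ?_, ?_⟩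
  · intro hf
    have h1 := mem_rect.1 hf i
    have h2 := mem_rect.1 hc i
    have h3 : |M * (z i - c i)| = |z i - c i| + (v i - u i) := by
      rw [abs_mul, abs_of_nonneg (by linarith), hM, add_mul, div_mul_cancel₀ _ hpos.ne', one_mul]
    have h4 : |M * (z i - c i)| < v i - u i := by
      simp only [Pi.add_apply, Pi.smul_apply, Pi.sub_apply, smul_eq_mul] at h1
      rw [abs_lt]
      constructor <;> linarith
    linarith
  · rintro w ⟨a, b, ha, hb, hab, rfl⟩ hw
    refine hz ?_
    simp only [decoration, mem_iUnion] at hw ⊢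
    obtain ⟨e, he, hwe⟩ := hw
    refine ⟨e, he, ?_⟩
    rw [← hc'] at hwe ⊢
    -- The point `w` equals `c + (a + b * M) • (z - c)`, so `z` lies between `c` and `w`: if `w`
    -- were on the decoration, so would be `z`.
    have hm : 1 ≤ a + b * M := by nlinarith
    refine (convex_segment c e).segment_subset (left_mem_segment ℝ c e) hwe
      ⟨1 - (a + b * M)⁻¹, (a + b * M)⁻¹, sub_nonneg.2 (inv_le_one_of_one_le₀ hm), by positivity,
        by ring, ?_⟩
    ext j
    simp only [Pi.add_apply, Pi.smul_apply, Pi.sub_apply, smul_eq_mul]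
    have hb' : a = 1 - b := by linarith
    field_simp
    rw [hb']
    ring

/-- The closure of every cross-sector meets a square. -/
theorem CrossFrame.sector_meets (h : CrossFrame V N C u v) (hp : SquarePacking V N)
    (hC : IsCross V N C) (hU : IsComponent (C \ decoration V N C) U) :
    (closure U ∩ squares V N).Nonempty := by
  by_contra hcon
  have hS : Disjoint (closure U) (squares V N) := by
    rwa [disjoint_iff_inter_eq_empty, ← not_nonempty_iff_eq_empty]
  obtain ⟨z, hz⟩ := hU.nonempty
  obtain ⟨hzC, hzD⟩ := hU.subset hz
  obtain ⟨f, hf, hfD⟩ := h.exists_far hp hC hzD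
  obtain ⟨w, hw, hw1, hw2⟩ := exists_mem_side (convex_segment z f).isPreconnected
    ⟨z, left_mem_segment ℝ z f, h.subset hzC⟩ (fun hs => hf (hs (right_mem_segment ℝ z f)))
  have hwU : w ∈ closure U := h.mem_closure_sector hp hC hU hS (subset_closure hz) hw1
    fun x hx _ => hfD x ((convex_segment z f).segment_subset (left_mem_segment ℝ z f) hw hx)
  have hwS := disjoint_left.1 hS hwU
  obtain ⟨e₁, e₂, s1, s2, i1, i2, hwe, hside, A, -, hA⟩ := h.side w hw1 hw2 hwS
  -- From `w` the closure of the sector cannot reach the end points `e₁` and `e₂` of the opening,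
  -- which lie in squares; the decoration must stop it on both sides. It meets the opening, outside
  -- the squares, only at exit points of the arm `A`, hence at a single point. This point lies on
  -- both sides of `w`, so it is `w`, which was reached along a ray off the decoration.
  have key : ∀ e ∈ segment ℝ e₁ e₂, e ∈ squares V N → e ∈ Icc u v →
      ∃ x ∈ segment ℝ w e, x ∉ squares V N ∧ x ∈ decoration V N C := by
    intro e he heS hei
    by_contra! hno
    exact disjoint_left.1 hS (h.mem_closure_sector hp hC hU hS hwU hei hno) heS
  have exit : ∀ x ∈ segment ℝ e₁ e₂, x ∉ squares V N → x ∈ decoration V N C →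
      ∃ a b, closure C ∩ arm N A.1 A.2.1 A.2.2 = segment ℝ a b ∧ x = midpoint ℝ a b := by
    intro x hx hxS hxD
    obtain ⟨k, p, q, hkpq, a, b, h1, h2⟩ := h.mem_exitPoints hp hC hxD (hside x hx)
    have h3 : x ∈ segment ℝ a b := h2 ▸ midpoint_mem_segment a b
    rw [← h1] at h3
    rw [← hA x hx hxS k p q hkpq h3.2]
    exact ⟨a, b, h1, h2⟩
  have hseg := convex_segment (𝕜 := ℝ) e₁ e₂
  have l1 := left_mem_segment ℝ e₁ e₂
  have l2 := right_mem_segment ℝ e₁ e₂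
  obtain ⟨x₁, m1, m2, m3⟩ := key e₁ l1 s1 i1
  obtain ⟨x₂, n1, n2, n3⟩ := key e₂ l2 s2 i2
  obtain ⟨a, b, o1, o2⟩ := exit x₁ (hseg.segment_subset hwe l1 m1) m2 m3
  obtain ⟨a', b', o3, o4⟩ := exit x₂ (hseg.segment_subset hwe l2 n1) n2 n3
  have hx : x₂ = x₁ := by
    rw [o2, o4]
    exact midpoint_eq_of_segment_eq (o3 ▸ o1)
  rw [hx] at n1
  have := eq_of_mem_segments m1 n1 hwe
  rw [this] at m3
  exact hfD w hw m3

theorem SquarePacking.interior_decoration (h : SquarePacking V N) (hC : IsCross V N C) :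
    interior (decoration V N C) = ∅ := by
  refine Measure.interior_eq_empty_of_null (μ := volume) ?_
  refine (measure_biUnion_null_iff (h.finite_exitPoints hC).countable).2 fun e _ => ?_
  refine measure_mono_null (t := (line[ℝ, centerOfMass C, e] : Set Plane)) ?_ ?_
  · rw [← convexHull_pair]
    exact convexHull_subset_affineSpan _
  · refine Measure.addHaar_affineSubspace _ _ fun htop => ?_
    have h1 := collinear_iff_finrank_le_one.1 (collinear_pair ℝ (centerOfMass C) e)
    rw [← direction_affineSpan, htop, AffineSubspace.direction_top, finrank_top] at h1
    simp at h1

/-- The enlarged squares are dense in the plane. -/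
theorem SquarePacking.exists_enlarged_inter (h : SquarePacking V N) {O : Set Plane}
    (hO : IsOpen O) (hne : O.Nonempty) : ∃ p ∈ V, (O ∩ enlarged V N p).Nonempty := by
  obtain ⟨z, hz⟩ := hne
  by_cases hzS : z ∈ squares V N
  · obtain ⟨p, hp, hzp⟩ := mem_squares.1 hzS
    exact ⟨p, hp, z, hz, Or.inl hzp⟩
  by_cases hzA : ∀ k p q, HasArm V N k p q → z ∉ arm N k p q
  swap
  · push Not at hzA
    obtain ⟨k, p, q, hA, hm⟩ := hzA
    rcases le_total (z k) ((p k + N + q k) / 2) with h1 | h1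
    · exact ⟨p, hA.1, z, hz, Or.inr (Or.inl ⟨k, q, hA, hm, h1⟩)⟩
    · exact ⟨q, hA.2.1, z, hz, Or.inr (Or.inr (Or.inl ⟨k, p, hA, hm, h1⟩))⟩
  have hzF : z ∈ freeSpace V N := mem_freeSpace.2 ⟨hzS, hzA⟩
  have hC : IsCross V N (connectedComponentIn (freeSpace V N) z) :=
    isComponent_connectedComponentIn hzF
  set C := connectedComponentIn (freeSpace V N) z
  have hzC : z ∈ C := mem_connectedComponentIn hzF
  have hOC : ¬ O ∩ C ⊆ decoration V N C := by
    intro hsub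
    have h1 := interior_maximal hsub (hO.inter (hC.isOpen h.isOpen_freeSpace))
    rw [h.interior_decoration hC] at h1
    exact h1 ⟨hz, hzC⟩
  obtain ⟨w, ⟨hwO, hwC⟩, hwD⟩ := not_subset.1 hOC
  have hU := isComponent_connectedComponentIn (S := C \ decoration V N C) ⟨hwC, hwD⟩
  have hwU := mem_connectedComponentIn (F := C \ decoration V N C) ⟨hwC, hwD⟩
  obtain ⟨u, v, hf⟩ := h.exists_crossFrame hC
  obtain ⟨s, hs, hsS⟩ := hf.sector_meets h hC hU
  obtain ⟨p, hp, hsp⟩ := mem_squares.1 hsS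
  exact ⟨p, hp, w, hwO, Or.inr (Or.inr (Or.inr ⟨_, ⟨C, hC, hU⟩, ⟨s, hs, hsp⟩, subset_closure hwU⟩))⟩

end Sectors

/-! ### Size and disjointness of enlarged squares -/

section Enlarged

variable {V V' : Set Plane} {N R : ℝ} {C U : Set Plane} {u v p q : Plane}

theorem interior_square (s : ℝ) (p : Plane) : interior (square s p) = rect p (fun i => p i + s) := by
  rw [square, ← pi_univ_Icc, interior_pi_set finite_univ, rect]
  congr! with i
  exact interior_Icc

theorem IsCrossSector.exists_closure_subset (h : SquarePacking V N) (hU : IsCrossSector V N U) :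
    ∃ C u v, IsCross V N C ∧ CrossFrame V N C u v ∧ U ⊆ C ∧
      IsComponent (C \ decoration V N C) U := by
  obtain ⟨C, hC, hU⟩ := hU
  obtain ⟨u, v, hf⟩ := h.exists_crossFrame hC
  exact ⟨C, u, v, hC, hf, fun z hz => (hU.subset hz).1, hU⟩

theorem SquarePacking.dist_le_of_mem_enlarged (h : SquarePacking V N) {x : Plane}
    (hx : x ∈ enlarged V N p) : dist x p ≤ 3 * N := by
  have hN := h.pos
  rcases hx with hx | ⟨k, q, hA, hx⟩ | ⟨k, q, hA, hx⟩ | ⟨U, hU, ⟨s, hs, hsp⟩, hx⟩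
  · rw [dist_comm]
    linarith [dist_le_of_mem_square hN hx]
  · rw [dist_comm]
    linarith [(h.dist_le_of_mem_arm hA hx.1).1]
  · rw [dist_comm]
    linarith [(h.dist_le_of_mem_arm hA hx.1).2]
  · obtain ⟨C, u, v, hC, hf, hUC, -⟩ := hU.exists_closure_subset h
    have h1 := hf.dist_le hN (hf.closure_subset (closure_mono hUC hx))
      (hf.closure_subset (closure_mono hUC hs))
    have h2 := dist_le_of_mem_square hN hsp
    rw [dist_comm] at h2
    linarith [dist_triangle x s p]

/-- A square with an interior point in the arm overlaps both end squares in the transverse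
direction, so it would have to fit between them, while the arm is shorter than `N`. -/
theorem SquarePacking.arm_disjoint (h : SquarePacking V N) {k : Fin 2} {a b : Plane}
    (hA : HasArm V N k a b) (hq : q ∈ V) : Disjoint (arm N k a b) (interior (square N q)) := by
  rw [disjoint_left]
  rintro z ⟨h1, h2, h3, h4⟩ hz
  rw [interior_square, mem_rect] at hz
  have z1 := hz k
  have z2 := hz (k + 1)
  have e1 := (h.dir k).cases hA.1 hq
  have e2 := (h.dir k).cases hA.2.1 hq
  obtain ⟨l1, l2, l3, l4⟩ := h.hasArm_hl hA
  rw [max_le_iff] at h3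
  rw [← min_add_add_right, le_min_iff] at h4
  have hN := h.pos
  dsimp only at *
  clear hz hA h hq
  generalize a k = a₀, a (k + 1) = a₁, b k = b₀, b (k + 1) = b₁, q k = q₀, q (k + 1) = q₁,
    z k = z₀, z (k + 1) = z₁ at *
  grind

theorem SquarePacking.square_disjoint (h : SquarePacking V N) (hp : p ∈ V) (hq : q ∈ V)
    (hpq : p ≠ q) : Disjoint (square N p) (interior (square N q)) := by
  rw [disjoint_left]
  intro z hz hz'
  rw [interior_square, mem_rect] at hz'
  have a1 := hz.1 0
  have a2 := hz.1 1
  have a3 := hz.2 0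
  have a4 := hz.2 1
  have b1 := hz' 0
  have b2 := hz' 1
  dsimp only at a3 a4
  rcases h.disj p hp q hq hpq with h1 | h1 | h1 | h1 <;> linarith

theorem SquarePacking.enlarged_disjoint (h : SquarePacking V N) (hp : p ∈ V) (hq : q ∈ V)
    (hpq : p ≠ q) : Disjoint (enlarged V N p) (interior (square N q)) := by
  rw [disjoint_left]
  rintro x (hx | ⟨k, b, hA, hx⟩ | ⟨k, b, hA, hx⟩ | ⟨U, hU, -, hx⟩) hxq
  · exact disjoint_left.1 (h.square_disjoint hp hq hpq) hx hxq
  · exact disjoint_left.1 (h.arm_disjoint hA hq) hx.1 hxq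
  · exact disjoint_left.1 (h.arm_disjoint hA hq) hx.1 hxq
  · obtain ⟨C, u, v, hC, -, hUC, -⟩ := hU.exists_closure_subset h
    obtain ⟨y, hy, hyU⟩ := mem_closure_iff.1 hx _ isOpen_interior hxq
    exact (hC.subset (hUC hyU)).1 q hq (interior_subset hy)

end Enlarged

/-! ### Locality of enlarged squares -/

section Locality

variable {V V' : Set Plane} {N R : ℝ} {C U : Set Plane} {p : Plane}

/-- The families `V` and `V'` have the same elements within distance `R` of `p`. -/
def Agree (V V' : Set Plane) (p : Plane) (R : ℝ) : Prop := ∀ q, dist q p ≤ R → (q ∈ V ↔ q ∈ V')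

theorem Agree.symm (h : Agree V V' p R) : Agree V' V p R := fun q hq => (h q hq).symm

/-- Arms are shorter than `N`, so any competitor for being nearest to `a` or to `b` lies within `4 *
N` of `a`. -/
theorem Agree.hasArm (h : Agree V V' p R) (hV : SquarePacking V N) {k : Fin 2} {a b : Plane}
    (ha : dist a p + 4 * N ≤ R) (hA : HasArm V N k a b) : HasArm V' N k a b := by
  have hN := hV.pos
  obtain ⟨l1, l2, l3, l4⟩ := hV.hasArm_hl hA
  obtain ⟨hav, hbv, hF, hn⟩ := hA
  have near : ∀ r : Plane, |r k - a k| ≤ 4 * N → |r (k + 1) - a (k + 1)| ≤ 4 * N →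
      (r ∈ V ↔ r ∈ V') := by
    intro r h1 h2
    refine h r ((dist_triangle r a p).trans ?_)
    have : dist r a ≤ 4 * N := by
      rw [dist_pi_le_iff (by linarith)]
      intro i
      rcases fin_two_eq k i with rfl | rfl <;> rwa [Real.dist_eq]
    linarith
  dsimp only at l1 l2 l3 l4
  refine ⟨(near a (by simp; linarith) (by simp; linarith)).1 hav, (near b
    (abs_le.2 ⟨by linarith, by linarith⟩) (abs_le.2 ⟨by linarith, by linarith⟩)).1 hbv, hF, ?_⟩
  rcases hn with hn | hn
  · refine Or.inl fun r hr hF' => ?_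
    by_contra! hlt
    have h1 := hF'.1
    have h2 := abs_lt.1 hF'.2
    exact absurd (hn r ((near r (abs_le.2 ⟨by linarith, by linarith⟩)
      (abs_le.2 ⟨by linarith, by linarith⟩)).2 hr) hF') (not_le.2 hlt)
  · refine Or.inr fun r hr hF' => ?_
    by_contra! hlt
    have h1 := hF'.1
    have h2 := abs_lt.1 hF'.2
    exact absurd (hn r ((near r (abs_le.2 ⟨by linarith, by linarith⟩)
      (abs_le.2 ⟨by linarith, by linarith⟩)).2 hr) hF') (not_le.2 hlt)

theorem Agree.mem_freeSpace (h : Agree V V' p R) (hV' : SquarePacking V' N) {z : Plane}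
    (hz : dist z p + 6 * N ≤ R) (hF : z ∈ freeSpace V N) : z ∈ freeSpace V' N := by
  have hN := hV'.pos
  refine ⟨fun q hq hzq => ?_, fun k a b hA hzA => ?_⟩
  · have h1 := dist_le_of_mem_square hN hzq
    exact hF.1 q ((h q (by linarith [dist_triangle q z p])).2 hq) hzq
  · have h1 := (hV'.dist_le_of_mem_arm hA hzA).1
    exact hF.2 k a b (h.symm.hasArm hV' (by linarith [dist_triangle a z p]) hA) hzA

/-- The free space near a point is determined at distance `6 * N`, and the frame bounds the diameter
of a cross by `2 * N`. The components through `z` for the two families therefore contain each other.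
-/
theorem Agree.isCross (h : Agree V V' p R) (hV : SquarePacking V N) (hV' : SquarePacking V' N)
    {z : Plane} (hz : dist z p + 8 * N ≤ R) (hC : IsCross V N C) (hzC : z ∈ C) :
    IsCross V' N C := by
  have hN := hV.pos
  obtain ⟨u, v, hf⟩ := hV.exists_crossFrame hC
  have hCF : C ⊆ freeSpace V' N := fun y hy => by
    have := hf.dist_le hN (hf.closure_subset (subset_closure hy))
      (hf.closure_subset (subset_closure hzC))
    exact h.mem_freeSpace hV' (by linarith [dist_triangle y z p]) (hC.subset hy)
  have hC' : IsCross V' N (connectedComponentIn (freeSpace V' N) z) :=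
    isComponent_connectedComponentIn (hCF hzC)
  obtain ⟨u', v', hf'⟩ := hV'.exists_crossFrame hC'
  have hzC' := mem_connectedComponentIn (hCF hzC)
  have h1 := hC'.subset_of_inter hC.isPreconnected hCF ⟨z, hzC, hzC'⟩
  have h2 := hC.subset_of_inter hC'.isPreconnected (fun y hy => by
    have := hf'.dist_le hN (hf'.closure_subset (subset_closure hy))
      (hf'.closure_subset (subset_closure hzC'))
    exact h.symm.mem_freeSpace hV (by linarith [dist_triangle y z p]) (hC'.subset hy))
    ⟨z, hzC', hzC⟩
  rwa [h2.antisymm h1] at hC'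

theorem Agree.exitPoints_subset (h : Agree V V' p R) (hV : SquarePacking V N)
    {z : Plane} (hz : dist z p + 8 * N ≤ R) (hC : IsCross V N C) (hzC : z ∈ C) :
    exitPoints V N C ⊆ exitPoints V' N C := by
  have hN := hV.pos
  obtain ⟨u, v, hf⟩ := hV.exists_crossFrame hC
  rintro e ⟨k, c, d, hA, a, b, h1, h2⟩
  have h3 : a ∈ closure C ∩ arm N k c d := h1 ▸ left_mem_segment ℝ a b
  have h4 := (hV.dist_le_of_mem_arm hA h3.2).1
  have h5 := hf.dist_le hN (hf.closure_subset h3.1) (hf.closure_subset (subset_closure hzC))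
  exact ⟨k, c, d, h.hasArm hV (by linarith [dist_triangle c a p, dist_triangle a z p]) hA,
    a, b, h1, h2⟩

theorem Agree.isCrossSector (h : Agree V V' p R) (hV : SquarePacking V N)
    (hV' : SquarePacking V' N) {z : Plane} (hz : dist z p + 8 * N ≤ R)
    (hU : IsCrossSector V N U) (hzU : z ∈ U) : IsCrossSector V' N U := by
  obtain ⟨C, hC, hU⟩ := hU
  have hzC := (hU.subset hzU).1
  have hC' := h.isCross hV hV' hz hC hzC
  have he : exitPoints V N C = exitPoints V' N C :=
    (h.exitPoints_subset hV hz hC hzC).antisymm (h.symm.exitPoints_subset hV' hz hC' hzC)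
  refine ⟨C, hC', ?_⟩
  rwa [decoration, ← he]

/-- A sector whose closure touches the square at `p` lies within `N + 2 * N` of `p`, and recognizing
it takes `8 * N` more; this is the costliest case. -/
theorem Agree.enlarged_subset (h : Agree V V' p R) (hV : SquarePacking V N)
    (hV' : SquarePacking V' N) (hR : 11 * N ≤ R) : enlarged V N p ⊆ enlarged V' N p := by
  have hN := hV.pos
  rintro x (hx | ⟨k, b, hA, hx⟩ | ⟨k, b, hA, hx⟩ | ⟨U, hU, ⟨s, hs, hsp⟩, hx⟩)
  · exact Or.inl hx
  · exact Or.inr (Or.inl ⟨k, b, h.hasArm hV (by simp; linarith) hA, hx⟩)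
  · refine Or.inr (Or.inr (Or.inl ⟨k, b, h.hasArm hV ?_ hA, hx⟩))
    obtain ⟨h1, h2⟩ := hV.dist_le_of_mem_arm hA hx.1
    rw [dist_comm] at h2
    linarith [dist_triangle b x p]
  · refine Or.inr (Or.inr (Or.inr ⟨U, ?_, ⟨s, hs, hsp⟩, hx⟩))
    obtain ⟨C, u, v, hC, hf, hUC, hU'⟩ := hU.exists_closure_subset hV
    obtain ⟨z, hz⟩ := hU'.nonempty
    have h1 := hf.dist_le hN (hf.closure_subset (subset_closure (hUC hz)))
      (hf.closure_subset (closure_mono hUC hs))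
    have h2 := dist_le_of_mem_square hN hsp
    rw [dist_comm] at h2
    exact h.isCrossSector hV hV' (by linarith [dist_triangle z s p]) hU hz

/-- The enlarged square depends only on the nearby squares. -/
theorem Agree.enlarged_eq (h : Agree V V' p R) (hV : SquarePacking V N)
    (hV' : SquarePacking V' N) (hR : 11 * N ≤ R) : enlarged V N p = enlarged V' N p :=
  (h.enlarged_subset hV hV' hR).antisymm (h.symm.enlarged_subset hV' hV hR)

end Locality

/-! ### Translation equivariance -/

section Translations

variable {V : Set Plane} {N : ℝ} {C U S : Set Plane} {u p q : Plane}

/-- The family `V - u`. -/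
def shift (u : Plane) (V : Set Plane) : Set Plane := {p | p + u ∈ V}

theorem mem_shift : p ∈ shift u V ↔ p + u ∈ V := Iff.rfl

@[simp] theorem shift_neg_shift : shift (-u) (shift u V) = V := by
  ext p
  simp [mem_shift]

theorem shift_closure : shift u (closure S) = closure (shift u S) :=
  (Homeomorph.addRight u).preimage_closure S

theorem SquarePacking.shift (h : SquarePacking V N) (u : Plane) : SquarePacking (shift u V) N where
  pos := h.pos
  disj p hp q hq hpq := by
    have := h.disj _ hp _ hq (fun h => hpq (add_right_cancel h))
    simp only [Pi.add_apply] at this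
    rcases this with h1 | h1 | h1 | h1
    · exact Or.inl (by linarith)
    · exact Or.inr (Or.inl (by linarith))
    · exact Or.inr (Or.inr (Or.inl (by linarith)))
    · exact Or.inr (Or.inr (Or.inr (by linarith)))
  maxl a b := by
    obtain ⟨p, hp, h1, h2, h3, h4⟩ := h.maxl (a + u 0) (b + u 1)
    refine ⟨p - u, by simpa [mem_shift] using hp, ?_, ?_, ?_, ?_⟩ <;>
      simp only [Pi.sub_apply] <;> linarith
  fin a b R := by
    refine ((h.fin (a + u 0) (b + u 1) R).preimage (add_left_injective u).injOn).subset ?_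
    rintro p ⟨hp, h1, h2⟩
    refine ⟨hp, ?_, ?_⟩
    · simpa using h1
    · simpa using h2

theorem faces_shift {k : Fin 2} : Faces N k (p + u) (q + u) ↔ Faces N k p q := by
  simp only [Faces, Pi.add_apply, add_sub_add_right_eq_sub]
  constructor <;> rintro ⟨h1, h2⟩ <;> exact ⟨by linarith, h2⟩

theorem hasArm_shift {k : Fin 2} : HasArm (shift u V) N k p q ↔ HasArm V N k (p + u) (q + u) := by
  have hsurj : ∀ P : Plane → Prop, (∀ r, P r) ↔ ∀ r, P (r + u) := fun P =>
    ⟨fun h r => h _, fun h r => by simpa using h (r - u)⟩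
  unfold HasArm
  rw [hsurj (fun r => r ∈ V → Faces N k (p + u) r → _),
    hsurj (fun r => r ∈ V → Faces N k r (q + u) → _)]
  simp only [faces_shift, mem_shift, Pi.add_apply, add_le_add_iff_right]

theorem shift_arm {k : Fin 2} : shift u (arm N k (p + u) (q + u)) = arm N k p q := by
  ext x
  simp only [mem_shift, arm, mem_ofPred_eq, Pi.add_apply, max_add_add_right, min_add_add_right]
  constructor <;> rintro ⟨h1, h2, h3, h4⟩ <;>
    exact ⟨by linarith, by linarith, by linarith, by linarith⟩

theorem shift_square : shift u (square N (p + u)) = square N p := by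
  ext x
  simp only [mem_shift, square, mem_Icc, Pi.le_def, Pi.add_apply]
  constructor <;> rintro ⟨h1, h2⟩ <;>
    exact ⟨fun i => by linarith [h1 i], fun i => by linarith [h2 i]⟩

theorem mem_freeSpace_shift {z : Plane} :
    z ∈ freeSpace (shift u V) N ↔ z + u ∈ freeSpace V N := by
  have hsurj : ∀ P : Plane → Prop, (∀ r, P r) ↔ ∀ r, P (r + u) := fun P =>
    ⟨fun h r => h _, fun h r => by simpa using h (r - u)⟩
  simp only [freeSpace, mem_ofPred_eq]
  rw [hsurj (fun r => r ∈ V → z + u ∉ square N r)]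
  refine and_congr (forall_congr' fun r => ?_) (forall_congr' fun k => ?_)
  · rw [mem_shift, ← mem_shift (V := square N (r + u)), shift_square]
  · rw [hsurj (fun p => ∀ q, HasArm V N k p q → z + u ∉ arm N k p q)]
    refine forall_congr' fun a => ?_
    rw [hsurj (fun q => HasArm V N k (a + u) q → z + u ∉ arm N k (a + u) q)]
    refine forall_congr' fun b => ?_
    rw [hasArm_shift, ← mem_shift (V := arm N k (a + u) (b + u)), shift_arm]

theorem IsComponent.shift (h : IsComponent S C) (u : Plane) :
    IsComponent (shift u S) (shift u C) := by
  obtain ⟨x, hx, rfl⟩ := h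
  refine ⟨x - u, by simpa [mem_shift], ?_⟩
  have := (Homeomorph.addRight u).symm.image_connectedComponentIn hx
  rw [Homeomorph.image_symm] at this
  refine this.trans ?_
  congr 1

theorem IsCross.shift (h : IsCross V N C) (u : Plane) :
    IsCross (shift u V) N (shift u C) := by
  have : freeSpace (RobinsonTiling.shift u V) N = RobinsonTiling.shift u (freeSpace V N) := by
    ext z
    exact mem_freeSpace_shift
  rw [IsCross, this]
  exact IsComponent.shift h u

theorem centerOfMass_shift (hp : SquarePacking V N) (hC : IsCross V N C) (u : Plane) :
    centerOfMass (shift u C) + u = centerOfMass C := by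
  obtain ⟨a, b, hf⟩ := hp.exists_crossFrame hC
  have h0 : volume C ≠ 0 := ((hC.isOpen hp.isOpen_freeSpace).measure_pos volume hC.nonempty).ne'
  have h1 : volume.real C ≠ 0 := by
    rw [measureReal_def, ENNReal.toReal_ne_zero]
    exact ⟨h0, hf.measure_lt_top.ne⟩
  have hmp := measurePreserving_add_right (volume : Measure Plane) u
  have h2 : volume.real (shift u C) = volume.real C := by
    rw [measureReal_def, measureReal_def]
    congr 1
    exact measure_preimage_add_right volume u C
  have h3 : ∫ x in shift u C, x = ∫ x in C, (x - u) := by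
    have := hmp.setIntegral_preimage_emb (MeasurableEquiv.addRight u).measurableEmbedding
      (fun x => x - u) C
    simp only [add_sub_cancel_right] at this
    exact this
  rw [centerOfMass, centerOfMass, setAverage_eq, setAverage_eq, h2, h3,
    integral_sub hf.integrableOn (integrableOn_const hf.measure_lt_top.ne), setIntegral_const,
    smul_sub, smul_smul, inv_mul_cancel₀ h1, one_smul, sub_add_cancel]

theorem shift_segment {a b : Plane} : shift u (segment ℝ a b) = segment ℝ (a - u) (b - u) := by
  ext z
  have := mem_segment_translate ℝ u (x := z) (b := a - u) (c := b - u)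
  rwa [add_sub_cancel, add_sub_cancel, add_comm] at this

theorem exitPoints_shift_subset {e : Plane} (he : e ∈ exitPoints V N C) :
    e - u ∈ exitPoints (shift u V) N (shift u C) := by
  obtain ⟨k, p, q, hA, a, b, h1, rfl⟩ := he
  refine ⟨k, p - u, q - u, hasArm_shift.2 (by simpa), a - u, b - u, ?_, ?_⟩
  · rw [← shift_segment, ← h1, ← shift_closure, ← shift_arm (u := u), sub_add_cancel,
      sub_add_cancel]
    rfl
  · ext i
    simp only [midpoint_eq_smul_add, Pi.smul_apply, Pi.add_apply, Pi.sub_apply, smul_eq_mul]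
    norm_num
    ring

theorem mem_decoration_shift (hp : SquarePacking V N) (hC : IsCross V N C) {z : Plane}
    (h : z + u ∈ decoration V N C) : z ∈ decoration (shift u V) N (shift u C) := by
  simp only [decoration, mem_iUnion] at h ⊢
  obtain ⟨e, he, hz⟩ := h
  refine ⟨e - u, exitPoints_shift_subset he, ?_⟩
  rw [← eq_sub_of_add_eq (centerOfMass_shift hp hC u) |>.symm, ← shift_segment]
  exact hz

theorem IsCrossSector.shift (hp : SquarePacking V N) (h : IsCrossSector V N U) (u : Plane) :
    IsCrossSector (shift u V) N (shift u U) := by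
  obtain ⟨C, hC, hU⟩ := h
  refine ⟨_, hC.shift u, ?_⟩
  convert hU.shift u using 1
  ext z
  refine and_congr Iff.rfl (not_congr ⟨fun h => ?_, mem_decoration_shift hp hC⟩)
  have := mem_decoration_shift (u := -u) (hp.shift u) (hC.shift u) (z := z + u) (by simpa)
  simpa using this

/-- One inclusion suffices: `enlarged_shift` obtains the other by shifting back by `-u`. -/
theorem mem_enlarged_shift (hp : SquarePacking V N) {x : Plane}
    (h : x + u ∈ enlarged V N (p + u)) : x ∈ enlarged (shift u V) N p := by
  have harm : ∀ {k a b}, x + u ∈ arm N k a b → x ∈ arm N k (a - u) (b - u) := by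
    intro k a b h
    rw [← shift_arm (u := u), sub_add_cancel, sub_add_cancel]
    exact h
  rcases h with hx | ⟨k, q, hA, hx, hx'⟩ | ⟨k, q, hA, hx, hx'⟩ | ⟨U, hU, ⟨s, hs, hsp⟩, hx⟩
  · left
    rwa [← shift_square (u := u)]
  · refine Or.inr (Or.inl ⟨k, q - u, hasArm_shift.2 (by simpa), by simpa using harm hx, ?_⟩)
    simp only [Pi.add_apply, Pi.sub_apply] at hx' ⊢
    linarith
  · refine Or.inr (Or.inr (Or.inl ⟨k, q - u, hasArm_shift.2 (by simpa), by simpa using harm hx, ?_⟩))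
    simp only [Pi.add_apply, Pi.sub_apply] at hx' ⊢
    linarith
  · refine Or.inr (Or.inr (Or.inr ⟨_, hU.shift hp u, ⟨s - u, ?_, ?_⟩, ?_⟩))
    · rw [← shift_closure]
      simpa [mem_shift]
    · rw [← shift_square (u := u)]
      simpa [mem_shift]
    · rw [← shift_closure]
      exact hx

theorem enlarged_shift (hp : SquarePacking V N) :
    enlarged (shift u V) N p = shift u (enlarged V N (p + u)) := by
  ext x
  refine ⟨fun h => ?_, mem_enlarged_shift hp⟩
  have := mem_enlarged_shift (u := -u) (x := x + u) (p := p + u) (hp.shift u) (by simpa)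
  simpa [mem_shift] using this

end Translations

/-! ### Tilings as configurations on ℤ² -/

section Configurations

open Topology

variable {A : Type*}

/-- An integer vector, seen in the plane. -/
def vec (m : Fin 2 → ℤ) : Plane := fun i => (m i : ℝ)

@[simp] theorem vec_apply (m : Fin 2 → ℤ) (i : Fin 2) : vec m i = m i := rfl

theorem vec_add (m n : Fin 2 → ℤ) : vec (m + n) = vec m + vec n := by
  ext i
  simp

theorem vec_neg (m : Fin 2 → ℤ) : vec (-m) = -vec m := by
  ext i
  simp

@[simp] theorem vec_zero : vec 0 = 0 := by
  ext i
  simp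

theorem vec_injective : Function.Injective vec := fun m n h => by
  ext i
  exact Int.cast_injective (α := ℝ) (congrFun h i)

@[simp] theorem norm_vec (m : Fin 2 → ℤ) : ‖vec m‖ = ‖m‖ := by
  refine le_antisymm ((pi_norm_le_iff_of_nonneg (norm_nonneg _)).2 fun i => ?_)
    ((pi_norm_le_iff_of_nonneg (norm_nonneg _)).2 fun i => ?_)
  · simpa [Int.norm_eq_abs] using norm_le_pi_norm m i
  · simpa [Int.norm_eq_abs] using norm_le_pi_norm (vec m) i

theorem finite_norm_le (r : ℝ) : {m : Fin 2 → ℤ | ‖m‖ ≤ r}.Finite := by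
  have := (isCompact_closedBall (0 : Fin 2 → ℤ) r).finite_of_discrete
  refine this.subset fun m hm => ?_
  simpa using hm

/-- The configuration `f` seen from the cell `m`. -/
def cfgShift (m : Fin 2 → ℤ) (f : (Fin 2 → ℤ) → A) : (Fin 2 → ℤ) → A := fun n => f (n + m)

@[simp] theorem cfgShift_apply (m n : Fin 2 → ℤ) (f : (Fin 2 → ℤ) → A) :
    cfgShift m f n = f (n + m) := rfl

@[simp] theorem cfgShift_zero (f : (Fin 2 → ℤ) → A) : cfgShift 0 f = f := by
  ext n
  simp

theorem cfgShift_cfgShift (m n : Fin 2 → ℤ) (f : (Fin 2 → ℤ) → A) :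
    cfgShift m (cfgShift n f) = cfgShift (m + n) f := by
  ext k
  simp [add_assoc]

/-- The tiling with marks `f`; the cell `0` has lower left corner `s`. -/
def ofCfg (s : Plane) (f : (Fin 2 → ℤ) → A) : Tiling A where
  tiles := range (fun m : Fin 2 → ℤ => ((s + vec m, f m) : Plane × A))
  lattice := ⟨s, f, rfl⟩

theorem exists_ofCfg (T : Tiling A) : ∃ s f, T = ofCfg s f := by
  obtain ⟨s, f, h⟩ := T.lattice
  exact ⟨s, f, Tiling.ext h⟩

theorem mem_tiles_ofCfg {s : Plane} {f : (Fin 2 → ℤ) → A} {t : Plane × A} :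
    t ∈ (ofCfg s f).tiles ↔ ∃ m, t.1 = s + vec m ∧ t.2 = f m := by
  simp only [ofCfg, mem_range, Prod.ext_iff, eq_comm]

theorem translate_ofCfg (s v : Plane) (f : (Fin 2 → ℤ) → A) :
    (ofCfg s f).translate v = ofCfg (s + v) f := by
  ext t
  change (t.1 - v, t.2) ∈ (ofCfg s f).tiles ↔ _
  simp only [mem_tiles_ofCfg]
  refine exists_congr fun m => and_congr_left fun _ => ?_
  rw [sub_eq_iff_eq_add, add_right_comm]

theorem ofCfg_eq_iff {s s' : Plane} {f f' : (Fin 2 → ℤ) → A} :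
    ofCfg s f = ofCfg s' f' ↔ ∃ n, s' = s + vec n ∧ f' = cfgShift n f := by
  constructor
  · intro h
    have h1 : ∀ m, (s' + vec m, f' m) ∈ (ofCfg s f).tiles := fun m => by
      rw [h]
      exact mem_tiles_ofCfg.2 ⟨m, rfl, rfl⟩
    simp only [mem_tiles_ofCfg] at h1
    obtain ⟨n, hn, -⟩ := h1 0
    rw [vec_zero, add_zero] at hn
    refine ⟨n, hn, funext fun m => ?_⟩
    obtain ⟨k, hk, hk'⟩ := h1 m
    rw [hn, add_assoc, ← vec_add] at hk
    have := vec_injective (add_left_cancel hk)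
    rw [hk', cfgShift_apply, ← this, add_comm]
  · rintro ⟨n, rfl, rfl⟩
    ext t
    simp only [mem_tiles_ofCfg]
    constructor
    · rintro ⟨m, h1, h2⟩
      refine ⟨m - n, ?_, by simpa using h2⟩
      rw [h1, add_assoc, ← vec_add]
      simp
    · rintro ⟨m, h1, h2⟩
      refine ⟨m + n, ?_, h2⟩
      rw [h1, add_assoc, ← vec_add, add_comm m]

theorem ofCfg_add_vec (s : Plane) (n : Fin 2 → ℤ) (f : (Fin 2 → ℤ) → A) :
    ofCfg (s + vec n) (cfgShift n f) = ofCfg s f :=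
  (ofCfg_eq_iff.2 ⟨n, rfl, rfl⟩).symm

theorem translate_translate (T : Tiling A) (u v : Plane) :
    (T.translate u).translate v = T.translate (u + v) := by
  obtain ⟨s, f, rfl⟩ := exists_ofCfg T
  simp only [translate_ofCfg, add_assoc]

@[simp] theorem translate_zero (T : Tiling A) : T.translate 0 = T := by
  obtain ⟨s, f, rfl⟩ := exists_ofCfg T
  simp [translate_ofCfg]

/-- The configurations agree at distance at most `r` from the origin. -/
def AgreeOn (r : ℝ) (f g : (Fin 2 → ℤ) → A) : Prop := ∀ m, ‖m‖ ≤ r → f m = g m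

theorem AgreeOn.symm {r : ℝ} {f g : (Fin 2 → ℤ) → A} (h : AgreeOn r f g) : AgreeOn r g f :=
  fun m hm => (h m hm).symm

theorem AgreeOn.mono {r r' : ℝ} {f g : (Fin 2 → ℤ) → A} (h : AgreeOn r f g) (hr : r' ≤ r) :
    AgreeOn r' f g := fun m hm => h m (hm.trans hr)

theorem AgreeOn.cfgShift {r : ℝ} {f g : (Fin 2 → ℤ) → A} (h : AgreeOn r f g) (m : Fin 2 → ℤ) :
    AgreeOn (r - ‖m‖) (cfgShift m f) (cfgShift m g) := fun n hn =>
  h _ ((norm_add_le n m).trans (by linarith))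

/-- A tile that meets the ball of radius `R` has its corner `s + vec m` within `R + 1` of the
origin, so its index has norm at most `R + ‖s‖ + 1`. -/
theorem coincideOn_ofCfg {s : Plane} {f g : (Fin 2 → ℤ) → A} {R : ℝ}
    (h : AgreeOn (R + ‖s‖ + 1) f g) : (ofCfg s f).CoincideOn (ofCfg s g) R := by
  rintro ⟨x, a⟩ ⟨y, hy, hyR⟩
  have key : ∀ m, x = s + vec m → f m = g m := by
    rintro m rfl
    refine h m ?_
    have h1 := dist_le_of_mem_square one_pos hy
    have h2 : ‖y‖ < R := by simpa using hyR
    rw [dist_eq_norm] at h1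
    calc ‖m‖ = ‖(s + vec m - y) + y - s‖ := by rw [← norm_vec]; congr 1; abel
      _ ≤ ‖(s + vec m - y) + y‖ + ‖s‖ := norm_sub_le _ _
      _ ≤ ‖s + vec m - y‖ + ‖y‖ + ‖s‖ := by gcongr; exact norm_add_le _ _
      _ ≤ R + ‖s‖ + 1 := by linarith
  simp only [mem_tiles_ofCfg]
  exact exists_congr fun m => and_congr_right fun hm => by rw [key m hm]

theorem isOpen_basicNhd (T : Tiling A) {r ε ε' : ℝ} (h : 0 < r) (h' : 0 < ε) (h'' : 0 < ε') :
    IsOpen (Tiling.basicNhd T r ε ε') :=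
  TopologicalSpace.isOpen_generateFrom_of_mem ⟨T, r, ε, ε', h, h', h'', rfl⟩

end Configurations

/-! ### Continuity of the tiling in its offset and marks -/

section Topology

open Topology

variable {A : Type*} [TopologicalSpace A] [DiscreteTopology A]

theorem agreeOn_mem_nhds (r : ℝ) (f : (Fin 2 → ℤ) → A) : {g | AgreeOn r f g} ∈ 𝓝 f := by
  have := set_pi_mem_nhds (finite_norm_le r) (x := f) (s := fun m => {f m})
    fun m _ => (isOpen_discrete _).mem_nhds rfl
  filter_upwards [this] with g hg m hm
  exact (hg m hm).symm

theorem continuous_ofCfg : Continuous (fun z : Plane × ((Fin 2 → ℤ) → A) => ofCfg z.1 z.2) := by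
  refine continuous_generateFrom_iff.2 ?_
  rintro _ ⟨T, r, ε, ε', hr, hε, hε', rfl⟩
  refine isOpen_iff_mem_nhds.2 ?_
  rintro ⟨s, f⟩ ⟨v, v', hv, hv', R, hR, hco⟩
  have h1 : {s' : Plane | ‖v' + (s - s')‖ < ε'} ∈ 𝓝 s := by
    have hc : Continuous fun s' : Plane => ‖v' + (s - s')‖ := by fun_prop
    exact (isOpen_lt hc continuous_const).mem_nhds (by simpa using hv')
  filter_upwards [prod_mem_nhds h1 (agreeOn_mem_nhds (R + ‖s + v'‖ + 1) f)]
  rintro ⟨s', f'⟩ ⟨hs, hf⟩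
  -- The second translation in a basic neighborhood absorbs the change of offset from `s` to `s'`.
  refine ⟨v, v' + (s - s'), hv, hs, R, hR, fun t ht => ?_⟩
  rw [hco t ht, translate_ofCfg, translate_ofCfg]
  have : s' + (v' + (s - s')) = s + v' := by abel
  rw [this]
  exact coincideOn_ofCfg hf t ht

end Topology

/-! ### The space of tilings is Hausdorff -/

section Separation

open Topology

variable {A : Type*}

theorem exists_forall_eq_of_abs_sub_lt (a : ℝ) : ∃ δ > 0, ∀ n : ℤ, |a - n| < δ → a = n := by
  by_cases h : Int.fract a = 0
  · refine ⟨1, one_pos, fun n hn => ?_⟩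
    have h1 : a = ⌊a⌋ := by
      have := Int.floor_add_fract a
      rw [h, add_zero] at this
      exact this.symm
    rw [h1] at hn ⊢
    have h2 : |⌊a⌋ - n| < 1 := by exact_mod_cast hn
    rw [Int.abs_lt_one_iff, sub_eq_zero] at h2
    rw [h2]
  · have h0 : 0 < Int.fract a := lt_of_le_of_ne (Int.fract_nonneg a) (Ne.symm h)
    have h1 := Int.fract_lt_one a
    refine ⟨min (Int.fract a) (1 - Int.fract a), lt_min h0 (by linarith), fun n hn => ?_⟩
    rw [lt_min_iff, abs_lt, abs_lt] at hn
    have h2 := Int.floor_add_fract a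
    rcases le_or_gt n ⌊a⌋ with h3 | h3
    · have : (n : ℝ) ≤ ⌊a⌋ := by exact_mod_cast h3
      linarith
    · have : (⌊a⌋ : ℝ) + 1 ≤ n := by exact_mod_cast h3
      linarith

theorem exists_forall_eq_vec (a : Plane) :
    ∃ δ > 0, ∀ n : Fin 2 → ℤ, ‖a - vec n‖ < δ → a = vec n := by
  choose δ hδ h using fun i => exists_forall_eq_of_abs_sub_lt (a i)
  refine ⟨min (δ 0) (δ 1), lt_min (hδ 0) (hδ 1), fun n hn => funext fun i => h i _ ?_⟩
  have h1 := (norm_le_pi_norm (a - vec n) i).trans_lt hn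
  rw [lt_min_iff] at h1
  fin_cases i
  exacts [h1.1, h1.2]

theorem exists_vec_of_coincideOn {a b : Plane} {f g : (Fin 2 → ℤ) → A} {R : ℝ} (hR : 1 < R)
    (h : (ofCfg a f).CoincideOn (ofCfg b g) R) : ∃ n, a = b + vec n := by
  set m : Fin 2 → ℤ := fun i => -⌊a i⌋ with hm
  have h1 : a + vec m ∈ Metric.ball (0 : Plane) R := by
    rw [mem_ball_zero_iff, pi_norm_lt_iff (by linarith)]
    intro i
    have h2 := Int.fract_nonneg (a i)
    have h3 := Int.fract_lt_one (a i)
    have h4 := Int.floor_add_fract (a i)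
    rw [Real.norm_eq_abs, abs_lt]
    simp only [Pi.add_apply, vec_apply, hm, Int.cast_neg]
    constructor <;> linarith
  have h2 := (h (a + vec m, f m) ⟨a + vec m, ⟨le_rfl, fun i => by simp⟩, h1⟩).1
    (mem_tiles_ofCfg.2 ⟨m, rfl, rfl⟩)
  obtain ⟨k, hk, -⟩ := mem_tiles_ofCfg.1 h2
  refine ⟨k - m, ?_⟩
  rw [sub_eq_add_neg, vec_add, vec_neg, ← add_assoc, ← hk]
  simp

/-- If the offsets differ modulo ℤ², their difference avoids integer vectors at distance less than
`δ`, and four translations of size below `δ / 4` cannot compensate for it. Otherwise some cell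
carries different marks, and a ball reaching this cell detects it. Separation is needed to turn
compact images into closed sets and continuous injections on compact spaces into embeddings. -/
instance : T2Space (Tiling A) := by
  refine ⟨fun T T' hTT' => ?_⟩
  obtain ⟨s, f, rfl⟩ := exists_ofCfg T
  obtain ⟨s', f', rfl⟩ := exists_ofCfg T'
  obtain ⟨δ, hδ, hδ'⟩ := exists_forall_eq_vec (s' - s)
  suffices H : ∃ r > 1, ∀ (T'' : Tiling A) (v v' w w' : Plane) (R R' : ℝ), ‖v‖ < δ / 4 → ‖v'‖ < δ / 4 → ‖w‖ < δ / 4 →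
      ‖w'‖ < δ / 4 → r < R → r < R' → ((ofCfg s f).translate v).CoincideOn (T''.translate v') R →
      ((ofCfg s' f').translate w).CoincideOn (T''.translate w') R' → False by
    obtain ⟨r, hr, H⟩ := H
    have h4 : 0 < δ / 4 := by linarith
    have self : ∀ T : Tiling A, T ∈ Tiling.basicNhd T r (δ / 4) (δ / 4) := fun T =>
      ⟨0, 0, by simpa, by simpa, r + 1, by linarith, fun t _ => Iff.rfl⟩
    refine ⟨_, _, isOpen_basicNhd (ofCfg s f) (by linarith) h4 h4,
      isOpen_basicNhd (ofCfg s' f') (by linarith : 0 < r) h4 h4, self _, self _, ?_⟩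
    rw [disjoint_left]
    rintro T'' ⟨v, v', h1, h2, R, hR, hco⟩ ⟨w, w', h3, h4, R', hR', hco'⟩
    exact H T'' v v' w w' R R' h1 h2 h3 h4 hR hR' hco hco'
  have key : ∀ (T'' : Tiling A) (v v' w w' : Plane) (R R' : ℝ), ‖v‖ < δ / 4 → ‖v'‖ < δ / 4 → ‖w‖ < δ / 4 →
      ‖w'‖ < δ / 4 → 1 < R → 1 < R' → ((ofCfg s f).translate v).CoincideOn (T''.translate v') R →
      ((ofCfg s' f').translate w).CoincideOn (T''.translate w') R' →
      v - v' + w' - w = 0 ∧ ∃ n, s' = s + vec n := by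
    intro T'' v v' w w' R R' hv hv' hw hw' hR hR' h1 h2
    obtain ⟨s'', f'', rfl⟩ := exists_ofCfg T''
    rw [translate_ofCfg, translate_ofCfg] at h1 h2
    obtain ⟨n, hn⟩ := exists_vec_of_coincideOn hR h1
    obtain ⟨n', hn'⟩ := exists_vec_of_coincideOn hR' h2
    have e : s' - s - vec (n' - n) = v - v' + w' - w := by
      rw [sub_eq_add_neg n', vec_add, vec_neg, eq_sub_of_add_eq hn, eq_sub_of_add_eq hn']
      abel
    have h3 := hδ' (n' - n) (by
      rw [e]
      calc ‖v - v' + w' - w‖ ≤ ‖v - v' + w'‖ + ‖w‖ := norm_sub_le _ _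
        _ ≤ ‖v - v'‖ + ‖w'‖ + ‖w‖ := by gcongr; exact norm_add_le _ _
        _ ≤ ‖v‖ + ‖v'‖ + ‖w'‖ + ‖w‖ := by gcongr; exact norm_sub_le _ _
        _ < δ := by linarith)
    refine ⟨?_, n' - n, by rw [← h3]; simp⟩
    rw [← e, h3, sub_self]
  by_cases hs : ∃ n, s' = s + vec n
  swap
  · exact ⟨2, by norm_num, fun T'' v v' w w' R R' hv hv' hw hw' hR hR' h1 h2 =>
      hs (key T'' v v' w w' R R' hv hv' hw hw' (by linarith) (by linarith) h1 h2).2⟩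
  obtain ⟨n, rfl⟩ := hs
  obtain ⟨m, hm⟩ : ∃ m, f (m + n) ≠ f' m := by
    by_contra! hcon
    exact hTT' (ofCfg_eq_iff.2 ⟨n, rfl, funext fun m => (hcon m).symm⟩)
  refine ⟨max 2 (‖s + vec (m + n)‖ + δ), by simp, fun T'' v v' w w' R R' hv hv' hw hw' hR hR' h1 h2
    => hm ?_⟩
  rw [max_lt_iff] at hR hR'
  obtain ⟨h3, -⟩ := key T'' v v' w w' R R' hv hv' hw hw' (by linarith) (by linarith) h1 h2
  have near : ∀ (v : Plane) (R : ℝ), ‖v‖ < δ / 4 → ‖s + vec (m + n)‖ + δ < R →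
      (square 1 (s + vec (m + n) + v) ∩ Metric.ball 0 R).Nonempty := by
    intro v R hv hR
    refine ⟨_, ⟨le_rfl, fun i => by simp⟩, ?_⟩
    rw [mem_ball_zero_iff]
    linarith [norm_add_le (s + vec (m + n)) v]
  have h4 := (h1 (s + vec (m + n) + v, f (m + n)) (near v R hv hR.2)).1
    (by
      rw [translate_ofCfg]
      exact mem_tiles_ofCfg.2 ⟨m + n, add_right_comm _ _ _, rfl⟩)
  have h5 : (s + vec (m + n) + w, f (m + n)) ∈ (T''.translate w').tiles := by
    change (s + vec (m + n) + v - v', f (m + n)) ∈ T''.tiles at h4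
    change (s + vec (m + n) + w - w', f (m + n)) ∈ T''.tiles
    convert h4 using 2
    rw [← sub_eq_zero, ← neg_eq_zero, ← h3]
    abel
  have h6 := (h2 (s + vec (m + n) + w, f (m + n)) (near w R' hw hR'.2)).2 h5
  rw [translate_ofCfg, mem_tiles_ofCfg] at h6
  obtain ⟨k, hk, hk'⟩ := h6
  have : k = m := by
    refine vec_injective ?_
    have := hk.symm
    simp only [vec_add] at this
    have e : s + vec n + w + vec k = s + vec n + w + vec m := by
      rw [this]
      abel
    exact add_left_cancel e
  rw [this] at hk'
  exact hk'

theorem exists_ofCfg_mem_Icc (T : Tiling A) : ∃ s ∈ Icc (0 : Plane) 1, ∃ f, T = ofCfg s f := by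
  obtain ⟨s, f, rfl⟩ := exists_ofCfg T
  refine ⟨s + vec (fun i => -⌊s i⌋), ⟨fun i => ?_, fun i => ?_⟩, _, (ofCfg_add_vec _ _ _).symm⟩
  · have := Int.floor_le (s i)
    simp only [Pi.add_apply, vec_apply, Int.cast_neg, Pi.zero_apply]
    linarith
  · have := (Int.lt_floor_add_one (s i)).le
    simp only [Pi.add_apply, vec_apply, Int.cast_neg, Pi.one_apply]
    linarith

theorem exists_norm_le_ofCfg (s : Plane) (f : (Fin 2 → ℤ) → A) :
    ∃ s' ∈ Icc (0 : Plane) 1, ∃ n, ofCfg s f = ofCfg s' (cfgShift n f) := by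
  obtain ⟨s', hs', f', h⟩ := exists_ofCfg_mem_Icc (ofCfg s f)
  obtain ⟨n, h1, rfl⟩ := ofCfg_eq_iff.1 h
  exact ⟨s', hs', n, h⟩

end Separation

/-! ### Uniform aperiodicity in the hull -/

section Orbits

variable {A : Type*} [TopologicalSpace A]

theorem continuous_cfgShift (n : Fin 2 → ℤ) :
    Continuous (cfgShift n : ((Fin 2 → ℤ) → A) → (Fin 2 → ℤ) → A) :=
  continuous_pi fun m => continuous_apply (m + n)

/-- The configurations in the orbit closure of `f₀`. -/
def cfgHull (f₀ : (Fin 2 → ℤ) → A) : Set ((Fin 2 → ℤ) → A) :=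
  closure (range fun n => cfgShift n f₀)

theorem cfgShift_mem_cfgHull {f₀ f : (Fin 2 → ℤ) → A} (hf : f ∈ cfgHull f₀) (n : Fin 2 → ℤ) :
    cfgShift n f ∈ cfgHull f₀ := by
  refine map_mem_closure (continuous_cfgShift n) hf ?_
  rintro _ ⟨m, rfl⟩
  exact ⟨n + m, (cfgShift_cfgShift n m f₀).symm⟩

theorem cfgShift_mem_cfgHull_iff {f₀ f : (Fin 2 → ℤ) → A} {n : Fin 2 → ℤ} :
    cfgShift n f ∈ cfgHull f₀ ↔ f ∈ cfgHull f₀ := by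
  refine ⟨fun h => ?_, fun h => cfgShift_mem_cfgHull h n⟩
  have := cfgShift_mem_cfgHull h (-n)
  rwa [cfgShift_cfgShift, neg_add_cancel, cfgShift_zero] at this

variable [DiscreteTopology A]

/-- Aperiodicity gives two tiles of `T`, at relative position `w`, with different marks. By
repetitivity this pair recurs in every ball of some radius `R`, so every translate has a cell `n`
with `‖n‖ ≤ R` where it differs from its `w`-shift. This is a finite union of closed conditions, so
it passes to the closure. -/
theorem exists_not_agreeOn {s₀ : Plane} {f₀ : (Fin 2 → ℤ) → A} (hap : (ofCfg s₀ f₀).Aperiodic)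
    (hrep : (ofCfg s₀ f₀).Repetitive) {w : Fin 2 → ℤ} (hw : w ≠ 0) :
    ∃ r : ℝ, ∀ f ∈ cfgHull f₀, ¬ AgreeOn r f (cfgShift w f) := by
  obtain ⟨m, hm⟩ : ∃ m, f₀ m ≠ f₀ (m + w) := by
    by_contra! hcon
    refine hw (vec_injective ?_)
    rw [vec_zero]
    refine hap _ ?_
    rw [translate_ofCfg]
    exact ofCfg_eq_iff.2 ⟨-w, by rw [vec_neg]; abel, funext fun n => by simp [hcon (n + -w)]⟩
  obtain ⟨R, hR, h⟩ := hrep {(s₀ + vec m, f₀ m), (s₀ + vec (m + w), f₀ (m + w))}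
    (by simp) (by
      rintro t (rfl | rfl)
      · exact mem_tiles_ofCfg.2 ⟨m, rfl, rfl⟩
      · exact mem_tiles_ofCfg.2 ⟨m + w, rfl, rfl⟩)
  refine ⟨R, ?_⟩
  have hcl : IsClosed (⋃ n ∈ {n : Fin 2 → ℤ | ‖n‖ ≤ R},
      {f : (Fin 2 → ℤ) → A | f n ≠ f (n + w)}) := by
    refine (finite_norm_le R).isClosed_biUnion fun n _ => ?_
    have hc : Continuous fun f : (Fin 2 → ℤ) → A => (f n, f (n + w)) := by fun_prop
    exact (isClosed_discrete {z : A × A | z.1 ≠ z.2}).preimage hc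
  have hsub : cfgHull f₀ ⊆ _ := closure_minimal (by
    rintro _ ⟨k, rfl⟩
    obtain ⟨u, hu⟩ := h (s₀ + vec k)
    obtain ⟨h1, h2⟩ := hu _ (Or.inl rfl)
    obtain ⟨h3, -⟩ := hu _ (Or.inr rfl)
    obtain ⟨a, ha, ha'⟩ := mem_tiles_ofCfg.1 h1
    obtain ⟨b, hb, hb'⟩ := mem_tiles_ofCfg.1 h3
    dsimp only at ha ha' hb hb' h2
    have hab : b = a + w := by
      refine vec_injective ?_
      refine add_left_cancel (a := s₀) ?_
      rw [← hb, vec_add, vec_add, ← add_assoc, ← add_assoc, ← ha]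
      abel
    simp only [mem_iUnion]
    refine ⟨a - k, ?_, ?_⟩
    · have h4 := h2 (show s₀ + vec m + u ∈ _ from ⟨le_rfl, fun i => by simp⟩)
      rw [ha, Metric.mem_ball, dist_add_left, dist_eq_norm] at h4
      change ‖a - k‖ ≤ R
      rw [← norm_vec, sub_eq_add_neg, vec_add, vec_neg, ← sub_eq_add_neg]
      exact h4.le
    · change f₀ (a - k + k) ≠ f₀ (a - k + w + k)
      have e : a - k + w + k = b := by
        rw [hab]
        abel
      rw [e, sub_add_cancel, ← ha', ← hb']
      exact hm) hcl
  intro f hf hag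
  have := hsub hf
  simp only [mem_iUnion] at this
  obtain ⟨n, hn, hne⟩ := this
  exact hne (hag n hn)

/-- Different translates of a configuration in the hull differ near the origin, uniformly for
translations of bounded size. -/
theorem exists_forall_eq_zero {s₀ : Plane} {f₀ : (Fin 2 → ℤ) → A} (hap : (ofCfg s₀ f₀).Aperiodic)
    (hrep : (ofCfg s₀ f₀).Repetitive) (D : ℝ) :
    ∃ r : ℝ, ∀ f ∈ cfgHull f₀, ∀ w, ‖w‖ ≤ D → AgreeOn r f (cfgShift w f) → w = 0 := by
  choose! r hr using fun (w : Fin 2 → ℤ) (hw : w ≠ 0) => exists_not_agreeOn hap hrep hw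
  obtain ⟨R, hR⟩ := ((finite_norm_le D).image r).bddAbove
  refine ⟨R, fun f hf w hw hag => ?_⟩
  by_contra hne
  exact hr w hne f hf (hag.mono (hR ⟨w, hw, rfl⟩))

end Orbits

/-! ### The hull and its topology -/

section Hull

open Topology

variable {A : Type*} [TopologicalSpace A] [DiscreteTopology A] [Finite A]

/-- Offsets may be taken in a compact unit square and the marks form a compact space, since `A` is
finite. Hence the generated topology can be handled as a quotient of a compact space. -/
theorem isProperMap_ofCfg :
    IsProperMap (fun z : Icc (0 : Plane) 1 × ((Fin 2 → ℤ) → A) => ofCfg z.1.1 z.2) := by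
  have : CompactSpace (Icc (0 : Plane) 1) := isCompact_iff_compactSpace.1 isCompact_Icc
  exact (continuous_ofCfg.comp (by fun_prop : Continuous fun z : Icc (0 : Plane) 1 ×
    ((Fin 2 → ℤ) → A) => (z.1.1, z.2))).isProperMap

theorem isQuotientMap_ofCfg :
    IsQuotientMap (fun z : Plane × ((Fin 2 → ℤ) → A) => ofCfg z.1 z.2) := by
  refine IsQuotientMap.of_comp (f := fun z : Icc (0 : Plane) 1 × ((Fin 2 → ℤ) → A) =>
    ((z.1 : Plane), z.2)) (by fun_prop) continuous_ofCfg ?_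
  refine isProperMap_ofCfg.isClosedMap.isQuotientMap isProperMap_ofCfg.continuous fun T => ?_
  obtain ⟨s, hs, f, rfl⟩ := exists_ofCfg_mem_Icc T
  exact ⟨(⟨s, hs⟩, f), rfl⟩

/-- The product of a proper surjection with the identity is again a quotient map, so continuity can
be tested on offsets and marks, where translating means adding to the offset. -/
theorem continuous_translate : Continuous (fun z : Plane × Tiling A => z.2.translate z.1) := by
  have h : IsProperMap (Prod.map id
      (fun z : Icc (0 : Plane) 1 × ((Fin 2 → ℤ) → A) => ofCfg z.1.1 z.2) :
      Plane × _ → Plane × Tiling A) := isProperMap_id.prodMap isProperMap_ofCfg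
  refine (h.isClosedMap.isQuotientMap h.continuous ?_).continuous_iff.2 ?_
  · rintro ⟨v, T⟩
    obtain ⟨s, hs, f, rfl⟩ := exists_ofCfg_mem_Icc T
    exact ⟨(v, ⟨s, hs⟩, f), rfl⟩
  · have : ((fun z : Plane × Tiling A => z.2.translate z.1) ∘ Prod.map id
        (fun z : Icc (0 : Plane) 1 × ((Fin 2 → ℤ) → A) => ofCfg z.1.1 z.2)) =
        fun z => ofCfg (z.2.1.1 + z.1) z.2.2 := by
      ext1 z
      exact translate_ofCfg _ _ _
    rw [this]
    exact continuous_ofCfg.comp (by fun_prop : Continuous fun z : Plane × Icc (0 : Plane) 1 ×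
      ((Fin 2 → ℤ) → A) => (z.2.1.1 + z.1, z.2.2))

/-- In one direction, the tilings with marks in `cfgHull f₀` form a closed set that contains the
orbit. In the other, `ofCfg s` is continuous and sends shifts of `f₀` to translates of the tiling.
-/
theorem mem_hull_iff {s s₀ : Plane} {f f₀ : (Fin 2 → ℤ) → A} :
    ofCfg s f ∈ (ofCfg s₀ f₀).hull ↔ f ∈ cfgHull f₀ := by
  constructor
  · intro h
    have hcl : IsClosed ((fun z : Icc (0 : Plane) 1 × ((Fin 2 → ℤ) → A) => ofCfg z.1.1 z.2) ''
        {z | z.2 ∈ cfgHull f₀}) :=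
      isProperMap_ofCfg.isClosedMap _ (isClosed_closure.preimage continuous_snd)
    have hsub : range (ofCfg s₀ f₀).translate ⊆
        (fun z : Icc (0 : Plane) 1 × ((Fin 2 → ℤ) → A) => ofCfg z.1.1 z.2) ''
        {z | z.2 ∈ cfgHull f₀} := by
      rintro _ ⟨v, rfl⟩
      rw [translate_ofCfg]
      obtain ⟨s', hs', n, h⟩ := exists_norm_le_ofCfg (s₀ + v) f₀
      exact ⟨(⟨s', hs'⟩, cfgShift n f₀), subset_closure ⟨n, rfl⟩, h.symm⟩
    obtain ⟨⟨s', f'⟩, hf', he⟩ := closure_minimal hsub hcl h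
    obtain ⟨n, -, rfl⟩ := ofCfg_eq_iff.1 he
    exact cfgShift_mem_cfgHull hf' n
  · intro h
    have hc : Continuous fun g : (Fin 2 → ℤ) → A => ofCfg s g :=
      continuous_ofCfg.comp (by fun_prop : Continuous fun g : (Fin 2 → ℤ) → A => (s, g))
    refine map_mem_closure hc h ?_
    rintro _ ⟨n, rfl⟩
    refine ⟨s - s₀ - vec n, ?_⟩
    rw [translate_ofCfg, ← ofCfg_add_vec _ n]
    congr 1
    abel

theorem translate_mem_hull_iff {T₀ T : Tiling A} {v : Plane} :
    T.translate v ∈ T₀.hull ↔ T ∈ T₀.hull := by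
  obtain ⟨s, f, rfl⟩ := exists_ofCfg T
  obtain ⟨s₀, f₀, rfl⟩ := exists_ofCfg T₀
  rw [translate_ofCfg, mem_hull_iff, mem_hull_iff]

end Hull

/-! ### Unions of lattice cells -/

section Cells

variable {s : Plane} {D : Set (Fin 2 → ℤ)} {k n : Fin 2 → ℤ}

/-- The union of the cells with indices in `D`. -/
def cells (s : Plane) (D : Set (Fin 2 → ℤ)) : Set Plane := ⋃ n ∈ D, square 1 (s + vec n)

theorem mem_cells {x : Plane} : x ∈ cells s D ↔ ∃ n ∈ D, x ∈ square 1 (s + vec n) := by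
  simp [cells]

/-- The center of the cell `k`. -/
noncomputable def center (s : Plane) (k : Fin 2 → ℤ) : Plane := fun i => s i + k i + 1 / 2

theorem center_mem_interior : center s k ∈ interior (square 1 (s + vec k)) := by
  rw [interior_square, mem_rect]
  intro i
  simp only [center, Pi.add_apply, vec_apply]
  constructor <;> linarith

theorem eq_of_mem_of_mem_interior {x : Plane} (h : x ∈ square 1 (s + vec n))
    (h' : x ∈ interior (square 1 (s + vec k))) : n = k := by
  rw [interior_square, mem_rect] at h'
  ext i
  have h1 := h.1 i
  have h2 := h.2 i
  have h3 := h' i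
  simp only [Pi.add_apply, vec_apply] at h1 h2 h3
  have h4 : (n i : ℝ) < k i + 1 := by linarith
  have h5 : (k i : ℝ) < n i + 1 := by linarith
  have h6 : n i < k i + 1 := by exact_mod_cast h4
  have h7 : k i < n i + 1 := by exact_mod_cast h5
  omega

theorem center_mem_cells : center s k ∈ cells s D ↔ k ∈ D := by
  rw [mem_cells]
  constructor
  · rintro ⟨n, hn, h⟩
    rwa [← eq_of_mem_of_mem_interior h center_mem_interior]
  · exact fun h => ⟨k, h, interior_subset center_mem_interior⟩

theorem mem_cells_of_mem_interior {x : Plane} (hx : x ∈ interior (square 1 (s + vec k))) :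
    x ∈ cells s D ↔ k ∈ D := by
  rw [mem_cells]
  constructor
  · rintro ⟨n, hn, h⟩
    rwa [← eq_of_mem_of_mem_interior h hx]
  · exact fun h => ⟨k, h, interior_subset hx⟩

theorem interior_cell_subset (hk : k ∈ D) :
    interior (square 1 (s + vec k)) ⊆ interior (cells s D) :=
  interior_mono (subset_biUnion_of_mem (u := fun n => square 1 (s + vec n)) hk)

theorem mem_square_add {r : ℝ} {p u x : Plane} : x ∈ square r (p + u) ↔ x - u ∈ square r p := by
  simp only [square, mem_Icc, Pi.le_def, Pi.add_apply, Pi.sub_apply]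
  constructor <;> rintro ⟨h1, h2⟩ <;>
    exact ⟨fun i => by linarith [h1 i], fun i => by linarith [h2 i]⟩

theorem mem_cells_add {u x : Plane} : x ∈ cells (s + u) D ↔ x - u ∈ cells s D := by
  simp only [mem_cells]
  refine exists_congr fun n => and_congr_right fun _ => ?_
  rw [add_right_comm, mem_square_add]

theorem image_add_cells (u : Plane) : (fun x => u + x) '' cells s D = cells (s + u) D := by
  ext x
  rw [mem_cells_add, image_add_left, mem_preimage, neg_add_eq_sub]

theorem exists_mem_cell (s x : Plane) : ∃ k, x ∈ square 1 (s + vec k) := by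
  refine ⟨fun i => ⌊x i - s i⌋, fun i => ?_, fun i => ?_⟩
  · have := Int.floor_le (x i - s i)
    simp only [Pi.add_apply, vec_apply]
    linarith
  · have := Int.lt_floor_add_one (x i - s i)
    simp only [Pi.add_apply, vec_apply]
    linarith

theorem isClosed_cells (hD : D.Finite) : IsClosed (cells s D) :=
  hD.isClosed_biUnion fun _ _ => isClosed_square _ _

theorem isCompact_cells (hD : D.Finite) : IsCompact (cells s D) :=
  hD.isCompact_biUnion fun _ _ => isCompact_Icc

end Cells

/-! ### Base points and recognition by finite windows -/

section BasePoints

open Topology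

variable {A : Type*} {β : A → Plane}

theorem base_bounds (hβ : ∀ a, β a ∈ interior (square 1 0)) (a : A) (i : Fin 2) :
    0 < β a i ∧ β a i < 1 := by
  have := hβ a
  rw [interior_square, mem_rect] at this
  simpa using this i

/-- The tiling with marks `f` having the origin as base point of the cell `0`. -/
def based (β : A → Plane) (f : (Fin 2 → ℤ) → A) : Tiling A := ofCfg (-β (f 0)) f

theorem based_eq_translate_iff {s u : Plane} {f g : (Fin 2 → ℤ) → A} :
    (ofCfg s f).translate (-u) = based β g ↔
      ∃ m, u = s + vec m + β (f m) ∧ g = cfgShift m f := by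
  rw [translate_ofCfg, based, ofCfg_eq_iff]
  refine exists_congr fun m => and_congr_left ?_
  rintro rfl
  rw [cfgShift_apply, zero_add]
  constructor <;> intro h <;> ext i <;> have := congrFun h i <;>
    simp only [Pi.add_apply, Pi.neg_apply] at this ⊢ <;> linarith

theorem translate_eq_based (s : Plane) (f : (Fin 2 → ℤ) → A) (m : Fin 2 → ℤ) :
    (ofCfg s f).translate (-(s + vec m + β (f m))) = based β (cfgShift m f) :=
  based_eq_translate_iff.2 ⟨m, rfl, rfl⟩

/-- Base points are interior to the unit square, so the coordinates of two of them differ by less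
than one. Hence the origin is the base point of at most one tile. -/
theorem eq_zero_of_vec (hβ : ∀ a, β a ∈ interior (square 1 0)) {a b : A} {m : Fin 2 → ℤ}
    (h : β a = β b + vec m) : m = 0 := by
  ext i
  have h1 := congrFun h i
  have h2 := base_bounds hβ a i
  have h3 := base_bounds hβ b i
  simp only [Pi.add_apply, vec_apply] at h1
  have h4 : (m i : ℝ) < 1 := by linarith
  have h5 : (-1 : ℝ) < m i := by linarith
  have h6 : m i < 1 := by exact_mod_cast h4
  have h7 : -1 < m i := by exact_mod_cast h5
  simp only [Pi.zero_apply]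
  omega

theorem based_injective (hβ : ∀ a, β a ∈ interior (square 1 0)) :
    Function.Injective (based β) := by
  intro f g h
  obtain ⟨n, h1, rfl⟩ := ofCfg_eq_iff.1 h
  have h2 : β (f 0) = β (cfgShift n f 0) + vec n := by
    rw [← neg_inj, eq_sub_of_add_eq h1.symm]
    abel
  rw [eq_zero_of_vec hβ h2, cfgShift_zero]

theorem zero_mem_cell_iff (hβ : ∀ a, β a ∈ interior (square 1 0)) {a : A} {n : Fin 2 → ℤ} :
    (0 : Plane) ∈ square 1 (-β a + vec n) ↔ n = 0 := by
  have h0 : (0 : Plane) ∈ interior (square 1 (-β a + vec 0)) := by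
    rw [interior_square, mem_rect]
    intro i
    have := base_bounds hβ a i
    simp only [Pi.add_apply, vec_zero, Pi.zero_apply, Pi.neg_apply]
    constructor <;> linarith
  constructor
  · exact fun h => eq_of_mem_of_mem_interior h h0
  · rintro rfl
    exact interior_subset h0

theorem zero_mem_cells_iff (hβ : ∀ a, β a ∈ interior (square 1 0)) {a : A}
    {D : Set (Fin 2 → ℤ)} : (0 : Plane) ∈ cells (-β a) D ↔ 0 ∈ D := by
  simp [mem_cells, zero_mem_cell_iff hβ]

variable [TopologicalSpace A]

theorem exists_agreeOn_subset {f : (Fin 2 → ℤ) → A} {U : Set ((Fin 2 → ℤ) → A)}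
    (hU : U ∈ 𝓝 f) : ∃ r : ℝ, ∀ g, AgreeOn r f g → g ∈ U := by
  rw [nhds_pi, Filter.mem_pi] at hU
  obtain ⟨I, hI, t, ht, hsub⟩ := hU
  obtain ⟨r, hr⟩ := (hI.image norm).bddAbove
  refine ⟨r, fun g hg => hsub fun m hm => ?_⟩
  rw [← hg m (hr ⟨m, hm, rfl⟩)]
  exact mem_of_mem_nhds (ht m)

variable [DiscreteTopology A] {f₀ : (Fin 2 → ℤ) → A} {s₀ : Plane}

theorem continuous_based : Continuous (based β) :=
  continuous_ofCfg.comp (f := fun f : (Fin 2 → ℤ) → A => (-β (f 0), f))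
    (((continuous_of_discreteTopology (f := β)).comp (continuous_apply 0)).neg.prodMk continuous_id)

variable [Finite A]

theorem mem_totalTransversal_iff {T : Tiling A} :
    T ∈ totalTransversal β (ofCfg s₀ f₀).hull ↔ ∃ f ∈ cfgHull f₀, T = based β f := by
  constructor
  · rintro ⟨hT, a, ha⟩
    obtain ⟨s, f, rfl⟩ := exists_ofCfg T
    obtain ⟨m, h1, h2⟩ := mem_tiles_ofCfg.1 ha
    dsimp only at h1 h2
    refine ⟨cfgShift m f, cfgShift_mem_cfgHull (mem_hull_iff.1 hT) m, ?_⟩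
    rw [based, cfgShift_apply, zero_add, ← h2, h1, ofCfg_add_vec]
  · rintro ⟨f, hf, rfl⟩
    exact ⟨mem_hull_iff.2 hf, f 0, mem_tiles_ofCfg.2 ⟨0, by simp, rfl⟩⟩

/-- Each point of the compact hull has a cylinder contained in `E` or in its complement; the largest
radius in a finite subcover works for all. -/
theorem exists_radius {E : Set (cfgHull f₀)} (hE : IsClopen E) :
    ∃ r : ℝ, ∀ f g : cfgHull f₀, AgreeOn r f.1 g.1 → f ∈ E → g ∈ E := by
  have hcomp : CompactSpace (cfgHull f₀) := isCompact_iff_compactSpace.1 isClosed_closure.isCompact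
  have key : ∀ f : cfgHull f₀, ∃ r : ℝ, ∀ g : cfgHull f₀, AgreeOn r f.1 g.1 → (g ∈ E ↔ f ∈ E) := by
    intro f
    by_cases hf : f ∈ E
    · obtain ⟨U, hU, hUE⟩ := mem_nhds_subtype _ _ _ |>.1 (hE.isOpen.mem_nhds hf)
      obtain ⟨r, hr⟩ := exists_agreeOn_subset hU
      exact ⟨r, fun g hg => iff_of_true (hUE (hr g hg)) hf⟩
    · obtain ⟨U, hU, hUE⟩ := mem_nhds_subtype _ _ _ |>.1 (hE.compl.isOpen.mem_nhds hf)
      obtain ⟨r, hr⟩ := exists_agreeOn_subset hU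
      exact ⟨r, fun g hg => iff_of_false (hUE (hr g hg)) hf⟩
  choose r hr using key
  obtain ⟨t, -, ht⟩ := isCompact_univ.elim_nhds_subcover
    (fun f : cfgHull f₀ => {g : cfgHull f₀ | AgreeOn (r f) f.1 g.1})
    fun f _ => continuous_subtype_val.continuousAt.preimage_mem_nhds (agreeOn_mem_nhds (r f) f.1)
  obtain ⟨R, hR⟩ := (t.finite_toSet.image r).bddAbove
  refine ⟨R, fun f g hfg hf => ?_⟩
  have := ht (mem_univ f)
  simp only [mem_iUnion] at this
  obtain ⟨h, hh, hhf⟩ := this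
  have hhg : AgreeOn (r h) h.1 g.1 := fun m hm =>
    (hhf m hm).trans (hfg m (hm.trans (hR ⟨h, hh, rfl⟩)))
  exact (hr h g hhg).2 ((hr h f hhf).1 hf)

theorem isOpenMap_ofCfg :
    IsOpenMap (fun z : Plane × ((Fin 2 → ℤ) → A) => ofCfg z.1 z.2) := by
  intro U hU
  rw [← isQuotientMap_ofCfg.isOpen_preimage]
  have : (fun z : Plane × ((Fin 2 → ℤ) → A) => ofCfg z.1 z.2) ⁻¹'
      ((fun z : Plane × ((Fin 2 → ℤ) → A) => ofCfg z.1 z.2) '' U) =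
      ⋃ n, (fun z : Plane × ((Fin 2 → ℤ) → A) => (z.1 + vec n, cfgShift n z.2)) ⁻¹' U := by
    ext ⟨s, f⟩
    simp only [mem_preimage, mem_image, mem_iUnion]
    constructor
    · rintro ⟨⟨s', f'⟩, h1, h2⟩
      obtain ⟨n, rfl, rfl⟩ := ofCfg_eq_iff.1 h2.symm
      exact ⟨n, h1⟩
    · rintro ⟨n, hn⟩
      exact ⟨_, hn, ofCfg_add_vec _ _ _⟩
  rw [this]
  refine isOpen_iUnion fun n => hU.preimage ?_
  exact (continuous_fst.add continuous_const).prodMk ((continuous_cfgShift n).comp continuous_snd)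

end BasePoints

/-! ### Combinatorial description of flow boxes -/

section CellData

open Topology

theorem center_add_vec (s : Plane) (m k : Fin 2 → ℤ) : center (s + vec m) (k - m) = center s k := by
  ext i
  simp only [center, Pi.add_apply, Pi.sub_apply, vec_apply, Int.cast_sub]
  ring

variable {A : Type*} {β : A → Plane} {f₀ : (Fin 2 → ℤ) → A} {s₀ : Plane}

/-- The configurations of the tilings in the `i`-th transversal. -/
def FlowBoxFamily.cfgs {Ω : Set (Tiling A)} (B : FlowBoxFamily β Ω) (i : Fin B.card) :
    Set ((Fin 2 → ℤ) → A) := {f | based β f ∈ B.trans i}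

theorem FlowBoxFamily.exists_bound (B : FlowBoxFamily β (ofCfg s₀ f₀).hull) :
    ∃ d : ℕ, ∀ i, B.plaque i ⊆ Metric.closedBall 0 (d : ℝ) := by
  have h1 : Bornology.IsBounded (⋃ i, B.plaque i) := by
    refine Bornology.isBounded_iUnion.2 fun i => ?_
    obtain ⟨M, hM, h, -⟩ := B.isPatch i
    rw [h]
    exact (Bornology.isBounded_biUnion hM).2 fun t _ => Metric.isBounded_Icc _ _
  obtain ⟨R, hR⟩ := h1.subset_closedBall 0
  obtain ⟨d, hd⟩ := exists_nat_ge R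
  exact ⟨d, fun i => (subset_iUnion _ i).trans (hR.trans (Metric.closedBall_subset_closedBall hd))⟩

variable [TopologicalSpace A]

/-- The `i`-th plaque consists of the cells with indices in `D i`, at distance at most `d` from the
central cell, and the `i`-th transversal consists of tilings recognized by their cells at distance
at most `r`. -/
structure FlowBoxFamily.IsCellData (B : FlowBoxFamily β (ofCfg s₀ f₀).hull)
    (D : Fin B.card → Set (Fin 2 → ℤ)) (r d : ℝ) : Prop where
  plaque_eq : ∀ i, ∀ f ∈ B.cfgs i, B.plaque i = cells (-β (f 0)) (D i)
  mem_cfgs : ∀ i, ∀ f ∈ B.cfgs i, ∀ g, AgreeOn r f g → f ∈ cfgHull f₀ → g ∈ cfgHull f₀ →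
    g ∈ B.cfgs i
  norm_le : ∀ i, ∀ n ∈ D i, ‖n‖ ≤ d
  zero_mem : ∀ i, 0 ∈ D i
  nonneg : 0 ≤ r

variable [DiscreteTopology A] [Finite A]
  {B : FlowBoxFamily β (ofCfg s₀ f₀).hull} {D : Fin B.card → Set (Fin 2 → ℤ)} {r d : ℝ}

theorem FlowBoxFamily.exists_of_mem_trans (B : FlowBoxFamily β (ofCfg s₀ f₀).hull) {i : Fin B.card}
    {T : Tiling A} (hT : T ∈ B.trans i) :
    ∃ f ∈ B.cfgs i, f ∈ cfgHull f₀ ∧ T = based β f := by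
  obtain ⟨f, hf, rfl⟩ := mem_totalTransversal_iff.1 (B.trans_subset i hT)
  exact ⟨f, hT, hf, rfl⟩

theorem FlowBoxFamily.mem_cfgHull {i : Fin B.card} {f : (Fin 2 → ℤ) → A}
    (hf : f ∈ B.cfgs i) : f ∈ cfgHull f₀ := mem_hull_iff.1 (B.trans_subset i hf).1

theorem FlowBoxFamily.exists_isCellData (hβ : ∀ a, β a ∈ interior (square 1 0))
    (hd : ∀ i, B.plaque i ⊆ Metric.closedBall 0 d) : ∃ D r, B.IsCellData D r (d + 1) := by
  have h1 : ∀ i, ∃ D : Set (Fin 2 → ℤ), ∀ f ∈ B.cfgs i, B.plaque i = cells (-β (f 0)) D := by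
    intro i
    obtain ⟨T, hT⟩ := B.trans_nonempty i
    obtain ⟨f, hf, -, rfl⟩ := B.exists_of_mem_trans hT
    obtain ⟨M, -, hM, hM'⟩ := B.isPatch i
    obtain ⟨t₀, ht₀, -⟩ : ∃ t ∈ M, (0 : Plane) ∈ square 1 t.1 := by
      have := B.zero_mem i
      rw [hM] at this
      simpa using this
    refine ⟨{n | (-β (f 0) + vec n, f n) ∈ M}, fun g hg => ?_⟩
    have hfg : β (g 0) = β (f 0) := by
      obtain ⟨m, h1, -⟩ := mem_tiles_ofCfg.1 (hM' _ hf ht₀)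
      obtain ⟨n, h2, -⟩ := mem_tiles_ofCfg.1 (hM' _ hg ht₀)
      have h3 : β (g 0) = β (f 0) + vec (n - m) := by
        have := h1.symm.trans h2
        ext i
        have := congrFun this i
        simp only [Pi.add_apply, Pi.neg_apply, vec_apply, Pi.sub_apply, Int.cast_sub] at this ⊢
        linarith
      rw [h3, eq_zero_of_vec hβ h3, vec_zero, add_zero]
    rw [hM, hfg]
    ext x
    simp only [mem_iUnion, mem_cells, mem_ofPred_eq, exists_prop]
    constructor
    · rintro ⟨t, ht, hx⟩
      obtain ⟨n, h2, h3⟩ := mem_tiles_ofCfg.1 (hM' _ hf ht)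
      refine ⟨n, ?_, h2 ▸ hx⟩
      rw [← h2, ← h3]
      exact ht
    · rintro ⟨n, hn, hx⟩
      exact ⟨_, hn, hx⟩
  have h2 : ∀ i, ∃ r : ℝ, ∀ f ∈ B.cfgs i, ∀ g, AgreeOn r f g → f ∈ cfgHull f₀ →
      g ∈ cfgHull f₀ → g ∈ B.cfgs i := by
    intro i
    have hc : Continuous fun f : cfgHull f₀ => (⟨based β f.1,
        mem_totalTransversal_iff.2 ⟨f.1, f.2, rfl⟩⟩ : totalTransversal β (ofCfg s₀ f₀).hull) :=
      (continuous_based.comp continuous_subtype_val).subtype_mk _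
    obtain ⟨r, hr⟩ := exists_radius ((B.trans_isClopen i).preimage hc)
    exact ⟨r, fun f hf g hfg hf' hg' => hr ⟨f, hf'⟩ ⟨g, hg'⟩ hfg hf⟩
  choose D hD using h1
  choose r hr using h2
  obtain ⟨R, hR⟩ := (finite_range r).bddAbove
  refine ⟨D, max R 0, hD, fun i f hf g hfg => hr i f hf g
    (hfg.mono ((hR ⟨i, rfl⟩).trans (le_max_left _ _))), fun i n hn => ?_, fun i => ?_,
    le_max_right _ _⟩
  · obtain ⟨T, hT⟩ := B.trans_nonempty i
    obtain ⟨f, hf, -, rfl⟩ := B.exists_of_mem_trans hT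
    have h3 : -β (f 0) + vec n ∈ Metric.closedBall (0 : Plane) d := by
      refine hd i ?_
      rw [hD i f hf]
      exact mem_cells.2 ⟨n, hn, le_rfl, fun j => by simp⟩
    rw [mem_closedBall_zero_iff] at h3
    have h4 : ‖β (f 0)‖ ≤ 1 := (pi_norm_le_iff_of_nonneg zero_le_one).2 fun j => by
      have := base_bounds hβ (f 0) j
      rw [Real.norm_eq_abs, abs_le]
      constructor <;> linarith
    calc ‖n‖ = ‖(-β (f 0) + vec n) + β (f 0)‖ := by rw [← norm_vec]; congr 1; abel
      _ ≤ ‖-β (f 0) + vec n‖ + ‖β (f 0)‖ := norm_add_le _ _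
      _ ≤ d + 1 := by linarith
  · obtain ⟨T, hT⟩ := B.trans_nonempty i
    obtain ⟨f, hf, -, rfl⟩ := B.exists_of_mem_trans hT
    have := B.zero_mem i
    rwa [hD i f hf, zero_mem_cells_iff hβ] at this

namespace FlowBoxFamily.IsCellData

theorem mem_plaquesOn (hD : B.IsCellData D r d) {s : Plane} {f : (Fin 2 → ℤ) → A} {Q : Set Plane} :
    Q ∈ B.plaquesOn (ofCfg s f) ↔
      ∃ i m, cfgShift m f ∈ B.cfgs i ∧ Q = cells (s + vec m) (D i) := by
  have key : ∀ i m, cfgShift m f ∈ B.cfgs i →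
      (fun x => s + vec m + β (f m) + x) '' B.plaque i = cells (s + vec m) (D i) := by
    intro i m h
    rw [hD.plaque_eq i _ h, image_add_cells]
    simp
  constructor
  · rintro ⟨i, u, hu, rfl⟩
    obtain ⟨g, hg, -, h1⟩ := B.exists_of_mem_trans hu
    obtain ⟨m, rfl, rfl⟩ := based_eq_translate_iff.1 h1
    exact ⟨i, m, hg, key i m hg⟩
  · rintro ⟨i, m, h, rfl⟩
    refine ⟨i, s + vec m + β (f m), ?_, (key i m h).symm⟩
    rw [translate_eq_based]
    exact h

/-- The box contains the image, under the open map `ofCfg`, of an open set of offsets times a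
cylinder of configurations. -/
theorem mem_interior_box (hD : B.IsCellData D r d) {i : Fin B.card} {f : (Fin 2 → ℤ) → A}
    (hf : f ∈ B.cfgs i) {v : Plane} (hv : v ∈ interior (B.plaque i)) (S : (ofCfg s₀ f₀).hull)
    (hS : S.1 = (based β f).translate (-v)) :
    S ∈ interior {S : (ofCfg s₀ f₀).hull | ∃ T ∈ B.trans i, ∃ v ∈ B.plaque i,
      S.1 = T.translate (-v)} := by
  set O : Set Plane := {s' | -β (f 0) - s' ∈ interior (B.plaque i)} with hO
  have hOo : IsOpen O := isOpen_interior.preimage (continuous_const.sub continuous_id)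
  have hcyl := mem_interior_iff_mem_nhds.2 (agreeOn_mem_nhds r f)
  have hW := isOpenMap_ofCfg (A := A) _ (hOo.prod (isOpen_interior (s := {g | AgreeOn r f g})))
  refine mem_interior.2 ⟨_, ?_, hW.preimage continuous_subtype_val, ?_⟩
  · rintro ⟨S', hS'⟩ ⟨⟨s', g⟩, ⟨h1, h2⟩, h3⟩
    obtain rfl : ofCfg s' g = S' := h3
    have h2' := interior_subset h2
    have hg := hD.mem_cfgs i f hf g h2' (FlowBoxFamily.mem_cfgHull hf) (mem_hull_iff.1 hS')
    refine ⟨_, hg, _, interior_subset h1, ?_⟩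
    have h4 : f 0 = g 0 := h2' 0 (by simpa using hD.nonneg)
    rw [based, translate_ofCfg, h4, neg_sub, sub_neg_eq_add, add_comm, add_neg_cancel_right]
  · refine ⟨(-β (f 0) - v, f), ⟨?_, hcyl⟩, ?_⟩
    · simpa [hO] using hv
    · rw [hS, based, translate_ofCfg, sub_eq_add_neg]

theorem exists_mem (hD : B.IsCellData D r d) (hB : B.IsBoxDecomposition)
    {f : (Fin 2 → ℤ) → A} (hf : f ∈ cfgHull f₀) (k : Fin 2 → ℤ) :
    ∃ i m, cfgShift m f ∈ B.cfgs i ∧ k - m ∈ D i := by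
  have h1 : (ofCfg 0 f).translate (-center 0 k) ∈ (ofCfg s₀ f₀).hull :=
    translate_mem_hull_iff.2 (mem_hull_iff.2 hf)
  rw [← hB, mem_iUnion] at h1
  obtain ⟨i, T, hT, v, hv, h2⟩ := h1
  obtain ⟨g, hg, -, rfl⟩ := B.exists_of_mem_trans hT
  have h3 : (ofCfg 0 f).translate (-(center 0 k - v)) = based β g := by
    have := congrArg (fun T => T.translate v) h2
    simp only [translate_translate] at this
    rw [neg_add_cancel, translate_zero] at this
    rw [← this]
    congr 1
    abel
  obtain ⟨m, h4, rfl⟩ := based_eq_translate_iff.1 h3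
  refine ⟨i, m, hg, ?_⟩
  rw [hD.plaque_eq i _ hg, cfgShift_apply, zero_add] at hv
  have h5 : center (0 : Plane) k ∈ cells (0 + vec m) (D i) := by
    have : (0 : Plane) + vec m = -β (f m) + (0 + vec m + β (f m)) := by abel
    rw [this, mem_cells_add]
    convert hv using 1
    rw [← h4]
    abel
  rwa [← center_add_vec 0 m k, center_mem_cells] at h5

/-- Translating the center of the cell `k` to the origin gives a tiling interior to both boxes.
Disjointness of interiors identifies the boxes, and injectivity of the box parametrization
identifies the plaques. -/
theorem eq_of_mem (hβ : ∀ a, β a ∈ interior (square 1 0)) (hD : B.IsCellData D r d)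
    {f : (Fin 2 → ℤ) → A}
    {i j : Fin B.card} {m m' k : Fin 2 → ℤ} (hi : cfgShift m f ∈ B.cfgs i)
    (hj : cfgShift m' f ∈ B.cfgs j) (hk : k - m ∈ D i) (hk' : k - m' ∈ D j) :
    i = j ∧ m = m' := by
  have key : ∀ {i m}, cfgShift m f ∈ B.cfgs i → k - m ∈ D i →
      center 0 k - (0 + vec m + β (f m)) ∈ interior (B.plaque i) ∧
      (ofCfg 0 f).translate (-center 0 k) =
        (based β (cfgShift m f)).translate (-(center 0 k - (0 + vec m + β (f m)))) := by
    intro i m hi hk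
    constructor
    · rw [hD.plaque_eq i _ hi]
      refine interior_cell_subset hk ?_
      have : center 0 k - (0 + vec m + β (f m)) =
          center (-β (cfgShift m f 0)) (k - m) := by
        ext j
        simp only [center, Pi.sub_apply, Pi.add_apply, Pi.zero_apply, vec_apply, Pi.neg_apply,
          cfgShift_apply, zero_add, Int.cast_sub]
        ring
      rw [this]
      exact center_mem_interior
    · rw [← translate_eq_based 0 f m, translate_translate]
      congr 1
      abel
  obtain ⟨h1, h2⟩ := key hi hk
  obtain ⟨h3, h4⟩ := key hj hk'
  have hij : i = j := by
    by_contra hij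
    have hmem : (ofCfg 0 f).translate (-center 0 k) ∈ (ofCfg s₀ f₀).hull :=
      translate_mem_hull_iff.2 (mem_hull_iff.2
        (cfgShift_mem_cfgHull_iff.1 (FlowBoxFamily.mem_cfgHull hi)))
    exact disjoint_left.1 (B.disjoint_interior i j hij)
      (hD.mem_interior_box hi h1 ⟨_, hmem⟩ h2) (hD.mem_interior_box hj h3 ⟨_, hmem⟩ h4)
  subst hij
  refine ⟨rfl, ?_⟩
  have h5 := (B.isEmbedding i).injective (a₁ := (⟨_, interior_subset h1⟩, ⟨_, hi⟩))
    (a₂ := (⟨_, interior_subset h3⟩, ⟨_, hj⟩)) (h2.symm.trans h4)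
  have h6 : vec m + β (f m) = vec m' + β (f m') := by
    have := congrArg (fun z => z.1.1) h5
    simpa using this
  have h7 : β (f m) = β (f m') + vec (m' - m) := by
    ext j
    have := congrFun h6 j
    simp only [Pi.add_apply, vec_apply, Pi.sub_apply, Int.cast_sub] at this ⊢
    linarith
  exact (sub_eq_zero.1 (eq_zero_of_vec hβ h7)).symm

end FlowBoxFamily.IsCellData

end CellData

/-! ### Flow boxes from a local rule -/

section Construction

open Topology

variable {A : Type*} {β : A → Plane} {f₀ : (Fin 2 → ℤ) → A} {s₀ : Plane}

theorem AgreeOn.trans {r : ℝ} {f g h : (Fin 2 → ℤ) → A} (h₁ : AgreeOn r f g)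
    (h₂ : AgreeOn r g h) : AgreeOn r f h := fun m hm => (h₁ m hm).trans (h₂ m hm)

theorem exists_representatives [Finite A] (r : ℝ) (E : Set ((Fin 2 → ℤ) → A)) :
    ∃ (n : ℕ) (rep : Fin n → (Fin 2 → ℤ) → A), (∀ j, rep j ∈ E) ∧
      (∀ i j, AgreeOn r (rep i) (rep j) → i = j) ∧ ∀ f ∈ E, ∃ j, AgreeOn r (rep j) f := by
  have hfin : Finite {m : Fin 2 → ℤ // ‖m‖ ≤ r} := (finite_norm_le r).to_subtype
  let J := {π : {m : Fin 2 → ℤ // ‖m‖ ≤ r} → A // ∃ f ∈ E, ∀ m, f m.1 = π m}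
  obtain ⟨n, ⟨e⟩⟩ := Finite.exists_equiv_fin J
  choose rep hE hrep using fun π : J => π.2
  refine ⟨n, fun j => rep (e.symm j), fun j => hE _, fun i j hij => ?_, fun f hf => ?_⟩
  · refine e.symm.injective (Subtype.ext (funext fun m => ?_))
    rw [← hrep, ← hrep]
    exact hij m.1 m.2
  · refine ⟨e ⟨fun m => f m.1, f, hf, fun _ => rfl⟩, fun m hm => ?_⟩
    simp only [Equiv.symm_apply_apply]
    exact hrep ⟨fun m => f m.1, f, hf, fun _ => rfl⟩ ⟨m, hm⟩

theorem exists_eq_cfgShift_of_mem_interior {s v : Plane} {f g : (Fin 2 → ℤ) → A}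
    {k : Fin 2 → ℤ} {D : Set (Fin 2 → ℤ)} (h : ofCfg s f = (based β g).translate (-v))
    (hv : v ∈ cells (-β (g 0)) D) (hk : (0 : Plane) ∈ interior (square 1 (s + vec k))) :
    ∃ m, g = cfgShift m f ∧ k - m ∈ D := by
  have h1 : (ofCfg s f).translate (-(-v)) = based β g := by
    rw [h, translate_translate, neg_neg, neg_add_cancel, translate_zero]
  obtain ⟨m, h2, rfl⟩ := based_eq_translate_iff.1 h1
  refine ⟨m, rfl, ?_⟩
  rw [cfgShift_apply, zero_add] at hv
  have h3 : (0 : Plane) ∈ cells (s + vec m) D := by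
    have : s + vec m = -β (f m) + -v := by
      rw [h2]
      abel
    rw [this, mem_cells_add]
    simpa using hv
  rw [← mem_cells_of_mem_interior (s := s + vec m) (k := k - m) (x := 0)]
  · exact h3
  · rwa [add_assoc, ← vec_add, add_sub_cancel]

theorem norm_le_of_mem_cells (hβ : ∀ a, β a ∈ interior (square 1 0)) {a : A}
    {D : Set (Fin 2 → ℤ)} {d : ℝ} (hD : ∀ n ∈ D, ‖n‖ ≤ d) {v : Plane} (hv : v ∈ cells (-β a) D) :
    ‖v‖ ≤ d + 1 := by
  obtain ⟨n, hn, h⟩ := mem_cells.1 hv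
  have h0 := hD n hn
  have hd : 0 ≤ d := (norm_nonneg n).trans h0
  rw [pi_norm_le_iff_of_nonneg (by linarith)]
  intro i
  have h1 := h.1 i
  have h2 := h.2 i
  have h3 := base_bounds hβ a i
  have h4 : |(n i : ℝ)| ≤ d := by
    have := (norm_le_pi_norm n i).trans h0
    rwa [Int.norm_eq_abs] at this
  rw [abs_le] at h4
  simp only [Pi.add_apply, Pi.neg_apply, vec_apply] at h1 h2
  rw [Real.norm_eq_abs, abs_le]
  constructor <;> linarith

variable [TopologicalSpace A]

/-- The plaques with centers in `E`, where `D f` consists of the cells of the plaque centered at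
the cell `0` of `f`, are disjoint and they depend only on a bounded neighborhood of their
center. -/
structure LocalPlaques (f₀ : (Fin 2 → ℤ) → A) (E : Set ((Fin 2 → ℤ) → A))
    (D : ((Fin 2 → ℤ) → A) → Set (Fin 2 → ℤ)) (r d : ℝ) : Prop where
  congr : ∀ f ∈ cfgHull f₀, ∀ g ∈ cfgHull f₀, AgreeOn r f g → f ∈ E → g ∈ E ∧ D g = D f
  norm_le : ∀ f ∈ cfgHull f₀, f ∈ E → ∀ n ∈ D f, ‖n‖ ≤ d
  zero_mem : ∀ f ∈ cfgHull f₀, f ∈ E → 0 ∈ D f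
  disj : ∀ f ∈ cfgHull f₀, ∀ m m' k, cfgShift m f ∈ E → cfgShift m' f ∈ E →
    k - m ∈ D (cfgShift m f) → k - m' ∈ D (cfgShift m' f) → m = m'
  nonneg : 0 ≤ r
  le : d ≤ r
  nonper : ∀ f ∈ cfgHull f₀, ∀ w, ‖w‖ ≤ 2 * d + 2 → AgreeOn r f (cfgShift w f) → w = 0

variable {E : Set ((Fin 2 → ℤ) → A)} {D : ((Fin 2 → ℤ) → A) → Set (Fin 2 → ℤ)} {r d : ℝ}

variable [DiscreteTopology A]

theorem isClopen_agreeOn (r : ℝ) (f : (Fin 2 → ℤ) → A) : IsClopen {g | AgreeOn r f g} := by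
  constructor
  · have : {g | AgreeOn r f g} = ⋂ m ∈ {m : Fin 2 → ℤ | ‖m‖ ≤ r}, {g | f m = g m} := by
      ext g
      simp [AgreeOn]
    rw [this]
    exact isClosed_biInter fun m _ => isClosed_eq continuous_const (continuous_apply m)
  · exact isOpen_iff_mem_nhds.2 fun g hg =>
      Filter.mem_of_superset (agreeOn_mem_nhds r g) fun h hh => hg.trans hh

variable [Finite A]

theorem isClosed_image_based (E : Set ((Fin 2 → ℤ) → A)) (hE : IsClosed E) :
    IsClosed (based β '' E) := (hE.isCompact.image continuous_based).isClosed

/-- A tiling interior to both boxes can be moved slightly along its leaf until the origin is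
interior to a cell. This cell then belongs to a plaque of each box. -/
theorem disjoint_interior_of {Ω : Set (Tiling A)} (hΩ : Ω = (ofCfg s₀ f₀).hull)
    {P P' : Set ((Fin 2 → ℤ) → A)} {a a' : A} {D D' : Set (Fin 2 → ℤ)}
    (ha : ∀ g ∈ P, g 0 = a) (ha' : ∀ g ∈ P', g 0 = a')
    (hdis : ∀ f ∈ cfgHull f₀, ∀ m m' k, cfgShift m f ∈ P → cfgShift m' f ∈ P' → k - m ∈ D →
      k - m' ∈ D' → False) :
    Disjoint (interior {S : Ω | ∃ T ∈ based β '' P, ∃ v ∈ cells (-β a) D, S.1 = T.translate (-v)})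
      (interior {S : Ω | ∃ T ∈ based β '' P', ∃ v ∈ cells (-β a') D',
        S.1 = T.translate (-v)}) := by
  subst hΩ
  rw [disjoint_left]
  rintro ⟨S, hS⟩ h1 h2
  obtain ⟨s, f, rfl⟩ := exists_ofCfg S
  have hf := mem_hull_iff.1 hS
  let φ : Plane → (ofCfg s₀ f₀).hull := fun w =>
    ⟨(ofCfg s f).translate (-w), translate_mem_hull_iff.2 hS⟩
  have hφ : Continuous φ := by
    refine Continuous.subtype_mk ?_ _
    exact continuous_translate.comp (continuous_neg.prodMk continuous_const)
  have h0 : φ 0 = ⟨ofCfg s f, hS⟩ := Subtype.ext (by simp [φ])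
  obtain ⟨k, hk⟩ := exists_mem_cell s 0
  have hk' : (0 : Plane) ∈ closure (interior (square 1 (s + vec k))) := by
    rw [interior_square, closure_rect fun i => by simp]
    exact hk
  obtain ⟨w, ⟨hw1, hw2⟩, hw3⟩ := mem_closure_iff.1 hk' (φ ⁻¹' (interior _ ∩ interior _))
    ((isOpen_interior.inter isOpen_interior).preimage hφ)
    (by rw [mem_preimage, h0]; exact ⟨h1, h2⟩)
  obtain ⟨_, ⟨g, hg, rfl⟩, v, hv, e⟩ := interior_subset hw1
  obtain ⟨_, ⟨g', hg', rfl⟩, v', hv', e'⟩ := interior_subset hw2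
  simp only [φ, translate_ofCfg] at e e'
  have hk0 : (0 : Plane) ∈ interior (square 1 (s + -w + vec k)) := by
    rw [interior_square, mem_rect] at hw3 ⊢
    intro i
    have := hw3 i
    simp only [Pi.add_apply, Pi.neg_apply, Pi.zero_apply] at this ⊢
    constructor <;> linarith
  obtain ⟨m, rfl, hm⟩ := exists_eq_cfgShift_of_mem_interior e (by rwa [ha g hg]) hk0
  obtain ⟨m', rfl, hm'⟩ := exists_eq_cfgShift_of_mem_interior e' (by rwa [ha' g' hg']) hk0
  exact hdis f hf m m' k hg hg' hm hm'

/-- The configurations in `E` are split into finitely many classes by their windows of radius `r`,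
and each class gives one box. The condition `nonper` makes its parametrization injective,
compactness makes it an embedding, and `disj` separates the boxes. -/
theorem LocalPlaques.exists_family (hβ : ∀ a, β a ∈ interior (square 1 0))
    (h : LocalPlaques f₀ E D r d) :
    ∃ (G : FlowBoxFamily β (ofCfg s₀ f₀).hull) (D' : Fin G.card → Set (Fin 2 → ℤ)),
      G.IsCellData D' r d ∧ (∀ i, ∀ f ∈ G.cfgs i, f ∈ E ∧ D' i = D f) ∧
      (∀ f ∈ cfgHull f₀, f ∈ E → ∃ i, f ∈ G.cfgs i) ∧
      ∀ i, ∀ f ∈ G.cfgs i, ∀ g ∈ G.cfgs i, AgreeOn r f g := by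
  obtain ⟨n, rep, h1, h2, h3⟩ := exists_representatives r (cfgHull f₀ ∩ E)
  set P : Fin n → Set ((Fin 2 → ℤ) → A) := fun j => cfgHull f₀ ∩ {g | AgreeOn r (rep j) g} with hP
  have hPE : ∀ j, ∀ g ∈ P j, g ∈ E ∧ D g = D (rep j) := fun j g hg =>
    h.congr _ (h1 j).1 g hg.1 hg.2 (h1 j).2
  have hP0 : ∀ j, ∀ g ∈ P j, g 0 = rep j 0 := fun j g hg => (hg.2 0 (by simpa using h.nonneg)).symm
  have hfin : ∀ j, (D (rep j)).Finite := fun j =>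
    (finite_norm_le d).subset fun n hn => h.norm_le _ (h1 j).1 (h1 j).2 n hn
  have hPc : ∀ j, IsClosed (P j) := fun j => isClosed_closure.inter (isClopen_agreeOn r _).1
  have hnorm : ∀ j, ∀ v ∈ cells (-β (rep j 0)) (D (rep j)), ‖v‖ ≤ d + 1 := fun j v hv =>
    norm_le_of_mem_cells hβ (h.norm_le _ (h1 j).1 (h1 j).2) hv
  have hinj : ∀ j, ∀ g ∈ P j, ∀ g' ∈ P j, ∀ v ∈ cells (-β (rep j 0)) (D (rep j)),
      ∀ v' ∈ cells (-β (rep j 0)) (D (rep j)),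
      (based β g).translate (-v) = (based β g').translate (-v') → v = v' ∧ g = g' := by
    intro j g hg g' hg' v hv v' hv' he
    have e1 : (based β g).translate (-(v - v')) = based β g' := by
      have := congrArg (fun T => T.translate v') he
      simp only [translate_translate, neg_add_cancel, translate_zero] at this
      rw [← this, neg_sub, neg_add_eq_sub]
    obtain ⟨m, e2, rfl⟩ := based_eq_translate_iff.1 e1
    have e3 : g m = g 0 := by
      have := hP0 j _ hg'
      rw [cfgShift_apply, zero_add] at this
      rw [this, hP0 j g hg]
    have e4 : v - v' = vec m := by
      rw [e2, e3]
      abel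
    -- Both `v` and `v'` have norm at most `d + 1`, whence the bound `2 * d + 2` in `nonper`.
    have e5 : m = 0 := by
      refine h.nonper g hg.1 m ?_ (hg.2.symm.trans hg'.2)
      rw [← norm_vec, ← e4]
      linarith [norm_sub_le v v', hnorm j v hv, hnorm j v' hv']
    subst e5
    rw [vec_zero, sub_eq_zero] at e4
    exact ⟨e4, by simp⟩
  have hcl : ∀ j, IsClopen {T : totalTransversal β (ofCfg s₀ f₀).hull | T.1 ∈ based β '' P j} := by
    intro j
    refine ⟨(isClosed_image_based _ (hPc j)).preimage continuous_subtype_val, ?_⟩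
    rw [← isClosed_compl_iff]
    have hc : IsClosed (cfgHull f₀ ∩ {g | AgreeOn r (rep j) g}ᶜ) :=
      isClosed_closure.inter (isClopen_agreeOn r (rep j)).compl.1
    convert (isClosed_image_based (β := β) _ hc).preimage (continuous_subtype_val (p := (· ∈ totalTransversal β (ofCfg s₀ f₀).hull)))
    ext ⟨T, hT⟩
    obtain ⟨g, hg, rfl⟩ := mem_totalTransversal_iff.1 hT
    simp only [mem_compl_iff, mem_ofPred_eq, mem_preimage, (based_injective hβ).mem_set_image,
      hP, mem_inter_iff, hg, true_and]
  let G : FlowBoxFamily β (ofCfg s₀ f₀).hull :=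
    { card := n
      plaque := fun j => cells (-β (rep j 0)) (D (rep j))
      trans := fun j => based β '' P j
      trans_nonempty := fun j => ⟨_, _, ⟨(h1 j).1, fun _ _ => rfl⟩, rfl⟩
      trans_subset := by
        rintro j _ ⟨g, hg, rfl⟩
        exact mem_totalTransversal_iff.2 ⟨g, hg.1, rfl⟩
      trans_isClopen := hcl
      zero_mem := fun j => (zero_mem_cells_iff hβ).2 (h.zero_mem _ (h1 j).1 (h1 j).2)
      isPatch := by
        intro j
        refine ⟨(fun n => (-β (rep j 0) + vec n, rep j n)) '' D (rep j), (hfin j).image _, ?_, ?_⟩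
        · rw [biUnion_image]
          rfl
        · rintro _ ⟨g, hg, rfl⟩ _ ⟨n, hn, rfl⟩
          refine mem_tiles_ofCfg.2 ⟨n, ?_, ?_⟩
          · rw [hP0 j g hg]
          · exact hg.2 n ((h.norm_le _ (h1 j).1 (h1 j).2 n hn).trans h.le)
      isEmbedding := by
        intro j
        have c1 : CompactSpace (cells (-β (rep j 0)) (D (rep j))) :=
          isCompact_iff_compactSpace.1 (isCompact_cells (hfin j))
        have c2 : CompactSpace (based β '' P j) :=
          isCompact_iff_compactSpace.1 ((hPc j).isCompact.image continuous_based)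
        refine (Continuous.isClosedEmbedding ?_ ?_).isEmbedding
        · exact continuous_translate.comp
            ((continuous_subtype_val.comp continuous_fst).neg.prodMk
              (continuous_subtype_val.comp continuous_snd))
        · rintro ⟨⟨v, hv⟩, ⟨_, g, hg, rfl⟩⟩ ⟨⟨v', hv'⟩, ⟨_, g', hg', rfl⟩⟩ he
          obtain ⟨rfl, rfl⟩ := hinj j g hg g' hg' v hv v' hv' he
          rfl
      disjoint_interior := by
        intro i j hij
        refine disjoint_interior_of rfl (hP0 i) (hP0 j) fun f hf m m' k hm hm' hk hk' => hij ?_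
        rw [← (hPE i _ hm).2] at hk
        rw [← (hPE j _ hm').2] at hk'
        obtain rfl := h.disj f hf m m' k (hPE i _ hm).1 (hPE j _ hm').1 hk hk'
        exact h2 i j (hm.2.trans hm'.2.symm) }
  have hcfgs : ∀ j, G.cfgs j = P j := fun j => by
    ext g
    exact (based_injective hβ).mem_set_image
  refine ⟨G, fun j => D (rep j), ⟨fun j f hf => ?_, fun j f hf g hfg hf' hg' => ?_,
    fun j => h.norm_le _ (h1 j).1 (h1 j).2, fun j => h.zero_mem _ (h1 j).1 (h1 j).2, h.nonneg⟩,
    fun j f hf => ?_, fun f hf hfE => ?_, fun j f hf g hg => ?_⟩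
  · rw [hcfgs] at hf
    rw [hP0 j f hf]
  · rw [hcfgs] at hf ⊢
    exact ⟨hg', hf.2.trans hfg⟩
  · rw [hcfgs] at hf
    exact ⟨(hPE j f hf).1, (hPE j f hf).2.symm⟩
  · obtain ⟨j, hj⟩ := h3 f ⟨hf, hfE⟩
    exact ⟨j, by rw [hcfgs]; exact ⟨hf, hj⟩⟩
  · rw [hcfgs] at hf hg
    exact hf.2.symm.trans hg.2

theorem FlowBoxFamily.IsCellData.isBoxDecomposition
    {B : FlowBoxFamily β (ofCfg s₀ f₀).hull} {D : Fin B.card → Set (Fin 2 → ℤ)}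
    (hD : B.IsCellData D r d) (h : ∀ f ∈ cfgHull f₀, ∀ k, ∃ i m, cfgShift m f ∈ B.cfgs i ∧
      k - m ∈ D i) : B.IsBoxDecomposition := by
  refine Subset.antisymm (iUnion_subset fun i => ?_) fun S hS => ?_
  · rintro _ ⟨T, hT, v, -, rfl⟩
    exact translate_mem_hull_iff.2 (B.trans_subset i hT).1
  · obtain ⟨s, f, rfl⟩ := exists_ofCfg S
    obtain ⟨k, hk⟩ := exists_mem_cell s 0
    obtain ⟨i, m, hm, hkm⟩ := h f (mem_hull_iff.1 hS) k
    refine mem_iUnion.2 ⟨i, _, hm, -(s + vec m + β (f m)), ?_, ?_⟩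
    · rw [hD.plaque_eq i _ hm]
      refine mem_cells.2 ⟨k - m, hkm, ?_⟩
      rw [← zero_sub (s + vec m + β (f m)), ← mem_square_add (r := 1) (u := s + vec m + β (f m))]
      convert hk using 2
      rw [cfgShift_apply, zero_add, sub_eq_add_neg k, vec_add, vec_neg]
      abel
    · rw [← translate_eq_based s f m, translate_translate, neg_neg, neg_add_cancel,
        translate_zero]

end Construction

/-! ### Greedy selection of separated cells -/

section Greedy

open Topology

variable {A : Type*}

theorem exists_coloring [Finite A] (ρ : ℝ) :
    ∃ (K : ℕ) (c : ((Fin 2 → ℤ) → A) → ℕ), (∀ f, c f < K) ∧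
      ∀ f g, c f = c g ↔ AgreeOn ρ f g := by
  obtain ⟨n, rep, -, h2, h3⟩ := exists_representatives ρ (univ : Set ((Fin 2 → ℤ) → A))
  choose j hj using fun f => h3 f (mem_univ f)
  refine ⟨n, fun f => j f, fun f => (j f).2, fun f g => ⟨fun h => ?_, fun h => ?_⟩⟩
  · have := Fin.ext h
    exact (hj f).symm.trans (this ▸ hj g)
  · exact congrArg Fin.val (h2 (j f) (j g) ((hj f).trans (h.trans (hj g).symm)))

/-- The configurations whose central cell is selected among the cells with colors smaller than `n`
in the greedy construction of a family of cells at distance at least `N` from each other. -/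
def greedy (N : ℕ) (c : ((Fin 2 → ℤ) → A) → ℕ) : ℕ → Set ((Fin 2 → ℤ) → A)
  | 0 => ∅
  | n + 1 => greedy N c n ∪ {f | c f = n ∧ ∀ w, ‖w‖ < N → cfgShift w f ∉ greedy N c n}

variable {N : ℕ} {c : ((Fin 2 → ℤ) → A) → ℕ} {ρ : ℝ}

/-- Each color inspects the earlier selection at distance less than `N`, so it adds `N` to the
window that decides the selection. -/
theorem greedy_congr (hc : ∀ f g, AgreeOn ρ f g → c f = c g) (n : ℕ) :
    ∀ f g, AgreeOn (ρ + n * N) f g → (f ∈ greedy N c n ↔ g ∈ greedy N c n) := by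
  induction n with
  | zero => simp [greedy]
  | succ n ih =>
    intro f g hfg
    push_cast at hfg
    have hN : (0 : ℝ) ≤ n * N := by positivity
    have hN' : (0 : ℝ) ≤ N := by positivity
    have h1 : ∀ w : Fin 2 → ℤ, ‖w‖ < N →
        (cfgShift w f ∈ greedy N c n ↔ cfgShift w g ∈ greedy N c n) := fun w hw =>
      ih _ _ ((hfg.cfgShift w).mono (by linarith))
    refine or_congr (ih f g (hfg.mono (by linarith))) (and_congr ?_ ?_)
    · rw [hc f g (hfg.mono (by linarith))]
    · exact forall_congr' fun w => forall_congr' fun hw => not_congr (h1 w hw)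

theorem greedy_separated {Y : Set ((Fin 2 → ℤ) → A)}
    (hc : ∀ f ∈ Y, ∀ w, ‖w‖ < N → c f = c (cfgShift w f) → w = 0) (n : ℕ) :
    ∀ f ∈ Y, ∀ w, ‖w‖ < N → f ∈ greedy N c n → cfgShift w f ∈ greedy N c n → w = 0 := by
  induction n with
  | zero => simp [greedy]
  | succ n ih =>
    rintro f hf w hw (h1 | ⟨h1, h1'⟩) (h2 | ⟨h2, h2'⟩)
    · exact ih f hf w hw h1 h2
    · refine absurd ?_ (h2' (-w) (by rwa [norm_neg]))
      rwa [cfgShift_cfgShift, neg_add_cancel, cfgShift_zero]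
    · exact absurd h2 (h1' w hw)
    · exact hc f hf w hw (h1.trans h2.symm)

theorem greedy_mono {m n : ℕ} (h : m ≤ n) : greedy N c m ⊆ greedy N c n := by
  induction n, h using Nat.le_induction with
  | base => rfl
  | succ n _ ih => exact ih.trans subset_union_left

/-- When the color of the central cell is processed, either an earlier selected cell blocks it or
the cell itself is selected. -/
theorem greedy_maximal (hN : 0 < N) {K : ℕ} (hK : ∀ f, c f < K) (f : (Fin 2 → ℤ) → A) :
    ∃ w, ‖w‖ < N ∧ cfgShift w f ∈ greedy N c K := by
  by_cases h : ∃ w, ‖w‖ < N ∧ cfgShift w f ∈ greedy N c (c f)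
  · obtain ⟨w, hw, h⟩ := h
    exact ⟨w, hw, greedy_mono (hK f).le h⟩
  · push Not at h
    refine ⟨0, by simpa using hN, greedy_mono (Nat.succ_le_of_lt (hK f)) ?_⟩
    rw [cfgShift_zero]
    exact Or.inr ⟨rfl, h⟩

end Greedy

/-! ### Maximal families of squares -/

section SquareFamilies

open Topology

variable {A : Type*} {β : A → Plane} {f₀ : (Fin 2 → ℤ) → A} {s₀ : Plane}

/-- The cells of a square of side `N` whose lower left cell is the cell `0`. -/
def squareCells (N : ℕ) : Set (Fin 2 → ℤ) := {n | ∀ i, 0 ≤ n i ∧ n i < N}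

theorem norm_lt_iff {N : ℕ} (hN : 0 < N) {w : Fin 2 → ℤ} : ‖w‖ < N ↔ ∀ i, -N < w i ∧ w i < N := by
  rw [pi_norm_lt_iff (by exact_mod_cast hN)]
  refine forall_congr' fun i => ?_
  rw [Int.norm_eq_abs, abs_lt]
  exact_mod_cast Iff.rfl

theorem cells_squareCells {N : ℕ} (hN : 0 < N) (s : Plane) :
    cells s (squareCells N) = square N s := by
  ext x
  rw [mem_cells]
  constructor
  · rintro ⟨n, hn, h1, h2⟩
    refine ⟨fun i => ?_, fun i => ?_⟩
    · have h3 := h1 i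
      have h4 : (0 : ℝ) ≤ n i := by exact_mod_cast (hn i).1
      simp only [Pi.add_apply, vec_apply] at h3
      linarith
    · have h3 := h2 i
      have h4 : (n i : ℝ) + 1 ≤ N := by exact_mod_cast (hn i).2
      simp only [Pi.add_apply, vec_apply] at h3
      linarith
  · rintro ⟨h1, h2⟩
    have h3 : ∀ i, 0 ≤ ⌊x i - s i⌋ := fun i => Int.floor_nonneg.2 (by linarith [h1 i])
    refine ⟨fun i => min ⌊x i - s i⌋ (N - 1), fun i => ⟨le_min (h3 i) (by lia), by
      have := min_le_right ⌊x i - s i⌋ ((N : ℤ) - 1)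
      lia⟩, fun i => ?_, fun i => ?_⟩
    · have h4 := Int.floor_le (x i - s i)
      have h5 : ((min ⌊x i - s i⌋ ((N : ℤ) - 1) : ℤ) : ℝ) ≤ ⌊x i - s i⌋ := by
        exact_mod_cast min_le_left _ _
      simp only [Pi.add_apply, vec_apply]
      linarith
    · have h4 := Int.lt_floor_add_one (x i - s i)
      have h5 := h2 i
      simp only [Pi.add_apply, vec_apply]
      rcases min_choice ⌊x i - s i⌋ ((N : ℤ) - 1) with e | e
      · rw [e]
        linarith
      · rw [e]
        push_cast
        linarith

theorem square_injective {r : ℝ} (hr : 0 ≤ r) {p q : Plane} (h : square r p = square r q) :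
    p = q := by
  have h1 : p ∈ square r q := h ▸ ⟨le_rfl, fun i => by simpa⟩
  have h2 : q ∈ square r p := h ▸ ⟨le_rfl, fun i => by simpa⟩
  exact le_antisymm h2.1 h1.1

/-- The lower left corners of the squares in the tiling with marks `f`. -/
def cornerSet (E : Set ((Fin 2 → ℤ) → A)) (s : Plane) (f : (Fin 2 → ℤ) → A) : Set Plane :=
  {p | ∃ m, cfgShift m f ∈ E ∧ p = s + vec m}

theorem squarePacking_cornerSet {E : Set ((Fin 2 → ℤ) → A)} {N : ℕ} (hN : 0 < N)
    {f : (Fin 2 → ℤ) → A} (h1 : ∀ m w, ‖w‖ < N → cfgShift m f ∈ E → cfgShift (w + m) f ∈ E → w = 0)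
    (h2 : ∀ m, ∃ w, ‖w‖ < N ∧ cfgShift (w + m) f ∈ E) (s : Plane) :
    SquarePacking (cornerSet E s f) N where
  pos := by exact_mod_cast hN
  disj := by
    rintro _ ⟨m, hm, rfl⟩ _ ⟨m', hm', rfl⟩ hne
    by_contra! hcon
    refine hne ?_
    have h3 : m' - m = 0 := by
      refine h1 m (m' - m) ((norm_lt_iff hN).2 ?_) hm (by rwa [sub_add_cancel])
      rw [Fin.forall_fin_two]
      simp only [Pi.add_apply, vec_apply] at hcon
      obtain ⟨c1, c2, c3, c4⟩ := hcon
      have c1' : (m' 0 : ℝ) < m 0 + N := by linarith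
      have c2' : (m 0 : ℝ) < m' 0 + N := by linarith
      have c3' : (m' 1 : ℝ) < m 1 + N := by linarith
      have c4' : (m 1 : ℝ) < m' 1 + N := by linarith
      norm_cast at c1' c2' c3' c4'
      simp only [Pi.sub_apply]
      lia
    rw [sub_eq_zero.1 h3]
  maxl u v := by
    set x : Plane := ![u, v] with hx
    obtain ⟨w, hw, hE⟩ := h2 fun i => ⌊x i - s i⌋
    rw [norm_lt_iff hN] at hw
    have key : ∀ i, (s + vec (w + fun i => ⌊x i - s i⌋)) i < x i + N ∧
        x i < (s + vec (w + fun i => ⌊x i - s i⌋)) i + N := by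
      intro i
      have h3 := Int.floor_le (x i - s i)
      have h4 := Int.lt_floor_add_one (x i - s i)
      -- The strict integer bounds on `w i` gain one unit, which absorbs the fractional part of the
      -- position of the test square.
      have h5 : (w i : ℝ) + 1 ≤ N := by exact_mod_cast (hw i).2
      have h6 : -(N : ℝ) + 1 ≤ w i := by exact_mod_cast (hw i).1
      simp only [Pi.add_apply, vec_apply, Int.cast_add]
      constructor <;> linarith
    exact ⟨_, ⟨_, hE, rfl⟩, (key 0).1, (key 0).2, (key 1).1, (key 1).2⟩
  fin u v R := by
    refine ((finite_norm_le (R + |u| + |v| + ‖s‖)).image (fun m => s + vec m)).subset ?_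
    rintro _ ⟨⟨m, -, rfl⟩, h3, h4⟩
    refine ⟨m, ?_, rfl⟩
    have hR : 0 ≤ R := (abs_nonneg _).trans h3
    change ‖m‖ ≤ _
    rw [← norm_vec, pi_norm_le_iff_of_nonneg (by positivity)]
    have s0 := norm_le_pi_norm s 0
    have s1 := norm_le_pi_norm s 1
    rw [Real.norm_eq_abs] at s0 s1
    simp only [Pi.add_apply, vec_apply] at h3 h4
    have u0 := abs_nonneg u
    have v0 := abs_nonneg v
    rw [abs_le] at h3 h4 s0 s1
    have u1 := le_abs_self u
    have u2 := neg_abs_le u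
    have v1 := le_abs_self v
    have v2 := neg_abs_le v
    simp only [Fin.forall_fin_two, Real.norm_eq_abs, abs_le, vec_apply]
    refine ⟨⟨?_, ?_⟩, ?_, ?_⟩ <;> linarith

theorem SquarePacking.isMaximalFamily {V : Set Plane} {N : ℝ} (h : SquarePacking V N) :
    IsMaximalFamily V N := by
  intro q
  obtain ⟨p, hp, h1, h2, h3, h4⟩ := h.maxl (q 0) (q 1)
  refine ⟨p, hp, fun i => (p i + q i + N) / 2, ?_, ?_⟩ <;>
  · rw [interior_square, mem_rect, Fin.forall_fin_two]
    refine ⟨⟨?_, ?_⟩, ?_, ?_⟩ <;> linarith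

variable [TopologicalSpace A] [DiscreteTopology A] [Finite A]

/-- Coloring cells by a window that detects all translations of size at most `N` gives different
colors to cells at that distance. The greedy selection is then separated and maximal by a local
rule. The larger radius in `hloc` also accommodates `d ≤ r` and translations up to `2 * N + 2`. -/
theorem exists_square_family (hβ : ∀ a, β a ∈ interior (square 1 0))
    (hper : ∀ D : ℝ, ∃ r : ℝ, ∀ f ∈ cfgHull f₀, ∀ w, ‖w‖ ≤ D → AgreeOn r f (cfgShift w f) → w = 0)
    {N : ℕ} (hN : 0 < N) :
    ∃ (F : FlowBoxFamily β (ofCfg s₀ f₀).hull) (E : Set ((Fin 2 → ℤ) → A)) (r : ℝ),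
      F.IsMaximalSquareFamily N ∧ 0 ≤ r ∧ (∀ f g, AgreeOn r f g → (f ∈ E ↔ g ∈ E)) ∧
      ∀ s, ∀ f ∈ cfgHull f₀, F.corners N (ofCfg s f) = cornerSet E s f ∧
        SquarePacking (cornerSet E s f) N := by
  obtain ⟨ρ₀, hρ₀⟩ := hper N
  set ρ := max ρ₀ 0 with hρ
  have hρ0 : 0 ≤ ρ := le_max_right _ _
  obtain ⟨K, c, hK, hc⟩ := exists_coloring (A := A) ρ
  set E := greedy N c K with hE
  have hcong : ∀ f g, AgreeOn (ρ + K * N) f g → (f ∈ E ↔ g ∈ E) :=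
    greedy_congr (fun f g h => (hc f g).2 h) K
  have hsep : ∀ f ∈ cfgHull f₀, ∀ w, ‖w‖ < N → f ∈ E → cfgShift w f ∈ E → w = 0 :=
    greedy_separated (fun f hf w hw h => hρ₀ f hf w hw.le
      (((hc _ _).1 h).mono (le_max_left _ _))) K
  have hmax : ∀ f, ∃ w, ‖w‖ < N ∧ cfgShift w f ∈ E := greedy_maximal hN hK
  obtain ⟨ρ₁, hρ₁⟩ := hper (2 * N + 2)
  have hKN : (0 : ℝ) ≤ K * N := by positivity
  have hN0 : (0 : ℝ) ≤ N := by positivity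
  have hloc : LocalPlaques f₀ E (fun _ => squareCells N) (ρ + K * N + N + max ρ₁ 0) N := by
    have m1 := le_max_left ρ₁ 0
    have m2 := le_max_right ρ₁ 0
    refine ⟨fun f _ g _ hfg hf => ⟨(hcong f g (hfg.mono (by linarith))).1 hf, rfl⟩, ?_, ?_, ?_,
      by linarith, by linarith, fun f hf w hw hag => hρ₁ f hf w hw (hag.mono (by linarith))⟩
    · rintro f - - n hn
      refine ((norm_lt_iff hN).2 fun i => ?_).le
      have := hn i
      lia
    · intro f _ _ i
      simpa using hN
    · intro f hf m m' k hm hm' hk hk'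
      have h3 : m' - m = 0 := by
        refine hsep _ (cfgShift_mem_cfgHull hf m) (m' - m) ((norm_lt_iff hN).2 fun i => ?_) hm
          (by rwa [cfgShift_cfgShift, sub_add_cancel])
        have a1 := hk i
        have a2 := hk' i
        simp only [Pi.sub_apply] at a1 a2 ⊢
        lia
      exact (sub_eq_zero.1 h3).symm
  obtain ⟨F, D', hD, hF1, hF2, -⟩ := hloc.exists_family (s₀ := s₀) hβ
  have hcor : ∀ s, ∀ f ∈ cfgHull f₀, F.corners N (ofCfg s f) = cornerSet E s f := by
    intro s f hf
    ext p
    simp only [FlowBoxFamily.corners, cornerSet, mem_ofPred_eq, hD.mem_plaquesOn]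
    constructor
    · rintro ⟨i, m, hm, h⟩
      rw [(hF1 i _ hm).2, cells_squareCells hN] at h
      exact ⟨m, (hF1 i _ hm).1, square_injective hN0 h⟩
    · rintro ⟨m, hm, rfl⟩
      obtain ⟨i, hi⟩ := hF2 _ (cfgShift_mem_cfgHull hf m) hm
      refine ⟨i, m, hi, ?_⟩
      rw [(hF1 i _ hi).2, cells_squareCells hN]
  have hpack : ∀ s, ∀ f ∈ cfgHull f₀, SquarePacking (cornerSet E s f) N := fun s f hf =>
    squarePacking_cornerSet hN
      (fun m w hw h1 h2 => hsep _ (cfgShift_mem_cfgHull hf m) w hw h1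
        (by rwa [cfgShift_cfgShift]))
      (fun m => by
        obtain ⟨w, hw, h⟩ := hmax (cfgShift m f)
        exact ⟨w, hw, by rwa [cfgShift_cfgShift] at h⟩) s
  refine ⟨F, E, ρ + K * N, ⟨fun i => ?_, fun T hT => ?_⟩, by linarith, hcong,
    fun s f hf => ⟨hcor s f hf, hpack s f hf⟩⟩
  · obtain ⟨T, hT⟩ := F.trans_nonempty i
    obtain ⟨f, hf, -, rfl⟩ := F.exists_of_mem_trans hT
    refine ⟨-β (f 0), ?_⟩
    rw [hD.plaque_eq i f hf, (hF1 i f hf).2, cells_squareCells hN]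
  · obtain ⟨s, f, rfl⟩ := exists_ofCfg T
    have hf := mem_hull_iff.1 hT
    rw [hcor s f hf]
    exact (hpack s f hf).isMaximalFamily

end SquareFamilies

/-! ### Assigning tiles to squares by priority -/

section Qualification

variable {V : Set Plane} {N : ℝ} {t : Set Plane} {p q u : Plane}

/-- The tile `t` is a part of the inflated tile of the square at `p`. -/
def Qualifies (V : Set Plane) (N : ℝ) (t : Set Plane) (p : Plane) : Prop :=
  (interior t ∩ enlarged V N p).Nonempty ∧
    ∀ q ∈ V, (interior t ∩ enlarged V N q).Nonempty → RightUp q p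

theorem rightUp_iff : RightUp p q ↔
    toLex (p 0 + p 1, p 0) ≤ toLex (q 0 + q 1, q 0) := by
  rw [Prod.Lex.toLex_le_toLex]
  rfl

theorem RightUp.antisymm (h : RightUp p q) (h' : RightUp q p) : p = q := by
  have := le_antisymm (rightUp_iff.1 h) (rightUp_iff.1 h')
  simp only [toLex_inj, Prod.mk.injEq] at this
  ext i
  fin_cases i
  · exact this.2
  · change p 1 = q 1
    linarith [this.1, this.2]

theorem Qualifies.unique (hp : Qualifies V N t p) (hq : Qualifies V N t q) (hpV : p ∈ V)
    (hqV : q ∈ V) : p = q :=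
  (hq.2 p hpV hp.1).antisymm (hp.2 q hqV hq.1)

theorem SquarePacking.finite_near_of_bounded (h : SquarePacking V N) (R : ℝ) :
    {q | q ∈ V ∧ ‖q‖ ≤ R}.Finite := by
  refine (h.fin 0 0 R).subset ?_
  rintro q ⟨hq, hR⟩
  refine ⟨hq, ?_, ?_⟩
  · simpa using (norm_le_pi_norm q 0).trans hR
  · simpa using (norm_le_pi_norm q 1).trans hR

/-- Some enlarged square meets the interior of `t` by density. Only finitely many do, since they
stay within `3 * N` of their squares, and the priority is a lexicographic order. -/
theorem SquarePacking.exists_qualifies (h : SquarePacking V N) (ht : (interior t).Nonempty)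
    (hb : Bornology.IsBounded t) : ∃ p ∈ V, Qualifies V N t p := by
  obtain ⟨R, hR⟩ := hb.subset_closedBall 0
  have hfin : {q | q ∈ V ∧ (interior t ∩ enlarged V N q).Nonempty}.Finite := by
    refine (h.finite_near_of_bounded (R + 3 * N)).subset ?_
    rintro q ⟨hq, x, hx, hxq⟩
    refine ⟨hq, ?_⟩
    have h1 := mem_closedBall_zero_iff.1 (hR (interior_subset hx))
    have h2 := h.dist_le_of_mem_enlarged hxq
    rw [dist_eq_norm] at h2
    linarith [norm_sub_norm_le q x, norm_sub_rev q x]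
  obtain ⟨p, ⟨hp, hp'⟩, hmax⟩ := exists_max_image _ (fun q : Plane => toLex (q 0 + q 1, q 0)) hfin
    (h.exists_enlarged_inter isOpen_interior ht)
  exact ⟨p, hp, hp', fun q hq hq' => rightUp_iff.2 (hmax q ⟨hq, hq'⟩)⟩

/-- The other enlarged squares avoid the interior of the square at `p`, so there is no competitor.
-/
theorem SquarePacking.qualifies_of_subset (h : SquarePacking V N) (ht : (interior t).Nonempty)
    (hp : p ∈ V) (hsub : t ⊆ interior (square N p)) : Qualifies V N t p := by
  obtain ⟨x, hx⟩ := ht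
  refine ⟨⟨x, hx, Or.inl (interior_subset (hsub (interior_subset hx)))⟩, ?_⟩
  rintro q hq ⟨y, hy, hyq⟩
  by_cases hqp : q = p
  · rw [hqp]
    exact Or.inr ⟨rfl, le_rfl⟩
  · exact absurd (hsub (interior_subset hy)) (disjoint_left.1 (h.enlarged_disjoint hq hp hqp) hyq)

theorem shift_interior {S : Set Plane} : shift u (interior S) = interior (shift u S) :=
  (Homeomorph.addRight u).preimage_interior S

theorem rightUp_add : RightUp (p + u) (q + u) ↔ RightUp p q := by
  simp only [RightUp, Pi.add_apply]
  grind

theorem qualifies_shift (h : SquarePacking V N) :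
    Qualifies (shift u V) N (shift u t) p ↔ Qualifies V N t (p + u) := by
  have key : ∀ q, (interior (shift u t) ∩ enlarged (shift u V) N q).Nonempty ↔
      (interior t ∩ enlarged V N (q + u)).Nonempty := by
    intro q
    rw [enlarged_shift h, ← shift_interior]
    constructor
    · rintro ⟨x, hx⟩
      exact ⟨x + u, hx⟩
    · rintro ⟨x, hx⟩
      exact ⟨x - u, by simpa [mem_shift] using hx⟩
  refine and_congr (key p) ⟨fun H q hq hq' => ?_, fun H q hq hq' => ?_⟩
  · have := H (q - u) (by simpa [mem_shift]) ((key _).2 (by simpa))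
    rwa [← rightUp_add (u := u), sub_add_cancel] at this
  · exact rightUp_add.1 (H (q + u) hq ((key q).1 hq'))

/-- A competitor meets `t`, so it is within `8 * N + 3 * N` of `p`, and determining its enlarged
square requires `11 * N` more. -/
theorem Agree.qualifies {V' : Set Plane} (hV : SquarePacking V N) (hV' : SquarePacking V' N)
    (hb : ∀ x ∈ t, ‖x - p‖ ≤ 8 * N)
    (h : Agree V V' p (22 * N)) (hp : Qualifies V N t p) : Qualifies V' N t p := by
  have hN := hV.pos
  refine ⟨?_, ?_⟩
  · rw [← h.enlarged_eq hV hV' (by linarith)]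
    exact hp.1
  · rintro q hq ⟨x, hx, hxq⟩
    have h1 := hb x (interior_subset hx)
    have h2 := hV'.dist_le_of_mem_enlarged hxq
    have h3 : dist q p ≤ 11 * N := by
      rw [← dist_eq_norm] at h1
      linarith [dist_triangle_left q p x]
    have h4 : Agree V V' q (11 * N) := fun z hz => h z (by linarith [dist_triangle z q p])
    refine hp.2 q ((h q (by linarith)).2 hq) ⟨x, hx, ?_⟩
    rwa [h4.enlarged_eq hV hV' le_rfl]

end Qualification

/-! ### Cells of the inflated tiles -/

section InflatedCells

variable {A : Type*} {β : A → Plane} {f₀ : (Fin 2 → ℤ) → A} {s₀ s : Plane}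

theorem shift_cells {u : Plane} {D : Set (Fin 2 → ℤ)} : shift u (cells (s + u) D) = cells s D := by
  ext x
  rw [mem_shift, mem_cells_add, add_sub_cancel_right]

theorem shift_cornerSet {E : Set ((Fin 2 → ℤ) → A)} {u : Plane} {f : (Fin 2 → ℤ) → A} :
    shift u (cornerSet E (s + u) f) = cornerSet E s f := by
  ext x
  simp only [mem_shift, cornerSet, mem_ofPred_eq, add_right_comm s u, add_left_inj]

theorem cornerSet_add_vec {E : Set ((Fin 2 → ℤ) → A)} {f : (Fin 2 → ℤ) → A} (k : Fin 2 → ℤ) :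
    cornerSet E (s + vec k) (cfgShift k f) = cornerSet E s f := by
  ext x
  simp only [cornerSet, mem_ofPred_eq, cfgShift_cfgShift]
  constructor
  · rintro ⟨m, hm, rfl⟩
    exact ⟨_, hm, by rw [vec_add]; abel⟩
  · rintro ⟨m, hm, rfl⟩
    exact ⟨m - k, by rwa [sub_add_cancel], by rw [add_assoc, ← vec_add, add_sub_cancel]⟩

theorem norm_sub_le_of_mem_cells {D : Set (Fin 2 → ℤ)} {d : ℝ} (hD : ∀ n ∈ D, ‖n‖ ≤ d) {x : Plane}
    (hx : x ∈ cells s D) : ‖x - s‖ ≤ d + 1 := by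
  obtain ⟨n, hn, h⟩ := mem_cells.1 hx
  have h0 := hD n hn
  have h1 : ‖x - (s + vec n)‖ ≤ 1 := by
    rw [pi_norm_le_iff_of_nonneg zero_le_one]
    intro i
    have h2 := h.1 i
    have h3 := h.2 i
    rw [Pi.sub_apply, Real.norm_eq_abs, abs_le]
    constructor <;> linarith
  calc ‖x - s‖ = ‖(x - (s + vec n)) + vec n‖ := by congr 1; abel
    _ ≤ _ := norm_add_le _ _
    _ ≤ d + 1 := by rw [norm_vec]; linarith

/-- The cells of the inflated tile of the square whose lower left cell is the cell `0` of `f`. -/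
def FlowBoxFamily.inflatedCells {Ω : Set (Tiling A)} (B : FlowBoxFamily β Ω)
    (D : Fin B.card → Set (Fin 2 → ℤ)) (E : Set ((Fin 2 → ℤ) → A)) (N : ℝ)
    (f : (Fin 2 → ℤ) → A) : Set (Fin 2 → ℤ) :=
  {n | ∃ i m, cfgShift m f ∈ B.cfgs i ∧ n - m ∈ D i ∧
    Qualifies (cornerSet E 0 f) N (cells (vec m) (D i)) 0}

variable {B : FlowBoxFamily β (ofCfg s₀ f₀).hull} {D : Fin B.card → Set (Fin 2 → ℤ)} {r d : ℝ}
  {E : Set ((Fin 2 → ℤ) → A)} {N : ℝ} {f : (Fin 2 → ℤ) → A}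

theorem mem_inflatedCells_cfgShift (hV : SquarePacking (cornerSet E s f) N) {n k : Fin 2 → ℤ} :
    n - k ∈ B.inflatedCells D E N (cfgShift k f) ↔
      ∃ i m, cfgShift m f ∈ B.cfgs i ∧ n - m ∈ D i ∧
        Qualifies (cornerSet E s f) N (cells (s + vec m) (D i)) (s + vec k) := by
  have h1 : cornerSet E 0 (cfgShift k f) = shift (s + vec k) (cornerSet E s f) := by
    rw [← cornerSet_add_vec (s := s) k, ← shift_cornerSet (u := s + vec k), zero_add]
  have key : ∀ i m, Qualifies (cornerSet E 0 (cfgShift k f)) N (cells (vec (m - k)) (D i)) 0 ↔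
      Qualifies (cornerSet E s f) N (cells (s + vec m) (D i)) (s + vec k) := by
    intro i m
    have h2 : cells (vec (m - k)) (D i) = shift (s + vec k) (cells (s + vec m) (D i)) := by
      rw [← shift_cells (u := s + vec k)]
      congr 2
      rw [add_left_comm, ← vec_add, sub_add_cancel]
    rw [h1, h2, qualifies_shift hV, zero_add]
  constructor
  · rintro ⟨i, m, h2, h3, h4⟩
    refine ⟨i, m + k, by rwa [← cfgShift_cfgShift], by convert h3 using 1; abel, ?_⟩
    rwa [← key, add_sub_cancel_right]
  · rintro ⟨i, m, h2, h3, h4⟩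
    exact ⟨i, m - k, by rwa [cfgShift_cfgShift, sub_add_cancel], by rwa [sub_sub_sub_cancel_right],
      (key i m).2 h4⟩

end InflatedCells

/-! ### The inflated tiles follow a local rule -/

section LocalInflation

variable {A : Type*} {β : A → Plane} {f₀ : (Fin 2 → ℤ) → A} {s₀ s : Plane}

/-- The leaf of each configuration carries a maximal packing by squares of side `N`, depending only
on the cells at distance at most `r`. -/
structure IsSquareData [TopologicalSpace A] (f₀ : (Fin 2 → ℤ) → A) (E : Set ((Fin 2 → ℤ) → A))
    (N r : ℝ) : Prop where
  nonneg : 0 ≤ r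
  congr : ∀ f g, AgreeOn r f g → (f ∈ E ↔ g ∈ E)
  packing : ∀ s, ∀ f ∈ cfgHull f₀, SquarePacking (cornerSet E s f) N

theorem vec_mem_cornerSet {E : Set ((Fin 2 → ℤ) → A)} {f : (Fin 2 → ℤ) → A} {k : Fin 2 → ℤ} :
    s + vec k ∈ cornerSet E s f ↔ cfgShift k f ∈ E := by
  constructor
  · rintro ⟨m, hm, h⟩
    rwa [vec_injective (add_left_cancel h)]
  · exact fun h => ⟨k, h, rfl⟩

variable [TopologicalSpace A]
  {B : FlowBoxFamily β (ofCfg s₀ f₀).hull} {D : Fin B.card → Set (Fin 2 → ℤ)} {r d : ℝ}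
  {E : Set ((Fin 2 → ℤ) → A)} {N r' : ℝ} {f g : (Fin 2 → ℤ) → A}

theorem IsSquareData.agree (hE : IsSquareData f₀ E N r') {R : ℝ} (h : AgreeOn (R + r') f g) :
    Agree (cornerSet E 0 f) (cornerSet E 0 g) 0 R := by
  have key : ∀ {f g}, AgreeOn (R + r') f g → ∀ q, dist q 0 ≤ R → q ∈ cornerSet E 0 f →
      q ∈ cornerSet E 0 g := by
    rintro f g h _ hq ⟨m, hm, rfl⟩
    rw [zero_add, dist_zero_right, norm_vec] at hq
    exact ⟨m, (hE.congr _ _ ((h.cfgShift m).mono (by linarith))).1 hm, rfl⟩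
  exact fun q hq => ⟨key h q hq, key h.symm q hq⟩

theorem interior_cells_nonempty {D : Set (Fin 2 → ℤ)} {k : Fin 2 → ℤ} (hk : k ∈ D) :
    (interior (cells s D)).Nonempty := ⟨_, interior_cell_subset hk center_mem_interior⟩

theorem isBounded_cells {D : Set (Fin 2 → ℤ)} (hD : ∀ n ∈ D, ‖n‖ ≤ d) :
    Bornology.IsBounded (cells s D) :=
  Metric.isBounded_closedBall.subset fun _ hx => by
    rw [Metric.mem_closedBall, dist_eq_norm]
    exact norm_sub_le_of_mem_cells hD hx

namespace FlowBoxFamily.IsCellData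

theorem norm_le_of_qualifies (hD : B.IsCellData D r d) {V : Set Plane} (hV : SquarePacking V N)
    {i : Fin B.card} {m : Fin 2 → ℤ} (h : Qualifies V N (cells (vec m) (D i)) 0) :
    ‖m‖ ≤ 3 * N + d + 1 := by
  obtain ⟨⟨x, hx, hx'⟩, -⟩ := h
  have h1 := norm_sub_le_of_mem_cells (hD.norm_le i) (interior_subset hx)
  have h2 := hV.dist_le_of_mem_enlarged hx'
  rw [dist_zero_right] at h2
  rw [← norm_vec]
  linarith [norm_sub_norm_le (vec m) x, norm_sub_rev (vec m) x]

theorem norm_le_of_mem_inflatedCells (hD : B.IsCellData D r d) (hE : IsSquareData f₀ E N r')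
    (hf : f ∈ cfgHull f₀) {n : Fin 2 → ℤ} (hn : n ∈ B.inflatedCells D E N f) :
    ‖n‖ ≤ 3 * N + 2 * d + 1 := by
  obtain ⟨i, m, -, h2, h3⟩ := hn
  have h4 := hD.norm_le_of_qualifies (hE.packing 0 f hf) h3
  have h5 := hD.norm_le i _ h2
  linarith [norm_sub_norm_le n m]

/-- A qualifying plaque stays within `3 * N + 2 * d + 2 ≤ 4 * N` of the square's corner. A window of
`22 * N` therefore settles the priority, and the terms `r` and `r'` serve to recognize the plaques
and the squares. -/
theorem inflatedCells_subset (hD : B.IsCellData D r d) (hE : IsSquareData f₀ E N r')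
    (hN : 2 * d + 2 ≤ N) (hf : f ∈ cfgHull f₀) (hg : g ∈ cfgHull f₀)
    (h : AgreeOn (22 * N + r + r') f g) : B.inflatedCells D E N f ⊆ B.inflatedCells D E N g := by
  rintro n ⟨i, m, h1, h2, h3⟩
  have hV := hE.packing 0 f hf
  have hN0 := hV.pos
  have hr := hD.nonneg
  have h4 := hD.norm_le_of_qualifies hV h3
  refine ⟨i, m, hD.mem_cfgs i _ h1 _ ((h.cfgShift m).mono ?_) (cfgShift_mem_cfgHull hf m)
    (cfgShift_mem_cfgHull hg m), h2, ?_⟩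
  · linarith [hE.nonneg]
  · refine Agree.qualifies hV (hE.packing 0 g hg) (fun x hx => ?_)
      (hE.agree (h.mono (by linarith))) h3
    have h5 := norm_sub_le_of_mem_cells (hD.norm_le i) hx
    rw [sub_zero]
    rw [← norm_vec] at h4
    linarith [norm_sub_norm_le x (vec m)]

variable [DiscreteTopology A] [Finite A]

/-- A cell determines its plaque of `B`, and this plaque qualifies for only one square. -/
theorem eq_of_mem_inflatedCells (hβ : ∀ a, β a ∈ interior (square 1 0)) (hD : B.IsCellData D r d)
    (hE : IsSquareData f₀ E N r') (hf : f ∈ cfgHull f₀) {n k k' : Fin 2 → ℤ}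
    (hk : cfgShift k f ∈ E) (hk' : cfgShift k' f ∈ E)
    (h : n - k ∈ B.inflatedCells D E N (cfgShift k f))
    (h' : n - k' ∈ B.inflatedCells D E N (cfgShift k' f)) : k = k' := by
  have hV := hE.packing 0 f hf
  obtain ⟨i, m, h1, h2, h3⟩ := (mem_inflatedCells_cfgShift hV).1 h
  obtain ⟨i', m', h1', h2', h3'⟩ := (mem_inflatedCells_cfgShift hV).1 h'
  obtain ⟨rfl, rfl⟩ := hD.eq_of_mem hβ h1 h1' h2 h2'
  exact vec_injective (add_left_cancel
    (h3.unique h3' (vec_mem_cornerSet.2 hk) (vec_mem_cornerSet.2 hk')))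

theorem exists_mem_inflatedCells (hD : B.IsCellData D r d) (hB : B.IsBoxDecomposition)
    (hE : IsSquareData f₀ E N r') (hf : f ∈ cfgHull f₀) (n : Fin 2 → ℤ) :
    ∃ k, cfgShift k f ∈ E ∧ n - k ∈ B.inflatedCells D E N (cfgShift k f) := by
  have hV := hE.packing 0 f hf
  obtain ⟨i, m, h1, h2⟩ := hD.exists_mem hB hf n
  obtain ⟨_, ⟨k, hk, rfl⟩, hq⟩ := hV.exists_qualifies
    (interior_cells_nonempty (s := 0 + vec m) h2) (isBounded_cells (hD.norm_le i))
  exact ⟨k, hk, (mem_inflatedCells_cfgShift hV).2 ⟨i, m, h1, h2, hq⟩⟩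

/-- The plaque of `B` through a cell at distance at most `e` reaches no further than `e + 2 * d +
1`, hence stays inside the square and belongs to its tile. -/
theorem mem_inflatedCells_of_norm_le (hD : B.IsCellData D r d) (hB : B.IsBoxDecomposition)
    (hE : IsSquareData f₀ E N r') (hf : f ∈ cfgHull f₀) {c n : Fin 2 → ℤ} {e : ℝ}
    (hc : cfgShift c f ∈ E) (h : ∀ i, c i + (e + 2 * d + 1) < 0 ∧ e + 2 * d + 1 < c i + N)
    (hn : ‖n‖ ≤ e) : n - c ∈ B.inflatedCells D E N (cfgShift c f) := by
  have hV := hE.packing 0 f hf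
  obtain ⟨i, m, h1, h2⟩ := hD.exists_mem hB hf n
  refine (mem_inflatedCells_cfgShift hV).2 ⟨i, m, h1, h2, hV.qualifies_of_subset
    (interior_cells_nonempty h2) (vec_mem_cornerSet.2 hc) fun x hx => ?_⟩
  rw [interior_square, mem_rect]
  intro j
  have h3 := norm_sub_le_of_mem_cells (hD.norm_le i) hx
  rw [zero_add] at h3
  have h4 := hD.norm_le i _ h2
  have h5 : ‖x‖ ≤ e + 2 * d + 1 := by
    have h6 := norm_vec m
    linarith [norm_sub_norm_le x (vec m), norm_sub_norm_le m n, norm_sub_rev m n]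
  have h7 := (norm_le_pi_norm x j).trans h5
  rw [Real.norm_eq_abs, abs_le] at h7
  have h8 := h j
  simp only [Pi.add_apply, Pi.zero_apply, vec_apply]
  constructor <;> linarith

theorem cells_inflatedCells (hD : B.IsCellData D r d) (hV : SquarePacking (cornerSet E s f) N)
    (k : Fin 2 → ℤ) : cells (s + vec k) (B.inflatedCells D E N (cfgShift k f)) =
      inflatedTile (B.plaquesOn (ofCfg s f)) (cornerSet E s f) N (s + vec k) := by
  ext x
  have h1 : x ∈ inflatedTile (B.plaquesOn (ofCfg s f)) (cornerSet E s f) N (s + vec k) ↔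
      ∃ t ∈ B.plaquesOn (ofCfg s f), Qualifies (cornerSet E s f) N t (s + vec k) ∧ x ∈ t := by
    simp only [inflatedTile, mem_iUnion, mem_ofPred_eq, exists_prop, and_assoc, Qualifies]
  rw [h1, mem_cells]
  constructor
  · rintro ⟨n, hn, hx⟩
    rw [← add_sub_cancel_right n k, mem_inflatedCells_cfgShift hV] at hn
    obtain ⟨i, m, h2, h3, h4⟩ := hn
    refine ⟨_, hD.mem_plaquesOn.2 ⟨i, m, h2, rfl⟩, h4, mem_cells.2 ⟨_, h3, ?_⟩⟩
    convert hx using 2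
    rw [add_assoc, add_assoc, ← vec_add, ← vec_add]
    congr 2
    abel
  · rintro ⟨t, ht, h4, hx⟩
    obtain ⟨i, m, h2, rfl⟩ := hD.mem_plaquesOn.1 ht
    obtain ⟨n, hn, hx⟩ := mem_cells.1 hx
    refine ⟨n + m - k, (mem_inflatedCells_cfgShift hV).2 ⟨i, m, h2, ?_, h4⟩, ?_⟩
    · rwa [add_sub_cancel_right]
    · convert hx using 2
      rw [add_assoc, add_assoc, ← vec_add, ← vec_add]
      congr 2
      abel

end FlowBoxFamily.IsCellData

end LocalInflation

/-! ### One step of Robinson inflation -/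

section InflationStep

variable {A : Type*} {β : A → Plane} {f₀ : (Fin 2 → ℤ) → A} {s₀ s : Plane}

theorem FlowBoxFamily.translate_mem_verticalBoundary {Ω : Set (Tiling A)} (B : FlowBoxFamily β Ω)
    {T : Tiling A} {Q : Set Plane} (hQ : Q ∈ B.plaquesOn T) {v : Plane} (hv : v ∈ Q)
    (hv' : v ∉ interior Q) : ∃ i, T.translate (-v) ∈ B.verticalBoundary i := by
  obtain ⟨i, u, hu, rfl⟩ := hQ
  obtain ⟨x, hx, rfl⟩ := hv
  refine ⟨i, _, hu, x, ⟨subset_closure hx, fun h => hv' ?_⟩, ?_⟩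
  · have : IsOpenMap fun x : Plane => u + x := isOpenMap_add_left u
    exact this.image_interior_subset _ ⟨x, h, rfl⟩
  · rw [translate_translate, neg_add]

variable [TopologicalSpace A] [DiscreteTopology A] [Finite A]
  {B B' : FlowBoxFamily β (ofCfg s₀ f₀).hull} {D : Fin B.card → Set (Fin 2 → ℤ)}
  {D' : Fin B'.card → Set (Fin 2 → ℤ)} {r d r' d' : ℝ}

/-- The centers of the two plaques differ by an integer vector of norm at most `d + d' + 4`. All
tilings in the new transversal share a window of radius `r'`, which is large enough to contain the
window of radius `r` around the old center. -/
theorem transversalAt_subset (hβ : ∀ a, β a ∈ interior (square 1 0)) (hD : B.IsCellData D r d)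
    (hD' : B'.IsCellData D' r' d')
    (hag : ∀ i, ∀ f ∈ B'.cfgs i, ∀ g ∈ B'.cfgs i, AgreeOn r' f g) (hr : r + d + d' + 4 ≤ r')
    {T : Tiling A} {j : Fin B'.card} {i : Fin B.card} {w v : Plane} (hw : w ∈ B'.plaque j)
    (hv : v ∈ B.plaque i) (hT : T ∈ B'.transversalAt j w) (hT' : T ∈ B.transversalAt i v) :
    B'.transversalAt j w ⊆ B.transversalAt i v := by
  obtain ⟨_, h1, rfl⟩ := hT
  obtain ⟨g, hg, -, rfl⟩ := B'.exists_of_mem_trans h1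
  obtain ⟨_, h2, h3⟩ := hT'
  obtain ⟨f, hf, -, rfl⟩ := B.exists_of_mem_trans h2
  have h4 : (based β g).translate (-(w - v)) = based β f := by
    have := congrArg (fun T => T.translate v) h3.symm
    simp only [translate_translate, neg_add_cancel, translate_zero] at this
    rw [← this, neg_sub, neg_add_eq_sub]
  obtain ⟨m, h5, rfl⟩ := based_eq_translate_iff.1 h4
  rw [hD'.plaque_eq j g hg] at hw
  rw [hD.plaque_eq i _ hf] at hv
  have hw' := norm_le_of_mem_cells hβ (hD'.norm_le j) hw
  have hv' := norm_le_of_mem_cells hβ (hD.norm_le i) hv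
  have hb : ∀ a, ‖β a‖ ≤ 1 := fun a => (pi_norm_le_iff_of_nonneg zero_le_one).2 fun k => by
    have := base_bounds hβ a k
    rw [Real.norm_eq_abs, abs_le]
    constructor <;> linarith
  have hm : ‖m‖ ≤ d + d' + 4 := by
    have : vec m = (w - v) + (β (g 0) - β (g m)) := by
      rw [h5]
      abel
    rw [← norm_vec, this]
    linarith [norm_add_le (w - v) (β (g 0) - β (g m)), norm_sub_le w v,
      norm_sub_le (β (g 0)) (β (g m)), hb (g 0), hb (g m)]
  rintro _ ⟨_, h6, rfl⟩
  obtain ⟨g', hg', -, rfl⟩ := B'.exists_of_mem_trans h6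
  have hgg := hag j g hg g' hg'
  have h7 : cfgShift m g' ∈ B.cfgs i :=
    hD.mem_cfgs i _ hf _ ((hgg.cfgShift m).mono (by linarith))
      (FlowBoxFamily.mem_cfgHull hf) (cfgShift_mem_cfgHull (FlowBoxFamily.mem_cfgHull hg') m)
  refine ⟨_, h7, ?_⟩
  have h8 : (based β g').translate (-(w - v)) = based β (cfgShift m g') := by
    refine based_eq_translate_iff.2 ⟨m, ?_, rfl⟩
    rw [h5, hgg 0 (by rw [norm_zero]; exact hD'.nonneg), hgg m (by linarith [hD.nonneg])]
  dsimp only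
  rw [← h8, translate_translate]
  congr 1
  abel

/-- A boundary point of a union of plaques lies in one of these plaques, and not in its interior. -/
theorem iUnion_verticalBoundary_subset (hD' : B'.IsCellData D' r' d')
    (h : ∀ f ∈ cfgHull f₀, ∀ s, ∀ Q ∈ B'.plaquesOn (ofCfg s f),
      ∃ τ ⊆ B.plaquesOn (ofCfg s f), Q = ⋃₀ τ) :
    ⋃ j, B'.verticalBoundary j ⊆ ⋃ i, B.verticalBoundary i := by
  refine iUnion_subset fun j => ?_
  rintro _ ⟨T, hT, v, hv, rfl⟩
  obtain ⟨g, hg, hg', rfl⟩ := B'.exists_of_mem_trans hT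
  have hQ : B'.plaque j ∈ B'.plaquesOn (based β g) := ⟨j, 0, by simpa using hT, by simp⟩
  obtain ⟨τ, hτ, hτ'⟩ := h g hg' _ _ hQ
  have hcl : IsClosed (B'.plaque j) := by
    rw [hD'.plaque_eq j g hg]
    exact isClosed_cells ((finite_norm_le d').subset (hD'.norm_le j))
  have hv1 : v ∈ B'.plaque j := hcl.frontier_subset hv
  rw [hτ'] at hv1
  obtain ⟨Q, hQ, hvQ⟩ := hv1
  refine mem_iUnion.2 (B.translate_mem_verticalBoundary (hτ hQ) hvQ fun hi => hv.2 ?_)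
  refine interior_mono ?_ hi
  rw [hτ']
  exact subset_sUnion_of_mem hQ

theorem exists_robinsonInflation (hβ : ∀ a, β a ∈ interior (square 1 0))
    (hper : ∀ D : ℝ, ∃ r : ℝ, ∀ f ∈ cfgHull f₀, ∀ w, ‖w‖ ≤ D → AgreeOn r f (cfgShift w f) → w = 0)
    (hB : B.IsBoxDecomposition) {d : ℝ} (hd0 : 0 ≤ d)
    (hd : ∀ i, B.plaque i ⊆ Metric.closedBall 0 d) {N : ℕ} (hN : 8 * d + 20 ≤ N) :
    ∃ B' : FlowBoxFamily β (ofCfg s₀ f₀).hull, B'.IsBoxDecomposition ∧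
      (∀ i, B'.plaque i ⊆ Metric.closedBall 0 (4 * N + 1)) ∧ IsRobinsonInflation B B' N := by
  obtain ⟨D, r, hD⟩ := B.exists_isCellData hβ hd
  set δ := d + 1 with hδ
  have hN0 : 0 < N := by
    have : (0 : ℝ) < N := by linarith
    exact_mod_cast this
  obtain ⟨F, E, rE, hF, hrE, hEc, hEF⟩ := exists_square_family (s₀ := s₀) hβ hper hN0
  have hE : IsSquareData f₀ E N rE := ⟨hrE, hEc, fun s f hf => (hEF s f hf).2⟩
  obtain ⟨ρ, hρ⟩ := hper (2 * (4 * N) + 2)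
  set h : ℕ := N / 2 with hh
  have hh1 : (2 * h : ℝ) ≤ N := by exact_mod_cast (by lia : 2 * h ≤ N)
  have hh2 : (N : ℝ) ≤ 2 * h + 1 := by exact_mod_cast (by lia : N ≤ 2 * h + 1)
  -- The new plaques are based at the middle cell of their square instead of its corner: the middle
  -- certainly belongs to the inflated tile, the corner might not.
  set c : Fin 2 → ℤ := fun _ => -h with hc
  have hcn : ‖c‖ ≤ h := by
    refine (pi_norm_le_iff_of_nonneg (by positivity)).2 fun i => ?_
    simp [hc]
  have hci : ∀ i, (c i : ℝ) = -h := fun i => by simp [hc]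
  set E' : Set ((Fin 2 → ℤ) → A) := {f | cfgShift c f ∈ E} with hE'
  set cl : ((Fin 2 → ℤ) → A) → Set (Fin 2 → ℤ) :=
    fun f => {n | n - c ∈ B.inflatedCells D E N (cfgShift c f)} with hcl
  have hr := hD.nonneg
  -- The term `30 * N` covers the window `22 * N`, the shift by `c`, and the margin `δ + 4 * N + 4`
  -- used by `transversalAt_subset`.
  set R : ℝ := 30 * N + r + rE + |ρ| with hR
  have hρ0 := abs_nonneg ρ
  have hρ1 := le_abs_self ρ
  -- This needs `4 * δ + 4 < h`, about half of `N`; the hypothesis `8 * d + 20 ≤ N` is made for it.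
  have hnear : ∀ f ∈ cfgHull f₀, f ∈ E' → ∀ n : Fin 2 → ℤ, ‖n‖ ≤ 2 * δ + 3 → n ∈ cl f :=
    fun f hf hfE n hn => hD.mem_inflatedCells_of_norm_le hB hE hf hfE
      (fun i => by rw [hci i]; constructor <;> linarith) hn
  have hloc : LocalPlaques f₀ E' cl R (4 * N) := by
    refine ⟨fun f hf g hg hfg hfE => ?_, fun f hf _ n hn => ?_, fun f hf hfE => ?_,
      fun f hf m m' k hm hm' hk hk' => ?_, by linarith, by linarith,
      fun f hf w hw hag => hρ f hf w hw (hag.mono (by linarith))⟩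
    · have h1 := (hfg.cfgShift c).mono (r' := 22 * N + r + rE) (by linarith)
      refine ⟨(hE.congr _ _ (h1.mono (by linarith))).1 hfE, ?_⟩
      have h2 := cfgShift_mem_cfgHull hf c
      have h3 := cfgShift_mem_cfgHull hg c
      have h4 := (hD.inflatedCells_subset hE (by linarith) h2 h3 h1).antisymm
        (hD.inflatedCells_subset hE (by linarith) h3 h2 h1.symm)
      simp only [hcl, h4]
    -- The sum `3 * N + 2 * δ + 1 + h` is at most `4 * N`.
    · have h1 := hD.norm_le_of_mem_inflatedCells hE (cfgShift_mem_cfgHull hf c) hn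
      linarith [norm_sub_norm_le n c]
    · exact hnear f hf hfE 0 (by rw [norm_zero]; linarith)
    · simp only [hE', hcl, mem_ofPred_eq, cfgShift_cfgShift, sub_sub] at hm hm' hk hk'
      rw [add_comm c m] at hm hk
      rw [add_comm c m'] at hm' hk'
      exact add_right_cancel (hD.eq_of_mem_inflatedCells hβ hE hf hm hm' hk hk')
  obtain ⟨B', D', hD', hB'1, hB'2, hB'3⟩ := hloc.exists_family (s₀ := s₀) hβ
  have hdec : B'.IsBoxDecomposition := by
    refine hD'.isBoxDecomposition fun f hf k => ?_
    obtain ⟨k₀, h1, h2⟩ := hD.exists_mem_inflatedCells hB hE hf k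
    have h3 : cfgShift c (cfgShift (k₀ - c) f) = cfgShift k₀ f := by
      rw [cfgShift_cfgShift, add_sub_cancel]
    obtain ⟨i, hi⟩ := hB'2 (cfgShift (k₀ - c) f) (cfgShift_mem_cfgHull hf _)
      (by rwa [hE', mem_ofPred_eq, h3])
    refine ⟨i, _, hi, ?_⟩
    rw [(hB'1 i _ hi).2, hcl, mem_ofPred_eq, h3, sub_sub, sub_add_cancel]
    exact h2
  have hcells : ∀ s, ∀ f ∈ cfgHull f₀, ∀ m, cells (s + vec m) (cl (cfgShift m f)) =
      inflatedTile (B.plaquesOn (ofCfg s f)) (cornerSet E s f) N (s + vec (c + m)) := by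
    intro s f hf m
    rw [← hD.cells_inflatedCells (hE.packing s f hf)]
    ext x
    simp only [mem_cells, hcl, mem_ofPred_eq, cfgShift_cfgShift]
    constructor
    · rintro ⟨n, hn, hx⟩
      refine ⟨n - c, hn, ?_⟩
      rwa [add_assoc, ← vec_add, show c + m + (n - c) = m + n by abel, vec_add, ← add_assoc]
    · rintro ⟨n, hn, hx⟩
      refine ⟨n + c, by rwa [add_sub_cancel_right], ?_⟩
      rwa [add_assoc, ← vec_add, show m + (n + c) = c + m + n by abel, vec_add, ← add_assoc]
  have hpl : ∀ s, ∀ f ∈ cfgHull f₀, B'.plaquesOn (ofCfg s f) =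
      inflatedTile (B.plaquesOn (ofCfg s f)) (cornerSet E s f) N '' cornerSet E s f := by
    intro s f hf
    ext Q
    rw [hD'.mem_plaquesOn]
    constructor
    · rintro ⟨i, m, hm, rfl⟩
      obtain ⟨h1, h2⟩ := hB'1 i _ hm
      rw [h2, hcells s f hf]
      refine ⟨_, vec_mem_cornerSet.2 ?_, rfl⟩
      rwa [← cfgShift_cfgShift]
    · rintro ⟨_, ⟨k, hk, rfl⟩, rfl⟩
      have h3 : cfgShift c (cfgShift (k - c) f) = cfgShift k f := by
        rw [cfgShift_cfgShift, add_sub_cancel]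
      obtain ⟨i, hi⟩ := hB'2 (cfgShift (k - c) f) (cfgShift_mem_cfgHull hf _)
        (by rwa [hE', mem_ofPred_eq, h3])
      refine ⟨i, k - c, hi, ?_⟩
      rw [(hB'1 i _ hi).2, hcells s f hf, add_sub_cancel]
  refine ⟨B', hdec, fun j v hv => ?_, ⟨fun T j i w hw v hv hT hT' =>
    transversalAt_subset hβ hD hD' hB'3 (by linarith) hw hv hT hT',
    iUnion_verticalBoundary_subset hD' fun f hf s Q hQ => ?_, fun T hT Q hQ => ?_⟩,
    F, hF, fun T hT => ?_⟩
  · obtain ⟨T, hT⟩ := B'.trans_nonempty j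
    obtain ⟨f, hf, -, rfl⟩ := B'.exists_of_mem_trans hT
    rw [hD'.plaque_eq j f hf] at hv
    exact mem_closedBall_zero_iff.2 (norm_le_of_mem_cells hβ (hD'.norm_le j) hv)
  · rw [hpl s f hf] at hQ
    obtain ⟨p, -, rfl⟩ := hQ
    exact ⟨_, fun t ht => ht.1, (sUnion_eq_biUnion).symm⟩
  · obtain ⟨s, f, rfl⟩ := exists_ofCfg T
    have hf := mem_hull_iff.1 hT
    obtain ⟨j, m, hm, rfl⟩ := hD'.mem_plaquesOn.1 hQ
    -- The old plaque through the central cell lies in the interior: a point within `1` of it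
    -- belongs to a cell at distance at most `2 * δ + 3` from the center, adding `1` for the cell,
    -- `1` for the ball, `δ + 1` for the plaque and `δ` for the central cell within it.
    obtain ⟨i, m₀, h1, h2⟩ := hD.exists_mem hB hf m
    refine ⟨_, hD.mem_plaquesOn.2 ⟨i, m₀, h1, rfl⟩, fun x hx => ?_⟩
    obtain ⟨h3, h4⟩ := hB'1 j _ hm
    rw [h4]
    refine mem_interior.2 ⟨Metric.ball x 1, fun y hy => ?_, Metric.isOpen_ball,
      Metric.mem_ball_self one_pos⟩
    obtain ⟨n, hn⟩ := exists_mem_cell (s + vec m) y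
    refine mem_cells.2 ⟨n, hnear _ (cfgShift_mem_cfgHull hf m) h3 n ?_, hn⟩
    have d1 := dist_le_of_mem_square one_pos hn
    have d2 := norm_sub_le_of_mem_cells (hD.norm_le i) hx
    have d3 := hD.norm_le i _ h2
    have d4 := Metric.mem_ball.1 hy
    rw [dist_eq_norm, norm_sub_rev] at d1
    rw [dist_eq_norm] at d4
    have key : vec n = -(y - (s + vec m + vec n)) + (y - x) + (x - (s + vec m₀)) - vec (m - m₀) := by
      rw [sub_eq_add_neg m, vec_add, vec_neg]
      abel
    rw [← norm_vec] at d3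
    rw [← norm_vec, key]
    refine (norm_sub_le _ _).trans ?_
    refine (add_le_add_left (norm_add₃_le) _).trans ?_
    rw [norm_neg]
    linarith
  · obtain ⟨s, f, rfl⟩ := exists_ofCfg T
    have hf := mem_hull_iff.1 hT
    rw [(hEF s f hf).1, hpl s f hf]

end InflationStep

end RobinsonTiling

/-! ### Iteration of the inflation -/

theorem mainTheorem6 {A : Type*} [Finite A] (β : A → RobinsonTiling.Plane)
    (hβ : ∀ a, β a ∈ interior (RobinsonTiling.square 1 0))
    (T : RobinsonTiling.Tiling A) (hap : T.Aperiodic) (hrep : T.Repetitive)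
    (B : RobinsonTiling.FlowBoxFamily β T.hull) (hB : B.IsBoxDecomposition) :
    ∃ K : ℕ, ∀ N : ℕ → ℕ, K ≤ N 1 → (∀ n, 1 ≤ n → K * N n ≤ N (n + 1)) →
      ∃ B'' : ℕ → RobinsonTiling.FlowBoxFamily β T.hull,
        B'' 0 = B ∧ (∀ n, (B'' n).IsBoxDecomposition) ∧
        ∀ n, RobinsonTiling.IsRobinsonInflation (B'' n) (B'' (n + 1)) (N (n + 1)) := by
  let _ : TopologicalSpace A := ⊥
  have : DiscreteTopology A := ⟨rfl⟩
  obtain ⟨s₀, f₀, rfl⟩ := RobinsonTiling.exists_ofCfg T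
  obtain ⟨d, hd⟩ := B.exists_bound
  -- Later plaques have radius `4 * N n + 1`, and `8 * (4 * N n + 1) + 20 ≤ 60 * N n` because `N n ≥
  -- 1`; the term `8 * d` serves the first step.
  refine ⟨8 * d + 60, fun N h1 h2 => ?_⟩
  have hN : ∀ n, 1 ≤ N (n + 1) := by
    intro n
    induction n with
    | zero => lia
    | succ n ih => nlinarith [h2 (n + 1) (by lia)]
  let P : ℕ → RobinsonTiling.FlowBoxFamily β (RobinsonTiling.ofCfg s₀ f₀).hull → Prop := fun n C =>
    C.IsBoxDecomposition ∧
      ∀ i, C.plaque i ⊆ Metric.closedBall 0 ((if n = 0 then d else 4 * N n + 1 : ℕ) : ℝ)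
  have step : ∀ n (C : {C // P n C}), ∃ C' : {C // P (n + 1) C},
      RobinsonTiling.IsRobinsonInflation C.1 C'.1 (N (n + 1)) := by
    rintro n ⟨C, hC, hC'⟩
    obtain ⟨C', h3, h4, h5⟩ := RobinsonTiling.exists_robinsonInflation hβ
      (RobinsonTiling.exists_forall_eq_zero hap hrep) hC (by positivity) hC' (N := N (n + 1)) (by
        norm_cast
        split_ifs with hn
        · subst hn
          lia
        · obtain ⟨n, rfl⟩ := Nat.exists_eq_succ_of_ne_zero hn
          have := hN n
          have := h2 (n + 1) (by lia)
          simp only [Nat.succ_eq_add_one] at *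
          nlinarith)
    refine ⟨⟨C', h3, ?_⟩, h5⟩
    simpa using h4
  choose next hnext using step
  let S : ∀ n, {C // P n C} := fun n => Nat.rec ⟨B, hB, by simpa using hd⟩ next n
  exact ⟨fun n => (S n).1, rfl, fun n => (S n).2.1, fun n => hnext n (S n)⟩
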